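/- Let $F(x)=f(x)+h(x)+g(Kx)$ with $K\in\mathbb R^{d\times p}$, $f(x)=\sum_{j=1}^n f_j(x_j)$ and $g(r)=\sum_{i=1}^m g_i(r_i)$ block separable ($m,n\ge 1$; $x_j\in\mathbb R^{p_j}$, $r_i\in\mathbb R^{d_i}$), and put $\phi=f+h$, $G(y)=\phi^*(-K^\top y)+g^*(y)$, $F^\star=\inf F$. Assume that $f,g$ are proper, closed and convex with values in $\mathbb R\cup\{+\infty\}$; $h$ is convex, differentiable and satisfies $\|\nabla_{x_j}h(x+U_jd_j)-\nabla_{x_j}h(x)\|\le L^h_j\|d_j\|$ for all $x,j,d_j$, where $U_j$ is the inclusion of the $j$-th block; the set $\mathcal X^\star$ of minimizers of $F$ is nonempty; and $0\in\mathrm{ri}(\mathrm{dom}\,g-K\,\mathrm{dom}\,\phi)$. Assume that each $f_j$ is $\mu_{f_j}$-strongly convex with $\mu_{f_j}>0$ and each $g_i$ is $\mu_{g_i}$-strongly convex with $\mu_{g_i}>0$. Let $\mathcal Y^\star$ be the set of minimizers of $G$. Given weights $\sigma_j>0$, let $\bar L_\sigma=\|K\,\mathrm{diag}(1/\sqrt\sigma)\|^2$,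 $L^h_\sigma=\max_j L^h_j/\sigma_j$, $\mu_g=\min_i\mu_{g_i}$, $\mu^f_\sigma=\min_j\mu_{f_j}/\sigma_j$; assume $L^h_\sigma+\bar L_\sigma>0$, so that $\beta_k$ below is well defined. Let $\hat q_i=1/m$, $q_j=1/n$, $\tau_0=\min\{1/m,1/n\}$. Let $c\ge 2$ with $c\tau_0>2$, let $\rho_0>0$ with $\rho_0\le\frac18\mu_g$ and $\rho_0\bar L_\sigma\le\frac18\mu^f_\sigma$, and for $k\ge0$ let $$\tau_k=\frac{c\tau_0}{k+c},\quad \rho_k=\frac{\rho_0\tau_0^2}{\tau_k^2},\quad \gamma_k=\frac1{4\rho_k},\quad \beta_k=\frac1{L^h_\sigma+4\bar L_\sigma\rho_k},\quad \eta_k=\frac{\rho_k}2 .$$ Let $x^0\in\mathrm{dom}\,f$ and $\hat y^0\in\mathbb R^d$. Start from $\tilde x^0=x^0$, $r^0=\tilde r^0=Kx^0$, and for $k=0,1,\dots$ set $\hat r^k=(1-\tau_k)r^k+\tau_k\tilde r^k$, $\hat x^k=(1-\tau_k)x^k+\tau_k\tilde x^k$; draw independent, uniformly distributed $i_k\in\{1,\dots,m\}$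 and $j_k\in\{1,\dots,n\}$, independently of the past; keep all blocks of $\tilde r^k,\tilde x^k$ except, for $i=i_k$ and $j=j_k$, $$\tilde r_i^{k+1}=\mathrm{prox}_{\gamma_k\tau_0g_i/\tau_k}\Big(\tilde r_i^k-\tfrac{\tau_0\gamma_k}{\tau_k}\big[-\hat y_i^k+\rho_k(\hat r_i^k-(K\hat x^k)_i)\big]\Big),$$ $$\tilde x_j^{k+1}=\mathrm{prox}_{\tau_0\beta_kf_j/(\tau_k\sigma_j)}\Big(\tilde x_j^k-\tfrac{\tau_0\beta_k}{\tau_k\sigma_j}\big[\nabla_{x_j}h(\hat x^k)+(K^\top(\hat y^k+\rho_k(K\hat x^k-\hat r^k)))_j\big]\Big);$$ then set $r^{k+1}=\hat r^k+\frac{\tau_k}{\tau_0}(\tilde r^{k+1}-\tilde r^k)$, $x^{k+1}=\hat x^k+\frac{\tau_k}{\tau_0}(\tilde x^{k+1}-\tilde x^k)$ and $\hat y^{k+1}=\hat y^k+\eta_k[Kx^{k+1}-r^{k+1}-(1-\tau_k)(Kx^k-r^k)]$. Here $\mathrm{prox}_\psi(u)=\arg\min_v\{\psi(v)+\frac12\|v-u\|^2\}$.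 Suppose further that $g$ is $M_g$-Lipschitz continuous ($M_g\ge0$) at the points of $K(\mathrm{dom}\,f)$, in the sense that $g(u)\le g(v)+M_g\|u-v\|$ for all $u\in K(\mathrm{dom}\,f)$ and $v\in\mathbb R^d$ (for instance, $K(\mathrm{dom}\,f)\subseteq\mathrm{dom}\,g$ and $g$ is $M_g$-Lipschitz on $\mathrm{dom}\,g$). Then $F(x^k)$ is almost surely finite and integrable for every $k\ge0$, and for all $x^\star\in\mathcal X^\star$, $y^\star\in\mathcal Y^\star$ and $k\ge0$ $$\mathbb E[F(x^k)-F^\star]\le\frac{c^2\hat{\mathcal E}_0^2+c^2(M_g+\|y^\star\|)\,\hat{\mathcal E}_0\sqrt{2/\rho_0}}{(k+c-1)^2},$$ where $$\hat{\mathcal E}_0^2=F(x^0)-F^\star+\tfrac1{\rho_0}\|\hat y^0-y^\star\|^2+\tfrac{(L^h_\sigma+4\rho_0\bar L_\sigma+\mu^f_\sigma)\tau_0}2\sum_j\tfrac{\sigma_j}{q_j}\|x^0_j-x^\star_j\|^2+\tfrac{\tau_0(4\rho_0+\mu_g)}2\sum_i\tfrac1{\hat q_i}\|(K(x^0-x^\star))_i\|^2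 .$$ Moreover $$\liminf_{k\to\infty}\; k^2\sqrt{\log k}\;\mathbb E[F(x^k)-F^\star]=0,$$ that is, $\mathbb E[F(x^k)]-F^\star=\underline o\big(1/(k^2\sqrt{\log k})\big)$, where $u_k=\underline o(v_k)$ means $\liminf_{k\to\infty}u_k/v_k=0$. -/

import Mathlib

open MeasureTheory ProbabilityTheory Filter Topology
open scoped BigOperators

noncomputable section

namespace RandPD

/-! ### Extended-real-valued convex functions -/

section ConvexBasics

variable {E : Type*} [NormedAddCommGroup E] [InnerProductSpace ℝ E]

/-- The (effective) domain of an extended-real-valued function. -/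
def edom (φ : E → EReal) : Set E := {x | φ x < ⊤}

/-- Proper: finite somewhere and never `-∞`. -/
def EProper (φ : E → EReal) : Prop := (∃ x, φ x < ⊤) ∧ ∀ x, φ x ≠ ⊥

/-- Convexity of a function with values in `ℝ ∪ {+∞}`. -/
def EConvex (φ : E → EReal) : Prop :=
  ∀ x y : E, ∀ a b : ℝ, 0 < a → 0 < b → a + b = 1 →
    φ (a • x + b • y) ≤ (a : EReal) * φ x + (b : EReal) * φ y

/-- `φ` is strongly convex with parameter `μ`: `φ - (μ/2)‖·‖²` is convex. -/
def EStrongConvex (μ : ℝ) (φ : E → EReal) : Prop :=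
  EConvex fun x => φ x - ((μ / 2 * ‖x‖ ^ 2 : ℝ) : EReal)

/-- The Fenchel conjugate. -/
def econj (φ : E → EReal) (y : E) : EReal := ⨆ x, ((inner ℝ y x : ℝ) : EReal) - φ x

/-- `u` minimizes `v ↦ φ v + (1/2)‖v - x‖²`. -/
def IsProx (φ : E → EReal) (x u : E) : Prop :=
  ∀ v, φ u + ((‖u - x‖ ^ 2 / 2 : ℝ) : EReal) ≤ φ v + ((‖v - x‖ ^ 2 / 2 : ℝ) : EReal)

/-- The proximal operator: the minimizer of `v ↦ φ v + (1/2)‖v - x‖²`, which exists and is unique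
when `φ` is proper, closed and convex. -/
def prox (φ : E → EReal) (x : E) : E := Classical.epsilon (IsProx φ x)

/-- `φ` is `M`-Lipschitz continuous at the points of `S` (in particular it is finite there, if it
is proper). For `S = Set.univ` this is Lipschitz continuity on the whole space; it also holds if
`S ⊆ edom φ` and `φ` is `M`-Lipschitz on `edom φ`. -/
def LipschitzAt (M : ℝ) (φ : E → EReal) (S : Set E) : Prop :=
  ∀ u ∈ S, ∀ v, φ u ≤ φ v + ((M * ‖u - v‖ : ℝ) : EReal)

end ConvexBasics

/-! ### The composite problem in block form -/

/-- `ℝ^{s_1} × ⋯ × ℝ^{s_N}` with the Euclidean norm. -/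
abbrev Block {N : ℕ} (s : Fin N → ℕ) : Type := PiLp 2 fun j => EuclideanSpace ℝ (Fin (s j))

/-- The inclusion `U_j` of the `j`-th block. -/
def blockIncl {N : ℕ} {s : Fin N → ℕ} (j : Fin N) (v : EuclideanSpace ℝ (Fin (s j))) : Block s :=
  WithLp.toLp 2 (Pi.single j v)

/-- Replace the `j`-th block of `x` by `v`. -/
def setBlock {N : ℕ} {s : Fin N → ℕ} (x : Block s) (j : Fin N)
    (v : EuclideanSpace ℝ (Fin (s j))) : Block s :=
  WithLp.toLp 2 (Function.update (WithLp.ofLp x) j v)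

/-- The squared weighted norm `∑_j w_j ‖x_j‖²`. -/
def wnormSq {N : ℕ} {s : Fin N → ℕ} (w : Fin N → ℝ) (x : Block s) : ℝ :=
  ∑ j, w j * ‖x j‖ ^ 2

/-- The linear map multiplying the `j`-th block by `a j`. -/
def blockDiag {N : ℕ} (s : Fin N → ℕ) (a : Fin N → ℝ) : Block s →L[ℝ] Block s :=
  LinearMap.toContinuousLinearMap
    { toFun := fun x => WithLp.toLp 2 fun j => a j • x j
      map_add' := fun x y => by ext j l; simp
      map_smul' := fun t x => by ext j l; simp [mul_left_comm] }

/-- The data of `min_x f(x) + h(x) + g(Kx)` with block separable `f` and `g`. -/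
structure Problem {m n : ℕ} (p : Fin n → ℕ) (d : Fin m → ℕ) where
  /-- the components of `f` -/
  f : ∀ j : Fin n, EuclideanSpace ℝ (Fin (p j)) → EReal
  /-- the components of `g` -/
  g : ∀ i : Fin m, EuclideanSpace ℝ (Fin (d i)) → EReal
  /-- the smooth term -/
  h : Block p → ℝ
  /-- the coupling matrix -/
  K : Block p →L[ℝ] Block d

namespace Problem

variable {m n : ℕ} {p : Fin n → ℕ} {d : Fin m → ℕ} (Pb : Problem p d)

/-- `f(x) = ∑_j f_j(x_j)`. -/
def fSum (x : Block p) : EReal := ∑ j, Pb.f j (x j)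

/-- `g(r) = ∑_i g_i(r_i)`. -/
def gSum (r : Block d) : EReal := ∑ i, Pb.g i (r i)

/-- `φ = f + h`. -/
def phi (x : Block p) : EReal := Pb.fSum x + (Pb.h x : EReal)

/-- The primal objective `F(x) = f(x) + h(x) + g(Kx)`. -/
def F (x : Block p) : EReal := Pb.phi x + Pb.gSum (Pb.K x)

/-- The dual objective `G(y) = φ*(-Kᵀy) + g*(y)`. -/
def G (y : Block d) : EReal :=
  econj Pb.phi (-(ContinuousLinearMap.adjoint Pb.K y)) + econj Pb.gSum y

/-- The primal optimal value `F⋆`. -/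
def Fstar : EReal := ⨅ x, Pb.F x

/-- The primal solution set. -/
def primalSol : Set (Block p) := {x | ∀ z, Pb.F x ≤ Pb.F z}

/-- The dual solution set. -/
def dualSol : Set (Block d) := {y | ∀ z, Pb.G y ≤ Pb.G z}

/-- The standing assumptions on the problem; `Lh j` is the smoothness constant of `h` with respect
to the `j`-th block. -/
structure Standing (Lh : Fin n → ℝ) : Prop where
  f_proper : EProper Pb.fSum
  f_closed : LowerSemicontinuous Pb.fSum
  f_convex : EConvex Pb.fSum
  g_proper : EProper Pb.gSum
  g_closed : LowerSemicontinuous Pb.gSum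
  g_convex : EConvex Pb.gSum
  h_convex : ConvexOn ℝ Set.univ Pb.h
  h_diff : Differentiable ℝ Pb.h
  Lh_nonneg : ∀ j, 0 ≤ Lh j
  h_smooth : ∀ (j : Fin n) (x : Block p) (v : EuclideanSpace ℝ (Fin (p j))),
    ‖gradient Pb.h (x + blockIncl j v) j - gradient Pb.h x j‖ ≤ Lh j * ‖v‖
  sol_nonempty : Pb.primalSol.Nonempty
  slater : (0 : Block d) ∈
    intrinsicInterior ℝ {z | ∃ r ∈ edom Pb.gSum, ∃ x ∈ edom Pb.phi, z = r - Pb.K x}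

/-- `L̄_σ = ‖K diag(1/√σ)‖²`. -/
def Lbar (σ : Fin n → ℝ) : ℝ := ‖Pb.K.comp (blockDiag p fun j => 1 / √(σ j))‖ ^ 2

end Problem

/-- `L^h_σ = max_j L^h_j / σ_j`. -/
def LhSigma {n : ℕ} (σ Lh : Fin n → ℝ) : ℝ := ⨆ j, Lh j / σ j

/-- `μ^f_σ = min_j μ_{f_j} / σ_j`. -/
def muSigma {n : ℕ} (σ μf : Fin n → ℝ) : ℝ := ⨅ j, μf j / σ j

/-- `μ_g = min_i μ_{g_i}`. -/
def muMin {m : ℕ} (μg : Fin m → ℝ) : ℝ := ⨅ i, μg i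

/-- `τ_0 = min {min_i q̂_i, min_j q_j}`. -/
def tauZero {m n : ℕ} (qhat : Fin m → ℝ) (q : Fin n → ℝ) : ℝ := min (⨅ i, qhat i) (⨅ j, q j)

/-! ### The fully randomized primal-dual algorithm -/

/-- The parameter sequences of the algorithm. -/
structure Params where
  τ : ℕ → ℝ
  ρ : ℕ → ℝ
  γ : ℕ → ℝ
  β : ℕ → ℝ
  η : ℕ → ℝ

/-- The parameter update `τ_k = cτ₀/(k+c)`, `ρ_k = ρ₀τ₀²/τ_k²`, `γ_k = 1/(4ρ_k)`,
`β_k = 1/(L^h_σ + 4 L̄_σ ρ_k)`, `η_k = ρ_k/2`. -/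
def strongParams (c τ₀ ρ₀ Lhσ Lbarσ : ℝ) : Params :=
  let τ : ℕ → ℝ := fun k => c * τ₀ / (k + c)
  let ρ : ℕ → ℝ := fun k => ρ₀ * τ₀ ^ 2 / τ k ^ 2
  { τ := τ
    ρ := ρ
    γ := fun k => 1 / (4 * ρ k)
    β := fun k => 1 / (Lhσ + 4 * Lbarσ * ρ k)
    η := fun k => ρ k / 2 }

/-- The state `(x^k, x̃^k, r^k, r̃^k, ŷ^k, ȳ^k)` of the algorithm. -/
structure State {m n : ℕ} (p : Fin n → ℕ) (d : Fin m → ℕ) where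
  x : Block p
  xt : Block p
  r : Block d
  rt : Block d
  yhat : Block d
  ybar : Block d

namespace Problem

variable {m n : ℕ} {p : Fin n → ℕ} {d : Fin m → ℕ} (Pb : Problem p d)

/-- One iteration of the algorithm with parameters `τ = τ_k`, …, when the indices `i = i_k` and
`j = j_k` are drawn. -/
def step (σ : Fin n → ℝ) (τ₀ τ ρ γ β η : ℝ) (i : Fin m) (j : Fin n) (s : State p d) :
    State p d :=
  let rhat : Block d := (1 - τ) • s.r + τ • s.rt
  let xhat : Block p := (1 - τ) • s.x + τ • s.xt
  let Δr : EuclideanSpace ℝ (Fin (d i)) := -(s.yhat i) + ρ • (rhat i - Pb.K xhat i)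
  let Δx : EuclideanSpace ℝ (Fin (p j)) := gradient Pb.h xhat j +
    (ContinuousLinearMap.adjoint Pb.K (s.yhat + ρ • (Pb.K xhat - rhat))) j
  let rt' : Block d := setBlock s.rt i
    (prox (fun u => ((γ * τ₀ / τ : ℝ) : EReal) * Pb.g i u) (s.rt i - (τ₀ * γ / τ) • Δr))
  let xt' : Block p := setBlock s.xt j
    (prox (fun u => ((τ₀ * β / (τ * σ j) : ℝ) : EReal) * Pb.f j u)
      (s.xt j - (τ₀ * β / (τ * σ j)) • Δx))
  let r' : Block d := rhat + (τ / τ₀) • (rt' - s.rt)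
  let x' : Block p := xhat + (τ / τ₀) • (xt' - s.xt)
  { x := x'
    xt := xt'
    r := r'
    rt := rt'
    yhat := s.yhat + η • (Pb.K x' - r' - (1 - τ) • (Pb.K s.x - s.r))
    ybar := (1 - τ) • s.ybar + τ • (s.yhat + ρ • (Pb.K xhat - rhat)) }

/-- The `k`-th state of the algorithm started at `(x^0, ŷ^0)` when the sequence of drawn indices
is `idx`. -/
def run (σ : Fin n → ℝ) (τ₀ : ℝ) (π : Params) (x₀ : Block p) (y₀ : Block d)
    (idx : ℕ → Fin m × Fin n) : ℕ → State p d
  | 0 => { x := x₀, xt := x₀, r := Pb.K x₀, rt := Pb.K x₀, yhat := y₀, ybar := y₀ }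
  | k + 1 => Pb.step σ τ₀ (π.τ k) (π.ρ k) (π.γ k) (π.β k) (π.η k) (idx k).1 (idx k).2
      (run σ τ₀ π x₀ y₀ idx k)

/-- The constant `Ê₀²` of the convergence rate. -/
def E0sq (σ Lh μf : Fin n → ℝ) (μg : Fin m → ℝ) (qhat : Fin m → ℝ) (q : Fin n → ℝ) (ρ₀ : ℝ)
    (x₀ xs : Block p) (y₀ ys : Block d) : ℝ :=
  ((Pb.F x₀).toReal - Pb.Fstar.toReal) + 1 / ρ₀ * ‖y₀ - ys‖ ^ 2
    + (LhSigma σ Lh + 4 * ρ₀ * Pb.Lbar σ + muSigma σ μf) * tauZero qhat q / 2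
        * wnormSq (fun j => σ j / q j) (x₀ - xs)
    + tauZero qhat q * (4 * ρ₀ + muMin μg) / 2
        * wnormSq (fun i => 1 / qhat i) (Pb.K (x₀ - xs))

end Problem

/-- The random indices of the algorithm: `i_k ∼ q̂`, `j_k ∼ q`, `i_k` and `j_k` independent, and
the pairs `(i_k, j_k)`, `k = 0, 1, …`, independent of each other. -/
structure IsSampling {Ω : Type*} [MeasurableSpace Ω] (P : Measure Ω) {m n : ℕ}
    (qhat : Fin m → ℝ) (q : Fin n → ℝ) (I : ℕ → Ω → Fin m) (J : ℕ → Ω → Fin n) : Prop where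
  meas_i : ∀ k, Measurable (I k)
  meas_j : ∀ k, Measurable (J k)
  law_i : ∀ k a, P.real {ω | I k ω = a} = qhat a
  law_j : ∀ k b, P.real {ω | J k ω = b} = q b
  indep_pair : ∀ k, IndepFun (I k) (J k) P
  indep_time : iIndepFun (fun k ω => (I k ω, J k ω)) P

/-- `u_k = o̲(v_k)`, i.e. `liminf_k u_k / v_k = 0` (the liminf is taken in `[-∞, ∞]`). -/
def SmallOLiminf (u v : ℕ → ℝ) : Prop :=
  liminf (fun k => ((u k / v k : ℝ) : EReal)) atTop = 0

end RandPD

end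

/-! Write Z = K x - r for the residual and let y⋆ be a Lagrange multiplier. The gap S = f(x) + h(x)
+ g(r) + ⟨y⋆, Z⟩ - F⋆ is nonnegative. Multipliers exist by `exists_multiplier`, a Hahn-Banach
argument under the relative interior condition, and every dual solution is one by
`multiplier_of_mem_dualSol`. The proof follows the augmented gap S + (ρ/2)‖Z‖² along the iterations.

The points x^k and r^k are convex combinations of the auxiliary points x̃ and r̃ (`avgSeq_mem`).
Hence f(x^k) and g(r^k) are bounded by the same combinations `fBar`, `gBar` of the values at the
auxiliary points. These bounds are affine in the newest value, and a step changes one block of x̃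
and one of r̃, so the bound for one step is a constant plus a term of block j plus a term of block
i, and averaging over the indices decouples (`average_add`). The multiplier update
(`augmented_update_le`), the descent lemma for h (`block_descent`) and the prox inequalities
(`block_progress`) combine into the one-step estimate `average_step_le`.

Multiplying that estimate by (k+c)²/c² = ρ_k/ρ₀ gives the dual distance the constant weight 1/ρ₀.
The weights of the primal distances then grow with ρ_k; strong convexity pays for this growth
because of the factors 1/8 (`coef_le`). Since cτ₀ > 2, the weight of the gap leaves a surplus
proportional to (k+c) times the gap (`scale_step_le`). So the expected gap e_k is O(1/k²) and
moreover ∑ k e_k converges (`expectation_bounds`).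

Replacing r^k by K x^k costs (M + ‖y⋆‖)‖Z‖, and the penalty gives ‖Z‖ = O(√gap / k); together these
yield the O(1/k²) rate for F. If k²√(log k) E[F(x^k) - F⋆] stayed above some ε > 0, then k² log k ·
e_k would stay bounded below, so ∑ k e_k would dominate the divergent series ∑ 1/(k log k)
(`frequently_lt_of_summable`). -/

namespace RandPD

/-! ### Extended-real convex functions and the proximal step. -/

section ConvexFacts

lemma coe_toReal_of_mem_edom {E : Type*} {φ : E → EReal} (hb : ∀ x, φ x ≠ ⊥) {x : E}
    (hx : φ x < ⊤) : ((φ x).toReal : EReal) = φ x :=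
  EReal.coe_toReal (ne_of_lt hx) (hb x)

variable {E : Type*} [NormedAddCommGroup E] [InnerProductSpace ℝ E]

/-- A convex extended-real-valued function is convex on its domain. -/
lemma EConvex.convexOn {φ : E → EReal} (hb : ∀ x, φ x ≠ ⊥) (hφ : EConvex φ) :
    ConvexOn ℝ (edom φ) fun x => (φ x).toReal := by
  have key : ∀ ⦃x⦄, x ∈ edom φ → ∀ ⦃y⦄, y ∈ edom φ → ∀ ⦃a b : ℝ⦄, 0 < a → 0 < b → a + b = 1 →
      φ (a • x + b • y) ≤ ((a * (φ x).toReal + b * (φ y).toReal : ℝ) : EReal) := by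
    intro x hx y hy a b ha hb' hab
    have := hφ x y a b ha hb' hab
    rw [← coe_toReal_of_mem_edom hb hx, ← coe_toReal_of_mem_edom hb hy] at this
    exact_mod_cast this
  rw [convexOn_iff_forall_pos]
  refine ⟨?_, ?_⟩
  · rw [convex_iff_forall_pos]
    intro x hx y hy a b ha hb' hab
    exact (key hx hy ha hb' hab).trans_lt (EReal.coe_lt_top _)
  · intro x hx y hy a b ha hb' hab
    have h := key hx hy ha hb' hab
    have hz : a • x + b • y ∈ edom φ := h.trans_lt (EReal.coe_lt_top _)
    rw [← coe_toReal_of_mem_edom hb hz] at h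
    exact_mod_cast h

/-- Subtracting a finite quadratic changes neither the domain nor properness, so the convex case
applies to the difference. -/
lemma EStrongConvex.strongConvexOn {φ : E → EReal} {μ : ℝ} (hb : ∀ x, φ x ≠ ⊥)
    (hφ : EStrongConvex μ φ) : StrongConvexOn (edom φ) μ fun x => (φ x).toReal := by
  rw [strongConvexOn_iff_convex]
  have hdom : edom (fun x => φ x - ((μ / 2 * ‖x‖ ^ 2 : ℝ) : EReal)) = edom φ := by
    ext x
    simp only [edom, Set.mem_ofPred_eq]
    generalize μ / 2 * ‖x‖ ^ 2 = t
    generalize hy : φ x = y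
    have := hb x
    induction y with
    | bot => simp
    | coe r => simp only [← EReal.coe_sub, EReal.coe_lt_top]
    | top => simp
  have hb' : ∀ x, φ x - ((μ / 2 * ‖x‖ ^ 2 : ℝ) : EReal) ≠ ⊥ := by
    intro x
    have := hb x
    generalize μ / 2 * ‖x‖ ^ 2 = t
    generalize φ x = y at this
    induction y with
    | bot => simp at this
    | coe r => rw [← EReal.coe_sub]; exact EReal.coe_ne_bot _
    | top => simp
  have h := EConvex.convexOn hb' hφ
  rw [hdom] at h
  refine h.congr fun x hx => ?_
  simp only []
  rw [← coe_toReal_of_mem_edom hb hx, ← EReal.coe_sub, EReal.toReal_coe, EReal.toReal_coe]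

/-- The strong convexity inequality at a convex combination. -/
lemma StrongConvexOn.le_segment {s : Set E} {μ : ℝ} {f : E → ℝ} (hf : StrongConvexOn s μ f)
    {u v : E} (hu : u ∈ s) (hv : v ∈ s) {t : ℝ} (h0 : 0 ≤ t) (h1 : t ≤ 1) :
    f (u + t • (v - u)) ≤ (1 - t) * f u + t * f v - t * (1 - t) * (μ / 2) * ‖v - u‖ ^ 2 := by
  have h := hf.2 hu hv (show 0 ≤ 1 - t by linarith) h0 (by ring)
  have he : (1 - t) • u + t • v = u + t • (v - u) := by module
  rw [he] at h
  simp only [smul_eq_mul] at h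
  rw [norm_sub_rev u v] at h
  linarith

lemma Convex.add_smul_sub_mem_edom {φ : E → EReal} {μ : ℝ}
    (hs : StrongConvexOn (edom φ) μ fun x => (φ x).toReal) {u v : E} (hu : u ∈ edom φ)
    (hv : v ∈ edom φ) {t : ℝ} (h0 : 0 ≤ t) (h1 : t ≤ 1) : u + t • (v - u) ∈ edom φ := by
  have he : (1 - t) • u + t • v = u + t • (v - u) := by module
  rw [← he]
  exact hs.1 hu hv (by linarith) h0 (by ring)

/-- A strongly convex function exceeds its value at `v₀` far away from `v₀`. -/
lemma exists_radius_of_strongConvex [ProperSpace E] {φ : E → EReal} {μ : ℝ}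
    (hb : ∀ x, φ x ≠ ⊥) (hl : LowerSemicontinuous φ) (hμ : 0 < μ)
    (hs : StrongConvexOn (edom φ) μ fun x => (φ x).toReal) {v₀ : E} (hv₀ : v₀ ∈ edom φ) :
    ∃ R : ℝ, 0 < R ∧ ∀ v ∈ edom φ, R ≤ ‖v - v₀‖ → (φ v₀).toReal ≤ (φ v).toReal := by
  obtain ⟨b, hbm, hbmin⟩ := LowerSemicontinuousOn.exists_isMinOn (f := φ)
    (Metric.nonempty_closedBall.2 zero_le_one : (Metric.closedBall v₀ 1).Nonempty)
    (isCompact_closedBall v₀ 1) (hl.lowerSemicontinuousOn _)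
  have hb0 : φ b ≤ φ v₀ := hbmin (Metric.mem_closedBall_self zero_le_one)
  have hbd : b ∈ edom φ := hb0.trans_lt hv₀
  set C := (φ v₀).toReal - (φ b).toReal with hC
  have hC0 : 0 ≤ C := by
    rw [← coe_toReal_of_mem_edom hb hbd, ← coe_toReal_of_mem_edom hb hv₀] at hb0
    have : (φ b).toReal ≤ (φ v₀).toReal := by exact_mod_cast hb0
    linarith
  -- C bounds the drop of `φ` below `φ v₀` on the unit ball. A point v at distance s is pulled back
  -- to that ball with parameter 1/s; convexity turns the drop C into at most s C, and strong
  -- convexity gives back s(s-1)μ/2. The balance is favourable as soon as s ≥ 1 + 2C/μ.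
  refine ⟨1 + 2 * C / μ, by positivity, fun v hv hR => ?_⟩
  set s := ‖v - v₀‖ with hsdef
  have hs1 : 1 ≤ s := le_trans (by have : 0 ≤ 2 * C / μ := by positivity
                                   linarith) hR
  have hspos : 0 < s := by linarith
  have hseg := StrongConvexOn.le_segment hs hv₀ hv (t := 1 / s) (by positivity)
    (by rw [div_le_one hspos]; exact hs1)
  have hmem := Convex.add_smul_sub_mem_edom hs hv₀ hv (t := 1 / s) (by positivity)
    (by rw [div_le_one hspos]; exact hs1)
  have hball : v₀ + (1 / s) • (v - v₀) ∈ Metric.closedBall v₀ 1 := by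
    rw [Metric.mem_closedBall, dist_eq_norm, add_sub_cancel_left, norm_smul, ← hsdef,
      Real.norm_of_nonneg (by positivity)]
    field_simp
    exact le_rfl
  have hlow : (φ b).toReal ≤ (φ (v₀ + (1 / s) • (v - v₀))).toReal := by
    have : φ b ≤ φ (v₀ + (1 / s) • (v - v₀)) := hbmin hball
    rw [← coe_toReal_of_mem_edom hb hbd, ← coe_toReal_of_mem_edom hb hmem] at this
    exact_mod_cast this
  have h1 := hlow.trans hseg
  rw [← hsdef] at h1
  have h2 : s * (φ b).toReal ≤ (s - 1) * (φ v₀).toReal + (φ v).toReal - (s - 1) * (μ / 2) * s := by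
    have := mul_le_mul_of_nonneg_left h1 hspos.le
    refine this.trans (le_of_eq ?_)
    field_simp
  have h3 : 2 * C ≤ μ * (s - 1) := by
    have : 2 * C / μ ≤ s - 1 := by linarith
    rw [div_le_iff₀ hμ] at this
    linarith
  nlinarith

/-- A minimizer of `γφ + ½‖· - x‖²` exists if `φ` is proper, closed and strongly convex. -/
lemma exists_isProx [ProperSpace E] {φ : E → EReal} {μ γ : ℝ} (hp : EProper φ)
    (hl : LowerSemicontinuous φ) (hμ : 0 < μ) (hs : EStrongConvex μ φ) (hγ : 0 < γ) (x : E) :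
    ∃ u, IsProx (fun v => (γ : EReal) * φ v) x u := by
  obtain ⟨⟨v₀, hv₀⟩, hb⟩ := hp
  obtain ⟨R, hR, hfar⟩ := exists_radius_of_strongConvex hb hl hμ (hs.strongConvexOn hb) hv₀
  have hγ0 : Continuous fun y : EReal => (γ : EReal) * y := by
    rw [continuous_iff_continuousAt]
    intro y
    have hγ' : (γ : EReal) ≠ 0 := by exact_mod_cast hγ.ne'
    exact (EReal.continuousAt_mul (p := ((γ : EReal), y)) (Or.inl hγ') (Or.inl hγ')
      (Or.inl (EReal.coe_ne_bot _)) (Or.inl (EReal.coe_ne_top _))).comp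
      (f := fun y : EReal => ((γ : EReal), y)) (by fun_prop)
  have hγm : Monotone fun y : EReal => (γ : EReal) * y := fun a b hab =>
    mul_le_mul_of_nonneg_left hab (EReal.coe_nonneg.2 hγ.le)
  have hl1 : LowerSemicontinuous fun v => (γ : EReal) * φ v := hγ0.comp_lowerSemicontinuous hl hγm
  have hl2 : LowerSemicontinuous fun v => ((‖v - x‖ ^ 2 / 2 : ℝ) : EReal) :=
    (continuous_coe_real_ereal.comp (by fun_prop)).lowerSemicontinuous
  have hl3 : LowerSemicontinuous
      fun v => (γ : EReal) * φ v + ((‖v - x‖ ^ 2 / 2 : ℝ) : EReal) :=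
    hl1.add' hl2 fun v => EReal.continuousAt_add (Or.inr (EReal.coe_ne_bot _))
      (Or.inr (EReal.coe_ne_top _))
  -- Beyond R' both summands exceed their values at `v₀`: `φ` because the distance to `v₀` is at
  -- least R, the quadratic because it is at least 2‖v₀ - x‖.
  set R' := max R (2 * ‖v₀ - x‖) with hR'
  have hR'0 : 0 ≤ R' := hR.le.trans (le_max_left _ _)
  obtain ⟨u, hum, humin⟩ := LowerSemicontinuousOn.exists_isMinOn
    (Metric.nonempty_closedBall.2 hR'0 : (Metric.closedBall v₀ R').Nonempty)
    (isCompact_closedBall v₀ R') (hl3.lowerSemicontinuousOn _)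
  refine ⟨u, fun v => ?_⟩
  by_cases hvR : v ∈ Metric.closedBall v₀ R'
  · exact humin hvR
  · refine (humin (Metric.mem_closedBall_self hR'0)).trans ?_
    simp only [Metric.mem_closedBall, dist_eq_norm, not_le] at hvR
    beta_reduce
    by_cases hv : v ∈ edom φ
    · have h1 := hfar v hv ((le_max_left _ _).trans hvR.le)
      have h2 : ‖v₀ - x‖ ≤ ‖v - x‖ := by
        have h3 := (le_max_right R _).trans hvR.le
        have h4 : ‖v - v₀‖ ≤ ‖v - x‖ + ‖v₀ - x‖ := by
          have := norm_sub_le (v - x) (v₀ - x)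
          simpa using this
        linarith
      rw [← coe_toReal_of_mem_edom hb hv, ← coe_toReal_of_mem_edom hb hv₀]
      have h5 : ‖v₀ - x‖ ^ 2 ≤ ‖v - x‖ ^ 2 := pow_le_pow_left₀ (norm_nonneg _) h2 2
      have h6 := mul_le_mul_of_nonneg_left h1 hγ.le
      have : γ * (φ v₀).toReal + ‖v₀ - x‖ ^ 2 / 2 ≤ γ * (φ v).toReal + ‖v - x‖ ^ 2 / 2 := by
        linarith
      exact_mod_cast this
    · have : φ v = ⊤ := not_lt_top_iff.1 hv
      rw [this, EReal.coe_mul_top_of_pos hγ, EReal.top_add_coe]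
      exact le_top

/-- The limit t → 0 removes the factor 1 - t that remains when a minimality inequality along a
segment is divided by t. -/
lemma le_of_forall_one_sub_mul_le {c d : ℝ} (h : ∀ t : ℝ, 0 < t → t < 1 → (1 - t) * c ≤ d) :
    c ≤ d := by
  have ht : Tendsto (fun t : ℝ => (1 - t) * c) (𝓝[>] 0) (𝓝 ((1 - 0) * c)) := by
    apply Tendsto.mono_left _ nhdsWithin_le_nhds
    exact Continuous.tendsto (by fun_prop) 0
  rw [sub_zero, one_mul] at ht
  refine le_of_tendsto ht ?_
  filter_upwards [Ioo_mem_nhdsGT (zero_lt_one' ℝ)] with t ht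
  exact h t ht.1 ht.2

/-- The proximal step in the domain, with its three-point inequality. -/
lemma prox_step [ProperSpace E] {φ : E → EReal} {μ ε : ℝ} (hp : EProper φ)
    (hl : LowerSemicontinuous φ) (hμ : 0 < μ) (hs : EStrongConvex μ φ) (hε : 0 < ε)
    (w Δ : E) {u : E} (hu : u = prox (fun v => (ε : EReal) * φ v) (w - ε • Δ)) :
    u ∈ edom φ ∧ ∀ v ∈ edom φ,
      (φ u).toReal + inner ℝ Δ (u - v) + μ / 2 * ‖v - u‖ ^ 2
        + 1 / (2 * ε) * (‖u - w‖ ^ 2 + ‖v - u‖ ^ 2 - ‖v - w‖ ^ 2) ≤ (φ v).toReal := by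
  have hpr : IsProx (fun v => (ε : EReal) * φ v) (w - ε • Δ) u := by
    rw [hu]
    exact Classical.epsilon_spec (exists_isProx hp hl hμ hs hε _)
  obtain ⟨⟨v₀, hv₀⟩, hb⟩ := hp
  have hsc := hs.strongConvexOn hb
  have hud : u ∈ edom φ := by
    by_contra hud
    have htop : φ u = ⊤ := not_lt_top_iff.1 hud
    have := hpr v₀
    beta_reduce at this
    rw [htop, EReal.coe_mul_top_of_pos hε, EReal.top_add_coe,
      ← coe_toReal_of_mem_edom hb hv₀, ← EReal.coe_mul, ← EReal.coe_add] at this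
    exact absurd this (not_le.2 (EReal.coe_lt_top _))
  refine ⟨hud, fun v hv => ?_⟩
  set x := w - ε • Δ with hx
  have hreal : ∀ z ∈ edom φ, ε * (φ u).toReal + ‖u - x‖ ^ 2 / 2
      ≤ ε * (φ z).toReal + ‖z - x‖ ^ 2 / 2 := by
    intro z hz
    have := hpr z
    beta_reduce at this
    rw [← coe_toReal_of_mem_edom hb hud, ← coe_toReal_of_mem_edom hb hz] at this
    exact_mod_cast this
  -- The regularized objective is strongly convex with modulus εμ + 1. Comparing its value at u with
  -- that at u + t(v - u), dividing by t and letting t → 0 gives quadratic growth away from the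
  -- minimizer, with no subdifferential needed.
  have hmain : (ε * μ + 1) / 2 * ‖v - u‖ ^ 2 ≤
      ε * (φ v).toReal + ‖v - x‖ ^ 2 / 2 - (ε * (φ u).toReal + ‖u - x‖ ^ 2 / 2) := by
    refine le_of_forall_one_sub_mul_le fun t ht0 ht1 => ?_
    have h1 := hreal _ (Convex.add_smul_sub_mem_edom hsc hud hv ht0.le ht1.le)
    have h2 := StrongConvexOn.le_segment hsc hud hv ht0.le ht1.le
    have h3 : ‖u + t • (v - u) - x‖ ^ 2
        = ‖u - x‖ ^ 2 + 2 * t * inner ℝ (u - x) (v - u) + t ^ 2 * ‖v - u‖ ^ 2 := by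
      rw [show u + t • (v - u) - x = (u - x) + t • (v - u) by abel, norm_add_sq_real,
        inner_smul_right, norm_smul, mul_pow, Real.norm_eq_abs, sq_abs]
      ring
    have h4 : ‖v - x‖ ^ 2 = ‖u - x‖ ^ 2 + 2 * inner ℝ (u - x) (v - u) + ‖v - u‖ ^ 2 := by
      rw [show v - x = (u - x) + (v - u) by abel, norm_add_sq_real]
    have h5 := mul_le_mul_of_nonneg_left h2 hε.le
    rw [h3] at h1
    have h6 : 0 ≤ t * (ε * (φ v).toReal + ‖v - x‖ ^ 2 / 2
        - (ε * (φ u).toReal + ‖u - x‖ ^ 2 / 2) - (1 - t) * ((ε * μ + 1) / 2 * ‖v - u‖ ^ 2)) := by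
      rw [h4]
      nlinarith
    have := nonneg_of_mul_nonneg_right h6 ht0
    linarith
  have e1 : ‖v - x‖ ^ 2 = ‖v - w‖ ^ 2 + 2 * ε * inner ℝ Δ (v - w) + ε ^ 2 * ‖Δ‖ ^ 2 := by
    rw [show v - x = (v - w) + ε • Δ by rw [hx]; abel, norm_add_sq_real, inner_smul_right,
      norm_smul, mul_pow, Real.norm_eq_abs, sq_abs, real_inner_comm]
    ring
  have e2 : ‖u - x‖ ^ 2 = ‖u - w‖ ^ 2 + 2 * ε * inner ℝ Δ (u - w) + ε ^ 2 * ‖Δ‖ ^ 2 := by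
    rw [show u - x = (u - w) + ε • Δ by rw [hx]; abel, norm_add_sq_real, inner_smul_right,
      norm_smul, mul_pow, Real.norm_eq_abs, sq_abs, real_inner_comm]
    ring
  have e3 : inner ℝ Δ (u - v) = inner ℝ Δ (u - w) - inner ℝ Δ (v - w) := by
    rw [← inner_sub_right]
    congr 1
    abel
  rw [e1, e2] at hmain
  rw [e3]
  have hfin : ε * ((φ u).toReal + (inner ℝ Δ (u - w) - inner ℝ Δ (v - w)) + μ / 2 * ‖v - u‖ ^ 2
        + 1 / (2 * ε) * (‖u - w‖ ^ 2 + ‖v - u‖ ^ 2 - ‖v - w‖ ^ 2)) ≤ ε * (φ v).toReal := by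
    have : ε * (1 / (2 * ε) * (‖u - w‖ ^ 2 + ‖v - u‖ ^ 2 - ‖v - w‖ ^ 2))
        = (‖u - w‖ ^ 2 + ‖v - u‖ ^ 2 - ‖v - w‖ ^ 2) / 2 := by field_simp
    rw [mul_add, this]
    linarith
  exact le_of_mul_le_mul_left hfin hε

end ConvexFacts

/-! ### Lagrange multipliers from the relative interior condition. -/

section Duality

variable {X Y : Type*} [NormedAddCommGroup X] [InnerProductSpace ℝ X]
  [NormedAddCommGroup Y] [InnerProductSpace ℝ Y] [FiniteDimensional ℝ Y]

omit [FiniteDimensional ℝ Y] in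
-- The line through 0 in direction z stays in the affine span, where `D` is a neighbourhood of 0, so
-- it is in `D` for small positive parameters.
lemma exists_pos_smul_mem_of_zero_mem_intrinsicInterior {D : Set Y}
    (h0 : (0 : Y) ∈ intrinsicInterior ℝ D) {z : Y} (hz : z ∈ (affineSpan ℝ D).direction) :
    ∃ t : ℝ, 0 < t ∧ t • z ∈ D := by
  obtain ⟨y, hy, hy0⟩ := mem_intrinsicInterior.1 h0
  have hmem : ∀ t : ℝ, t • z ∈ affineSpan ℝ D := fun t => by
    have h := AffineSubspace.vadd_mem_of_mem_direction
      ((affineSpan ℝ D).direction.smul_mem t hz) y.2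
    simpa [hy0] using h
  let γ : ℝ → affineSpan ℝ D := fun t => ⟨t • z, hmem t⟩
  have hγ : Continuous γ := Continuous.subtype_mk (by fun_prop) _
  have hγ0 : γ 0 = y := Subtype.ext (by simp [γ, hy0])
  have hev : ∀ᶠ t in 𝓝 (0 : ℝ), γ t ∈ interior ((↑) ⁻¹' D : Set (affineSpan ℝ D)) := by
    apply hγ.continuousAt.eventually_mem
    rw [hγ0]
    exact isOpen_interior.mem_nhds hy
  have hev' : ∀ᶠ t in 𝓝[>] (0 : ℝ), γ t ∈ interior ((↑) ⁻¹' D : Set (affineSpan ℝ D)) :=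
    hev.filter_mono nhdsWithin_le_nhds
  obtain ⟨t, ht, htpos⟩ := (hev'.and self_mem_nhdsWithin).exists
  have ht' : γ t ∈ ((↑) ⁻¹' D : Set (affineSpan ℝ D)) := interior_subset ht
  exact ⟨t, htpos, ht'⟩

/-- The cone generated by the epigraph of the value function of `min φ(x) + g(r)` subject to
`r - K x = z`, over a subspace `V` of perturbations `z`. -/
def valueCone (K : X →L[ℝ] Y) {A : Set X} {B : Set Y} {φ : X → ℝ} {g : Y → ℝ}
    (hφ : ConvexOn ℝ A φ) (hg : ConvexOn ℝ B g) (Fs : ℝ) (V : Submodule ℝ Y) :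
    PointedCone ℝ (V × ℝ) where
  carrier := {w | w = 0 ∨ ∃ t : ℝ, 0 < t ∧ ∃ x ∈ A, ∃ r ∈ B, r - K x = t • (w.1 : Y) ∧
    φ x + g r - Fs ≤ t * w.2}
  zero_mem' := Or.inl rfl
  add_mem' := by
    rintro w₁ w₂ (rfl | h₁) (rfl | h₂)
    · exact Or.inl (by simp)
    · exact Or.inr (by simpa using h₂)
    · exact Or.inr (by simpa using h₁)
    · obtain ⟨t₁, ht₁, x₁, hx₁, r₁, hr₁, e₁, v₁⟩ := h₁
      obtain ⟨t₂, ht₂, x₂, hx₂, r₂, hr₂, e₂, v₂⟩ := h₂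
      have hs : 0 < t₁ + t₂ := by positivity
      have ha : 0 ≤ t₂ / (t₁ + t₂) := by positivity
      have hb : 0 ≤ t₁ / (t₁ + t₂) := by positivity
      have hab : t₂ / (t₁ + t₂) + t₁ / (t₁ + t₂) = 1 := by field_simp; ring
      -- The parameter t scales w into the epigraph. With convex weights t₂/(t₁+t₂) and t₁/(t₁+t₂)
      -- both scaled vectors receive the common factor t₁t₂/(t₁+t₂), which is therefore the
      -- parameter of the sum.
      refine Or.inr ⟨t₁ * t₂ / (t₁ + t₂), by positivity, _, hφ.1 hx₁ hx₂ ha hb hab, _,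
        hg.1 hr₁ hr₂ ha hb hab, ?_, ?_⟩
      · have : (t₂ / (t₁ + t₂)) • r₁ + (t₁ / (t₁ + t₂)) • r₂
            - K ((t₂ / (t₁ + t₂)) • x₁ + (t₁ / (t₁ + t₂)) • x₂)
            = (t₂ / (t₁ + t₂)) • (r₁ - K x₁) + (t₁ / (t₁ + t₂)) • (r₂ - K x₂) := by
          rw [map_add, map_smul, map_smul]
          module
        rw [this, e₁, e₂, smul_smul, smul_smul, Prod.fst_add, Submodule.coe_add, smul_add]
        congr 2 <;> ring
      · have h1 := hφ.2 hx₁ hx₂ ha hb hab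
        have h2 := hg.2 hr₁ hr₂ ha hb hab
        have h3 := mul_le_mul_of_nonneg_left v₁ ha
        have h4 := mul_le_mul_of_nonneg_left v₂ hb
        simp only [smul_eq_mul] at h1 h2
        have h5 : t₁ * t₂ / (t₁ + t₂) * (w₁ + w₂).2
            = t₂ / (t₁ + t₂) * (t₁ * w₁.2) + t₁ / (t₁ + t₂) * (t₂ * w₂.2) := by
          rw [Prod.snd_add]; ring
        have h6 : Fs = t₂ / (t₁ + t₂) * Fs + t₁ / (t₁ + t₂) * Fs := by
          rw [← add_mul, hab, one_mul]
        rw [h5]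
        linarith
  smul_mem' := by
    rintro ⟨a, ha⟩ w (rfl | ⟨t, ht, x, hx, r, hr, e, v⟩)
    · exact Or.inl (smul_zero _)
    · rcases ha.eq_or_lt with rfl | ha'
      · exact Or.inl (by ext <;> simp [Nonneg.mk_smul])
      · refine Or.inr ⟨t / a, by positivity, x, hx, r, hr, ?_, ?_⟩
        · rw [e, Nonneg.mk_smul, Prod.smul_fst, Submodule.coe_smul, smul_smul]
          congr 1
          field_simp
        · rw [Nonneg.mk_smul, Prod.smul_snd, smul_eq_mul]
          refine v.trans (le_of_eq ?_)
          field_simp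

/-- Existence of a multiplier for `min φ(x) + g(K x)` under the relative interior condition. -/
lemma exists_multiplier (K : X →L[ℝ] Y) {A : Set X} {B : Set Y} {φ : X → ℝ} {g : Y → ℝ}
    (hφ : ConvexOn ℝ A φ) (hg : ConvexOn ℝ B g) {Fs : ℝ}
    (hFs : ∀ x ∈ A, K x ∈ B → Fs ≤ φ x + g (K x))
    (h0 : (0 : Y) ∈ intrinsicInterior ℝ {z | ∃ r ∈ B, ∃ x ∈ A, z = r - K x}) :
    ∃ y : Y, ∀ x ∈ A, ∀ r ∈ B, Fs ≤ φ x + g r + inner ℝ y (K x - r) := by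
  set D : Set Y := {z | ∃ r ∈ B, ∃ x ∈ A, z = r - K x} with hD
  set V := (affineSpan ℝ D).direction with hV
  have hDV : ∀ z ∈ D, z ∈ V := fun z hz => by
    have h1 : z ∈ affineSpan ℝ D := subset_affineSpan ℝ D hz
    have h2 : (0 : Y) ∈ affineSpan ℝ D := subset_affineSpan ℝ D (intrinsicInterior_subset h0)
    simpa using AffineSubspace.vsub_mem_direction h1 h2
  have hne : ((0 : V), (1 : ℝ)) ≠ 0 := by simp
  -- The functional sending (0, 1) to 1 is nonnegative on the vertical line inside the cone because
  -- `Fs` is a lower bound. Every vector can be moved into the cone along this line, since each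
  -- direction in V has a positive multiple in `D`. The positive extension G has the form (z, b) ↦ ℓ
  -- z + b, and -ℓ represents the multiplier.
  obtain ⟨G, hG1, hG2⟩ := riesz_extension (valueCone K hφ hg Fs V)
    (LinearPMap.mkSpanSingleton ((0 : V), (1 : ℝ)) (1 : ℝ) hne) (by
      rintro ⟨w, hw⟩ hwC
      obtain ⟨a, rfl⟩ := Submodule.mem_span_singleton.1 hw
      have hval := LinearPMap.mkSpanSingleton'_apply ((0 : V), (1 : ℝ)) (1 : ℝ)
        (fun c hc => by simpa using congrArg Prod.snd hc) a hw
      refine le_of_le_of_eq ?_ hval.symm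
      rcases hwC with h | ⟨t, ht, x, hx, r, hr, e, v⟩
      · have : a = 0 := by simpa using h
        simp [this]
      · simp only [Prod.smul_mk, smul_zero, ZeroMemClass.coe_zero, smul_eq_mul, mul_one] at e v
        have hrx : r = K x := by rwa [sub_eq_zero] at e
        have := hFs x hx (hrx ▸ hr)
        rw [hrx] at v
        have h3 : 0 ≤ t * a := by linarith
        simpa using nonneg_of_mul_nonneg_right h3 ht) (by
      rintro ⟨z, b⟩
      obtain ⟨t, ht, r, hr, x, hx, e⟩ := exists_pos_smul_mem_of_zero_mem_intrinsicInterior h0 z.2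
      refine ⟨⟨((φ x + g r - Fs) / t - b) • ((0 : V), (1 : ℝ)),
        Submodule.smul_mem _ _ (Submodule.mem_span_singleton_self _)⟩,
        Or.inr ⟨t, ht, x, hx, r, hr, ?_, ?_⟩⟩
      · simp [e]
      · simp only [Prod.snd_add, Prod.smul_snd, smul_eq_mul, mul_one, sub_add_cancel]
        rw [mul_div_cancel₀ _ ht.ne'])
  have hG01 : G ((0 : V), (1 : ℝ)) = 1 := by
    have := hG1 ⟨_, Submodule.mem_span_singleton_self _⟩
    rw [this]
    exact LinearPMap.mkSpanSingleton'_apply_self _ _ _ _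
  let ℓ : V →L[ℝ] ℝ := LinearMap.toContinuousLinearMap (G.comp (LinearMap.inl ℝ V ℝ))
  set y₀ : V := (InnerProductSpace.toDual ℝ V).symm ℓ with hy₀
  refine ⟨-(y₀ : Y), fun x hx r hr => ?_⟩
  have hz : r - K x ∈ V := hDV _ ⟨r, hr, x, hx, rfl⟩
  have hC : ((⟨r - K x, hz⟩ : V), φ x + g r - Fs) ∈ valueCone K hφ hg Fs V :=
    Or.inr ⟨1, one_pos, x, hx, r, hr, by simp, by simp⟩
  have h1 := hG2 _ hC
  have h2 : ((⟨r - K x, hz⟩ : V), φ x + g r - Fs)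
      = LinearMap.inl ℝ V ℝ ⟨r - K x, hz⟩ + (φ x + g r - Fs) • ((0 : V), (1 : ℝ)) := by
    ext <;> simp
  rw [h2, map_add, map_smul, hG01, smul_eq_mul, mul_one] at h1
  have h3 : G (LinearMap.inl ℝ V ℝ ⟨r - K x, hz⟩) = inner ℝ (y₀ : Y) (r - K x) := by
    have : ℓ ⟨r - K x, hz⟩ = inner ℝ y₀ (⟨r - K x, hz⟩ : V) := by
      rw [hy₀, InnerProductSpace.toDual_symm_apply]
    rw [Submodule.coe_inner] at this
    exact this
  have h4 : inner ℝ (-(y₀ : Y)) (K x - r) = inner ℝ (y₀ : Y) (r - K x) := by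
    rw [← neg_sub r (K x), inner_neg_neg]
  rw [h4, ← h3]
  linarith

end Duality

/-! ### Block separable extended-real sums. -/

section Separable

variable {N : ℕ} {s : Fin N → ℕ} {φ : ∀ j, EuclideanSpace ℝ (Fin (s j)) → EReal}

lemma sum_ereal_ne_bot {ι : Type*} {t : Finset ι} {a : ι → EReal} (h : ∀ i ∈ t, a i ≠ ⊥) :
    ∑ i ∈ t, a i ≠ ⊥ := by
  classical
  induction t using Finset.induction_on with
  | empty => simp
  | insert i t hi ih =>
    rw [Finset.sum_insert hi]
    exact EReal.add_ne_bot_iff.2 ⟨h i (Finset.mem_insert_self _ _),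
      ih fun j hj => h j (Finset.mem_insert_of_mem hj)⟩

lemma ne_bot_of_sum {ι : Type*} [Fintype ι] {a : ι → EReal} (h : ∑ i, a i ≠ ⊥) (i : ι) :
    a i ≠ ⊥ := by
  classical
  intro hi
  apply h
  rw [← Finset.add_sum_erase _ _ (Finset.mem_univ i), hi, EReal.bot_add]

lemma coe_ereal_sum {ι : Type*} (t : Finset ι) (a : ι → ℝ) :
    ((∑ i ∈ t, a i : ℝ) : EReal) = ∑ i ∈ t, (a i : EReal) := by
  classical
  induction t using Finset.induction_on with
  | empty => simp
  | insert i t hi ih => rw [Finset.sum_insert hi, Finset.sum_insert hi, EReal.coe_add, ih]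

lemma sum_ereal_lt_top_iff {ι : Type*} [Fintype ι] {a : ι → EReal} (h : ∀ i, a i ≠ ⊥) :
    ∑ i, a i < ⊤ ↔ ∀ i, a i < ⊤ := by
  classical
  refine ⟨fun hs i => ?_, fun hs => ?_⟩
  · by_contra hi
    rw [not_lt_top_iff] at hi
    rw [← Finset.add_sum_erase _ _ (Finset.mem_univ i), hi,
      EReal.top_add_of_ne_bot (sum_ereal_ne_bot fun j _ => h j)] at hs
    exact lt_irrefl _ hs
  · have : ∑ i, a i = ((∑ i, (a i).toReal : ℝ) : EReal) := by
      rw [coe_ereal_sum]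
      exact Finset.sum_congr rfl fun i _ => (EReal.coe_toReal (hs i).ne (h i)).symm
    rw [this]
    exact EReal.coe_lt_top _

lemma component_ne_bot (hb : ∀ x : Block s, ∑ j, φ j (x j) ≠ ⊥) (j : Fin N)
    (v : EuclideanSpace ℝ (Fin (s j))) : φ j v ≠ ⊥ := by
  have := ne_bot_of_sum (hb (blockIncl j v)) j
  simpa [blockIncl] using this

lemma mem_edom_sum_iff (hb : ∀ x : Block s, ∑ j, φ j (x j) ≠ ⊥) {x : Block s} :
    ∑ j, φ j (x j) < ⊤ ↔ ∀ j, x j ∈ edom (φ j) :=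
  sum_ereal_lt_top_iff fun j => component_ne_bot hb j _

lemma component_proper (hp : EProper fun x : Block s => ∑ j, φ j (x j)) (j : Fin N) :
    EProper (φ j) := by
  obtain ⟨⟨x, hx⟩, hb⟩ := hp
  exact ⟨⟨x j, (mem_edom_sum_iff hb).1 hx j⟩, component_ne_bot hb j⟩

lemma sum_eq_coe (hb : ∀ x : Block s, ∑ j, φ j (x j) ≠ ⊥) {x : Block s}
    (hx : ∑ j, φ j (x j) < ⊤) :
    ∑ j, φ j (x j) = ((∑ j, (φ j (x j)).toReal : ℝ) : EReal) := by
  rw [coe_ereal_sum]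
  exact Finset.sum_congr rfl fun j _ =>
    (EReal.coe_toReal ((mem_edom_sum_iff hb).1 hx j).ne (component_ne_bot hb j _)).symm

/-- Freezing the other blocks at a point of the domain makes the sum equal to `φ j` plus a finite
constant, which can be subtracted again. -/
lemma component_closed (hp : EProper fun x : Block s => ∑ j, φ j (x j))
    (hl : LowerSemicontinuous fun x : Block s => ∑ j, φ j (x j)) (j : Fin N) :
    LowerSemicontinuous (φ j) := by
  obtain ⟨⟨x, hx⟩, hb⟩ := hp
  have hxj := (mem_edom_sum_iff hb).1 hx
  set c : ℝ := ∑ i ∈ Finset.univ.erase j, (φ i (x i)).toReal with hc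
  have hcont : Continuous fun v : EuclideanSpace ℝ (Fin (s j)) => setBlock x j v := by
    unfold setBlock
    fun_prop
  have hl2 : LowerSemicontinuous fun v => ∑ i, φ i (setBlock x j v i) := hl.comp hcont
  have hsum : ∀ v, ∑ i, φ i (setBlock x j v i) = φ j v + (c : EReal) := by
    intro v
    rw [← Finset.add_sum_erase _ _ (Finset.mem_univ j), hc, coe_ereal_sum]
    congr 1
    · simp [setBlock]
    · refine Finset.sum_congr rfl fun i hi => ?_
      rw [EReal.coe_toReal (hxj i).ne (component_ne_bot hb i _)]
      simp [setBlock, Function.update_of_ne (Finset.ne_of_mem_erase hi)]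
  have heq : φ j = fun v => (∑ i, φ i (setBlock x j v i)) + ((-c : ℝ) : EReal) := by
    funext v
    rw [hsum, add_assoc, ← EReal.coe_add]
    simp
  rw [heq]
  have hconst : LowerSemicontinuous
      fun _ : EuclideanSpace ℝ (Fin (s j)) => ((-c : ℝ) : EReal) := lowerSemicontinuous_const
  exact hl2.add' hconst fun v => EReal.continuousAt_add (Or.inr (EReal.coe_ne_bot _))
      (Or.inr (EReal.coe_ne_top _))

end Separable

/-! ### Finite values on the domains and strong duality for the block problem. -/

namespace Problem

variable {m n : ℕ} {p : Fin n → ℕ} {d : Fin m → ℕ} {Pb : Problem p d}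

/-- The real value of `f` on its domain. -/
def fR (Pb : Problem p d) (x : Block p) : ℝ := ∑ j, (Pb.f j (x j)).toReal

/-- The real value of `g` on its domain. -/
def gR (Pb : Problem p d) (r : Block d) : ℝ := ∑ i, (Pb.g i (r i)).toReal

/-- The real value of `F` on its domain. -/
def FR (Pb : Problem p d) (x : Block p) : ℝ := Pb.fR x + Pb.h x + Pb.gR (Pb.K x)

lemma phi_eq_top {x : Block p} (hx : x ∉ edom Pb.fSum) : Pb.phi x = ⊤ := by
  have : Pb.fSum x = ⊤ := not_lt_top_iff.1 hx
  rw [phi, this, EReal.top_add_coe]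

variable {Lh : Fin n → ℝ}

namespace Standing

variable (hA : Pb.Standing Lh)
include hA

lemma fSum_eq {x : Block p} (hx : x ∈ edom Pb.fSum) : Pb.fSum x = (Pb.fR x : EReal) :=
  sum_eq_coe hA.f_proper.2 hx

lemma gSum_eq {r : Block d} (hr : r ∈ edom Pb.gSum) : Pb.gSum r = (Pb.gR r : EReal) :=
  sum_eq_coe hA.g_proper.2 hr

lemma fR_convexOn : ConvexOn ℝ (edom Pb.fSum) Pb.fR := by
  refine (EConvex.convexOn hA.f_proper.2 hA.f_convex).congr fun x hx => ?_
  simp only []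
  rw [hA.fSum_eq hx, EReal.toReal_coe]

lemma gR_convexOn : ConvexOn ℝ (edom Pb.gSum) Pb.gR := by
  refine (EConvex.convexOn hA.g_proper.2 hA.g_convex).congr fun x hx => ?_
  simp only []
  rw [hA.gSum_eq hx, EReal.toReal_coe]

lemma phi_eq {x : Block p} (hx : x ∈ edom Pb.fSum) :
    Pb.phi x = ((Pb.fR x + Pb.h x : ℝ) : EReal) := by
  rw [phi, hA.fSum_eq hx, EReal.coe_add]

lemma edom_phi : edom Pb.phi = edom Pb.fSum := by
  ext x
  refine ⟨fun h => ?_, fun h => ?_⟩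
  · by_contra hx
    have : Pb.phi x < ⊤ := h
    rw [phi_eq_top hx] at this
    exact lt_irrefl _ this
  · change Pb.phi x < ⊤
    rw [hA.phi_eq h]
    exact EReal.coe_lt_top _

lemma F_eq {x : Block p} (hx : x ∈ edom Pb.fSum) (hr : Pb.K x ∈ edom Pb.gSum) :
    Pb.F x = (Pb.FR x : EReal) := by
  rw [F, hA.phi_eq hx, hA.gSum_eq hr, FR, ← EReal.coe_add]

lemma mem_edom_of_F_lt_top {x : Block p} (hx : Pb.F x < ⊤) :
    x ∈ edom Pb.fSum ∧ Pb.K x ∈ edom Pb.gSum := by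
  have hxf : x ∈ edom Pb.fSum := by
    by_contra h
    rw [F, phi_eq_top h, EReal.top_add_of_ne_bot (hA.g_proper.2 _)] at hx
    exact lt_irrefl _ hx
  refine ⟨hxf, ?_⟩
  by_contra h
  have : Pb.gSum (Pb.K x) = ⊤ := not_lt_top_iff.1 h
  rw [F, hA.phi_eq hxf, this, EReal.coe_add_top] at hx
  exact lt_irrefl _ hx

lemma mem_edom_of_mem_primalSol {xs : Block p} (hxs : xs ∈ Pb.primalSol) :
    xs ∈ edom Pb.fSum ∧ Pb.K xs ∈ edom Pb.gSum := by
  apply hA.mem_edom_of_F_lt_top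
  -- The relative interior condition places 0 in dom g - K dom φ, so a point with finite objective
  -- exists and the minimum is finite.
  obtain ⟨r, hr, x, hx, h0⟩ := intrinsicInterior_subset hA.slater
  rw [hA.edom_phi] at hx
  have hrx : r = Pb.K x := (sub_eq_zero.1 h0.symm)
  refine (hxs x).trans_lt ?_
  rw [hA.F_eq hx (hrx ▸ hr)]
  exact EReal.coe_lt_top _

lemma Fstar_eq {xs : Block p} (hxs : xs ∈ Pb.primalSol) : Pb.Fstar = (Pb.FR xs : EReal) := by
  obtain ⟨h1, h2⟩ := hA.mem_edom_of_mem_primalSol hxs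
  rw [← hA.F_eq h1 h2]
  exact le_antisymm (iInf_le _ _) (le_iInf hxs)

/-- Strong duality: every dual solution is a multiplier. -/
lemma exists_dual_multiplier {xs : Block p} (hxs : xs ∈ Pb.primalSol) :
    ∃ y, ∀ x ∈ edom Pb.fSum, ∀ r ∈ edom Pb.gSum,
      Pb.FR xs ≤ Pb.fR x + Pb.h x + Pb.gR r + inner ℝ y (Pb.K x - r) := by
  obtain ⟨h1, h2⟩ := hA.mem_edom_of_mem_primalSol hxs
  have hsl := hA.slater
  rw [hA.edom_phi] at hsl
  have hconv : ConvexOn ℝ (edom Pb.fSum) fun x => Pb.fR x + Pb.h x :=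
    hA.fR_convexOn.add (hA.h_convex.subset (Set.subset_univ _) hA.fR_convexOn.1)
  refine exists_multiplier Pb.K hconv hA.gR_convexOn (fun x hx hr => ?_) hsl
  have := hxs x
  rw [hA.F_eq h1 h2, hA.F_eq hx hr] at this
  exact_mod_cast this

lemma inner_adjoint_sub_phi {x : Block p} (hx : x ∈ edom Pb.fSum) (y : Block d) :
    ((inner ℝ (-(ContinuousLinearMap.adjoint Pb.K y)) x : ℝ) : EReal) - Pb.phi x
      = ((-inner ℝ y (Pb.K x) - (Pb.fR x + Pb.h x) : ℝ) : EReal) := by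
  rw [hA.phi_eq hx, inner_neg_left, ContinuousLinearMap.adjoint_inner_left, EReal.coe_sub]

/-- Taking the supremum over r and then over x in the multiplier inequality bounds the sum of the
two conjugates. -/
lemma G_le_of_multiplier {Fs : ℝ} {y : Block d}
    (hy : ∀ x ∈ edom Pb.fSum, ∀ r ∈ edom Pb.gSum,
      Fs ≤ Pb.fR x + Pb.h x + Pb.gR r + inner ℝ y (Pb.K x - r)) :
    Pb.G y ≤ ((-Fs : ℝ) : EReal) := by
  obtain ⟨x₀, hx₀⟩ := hA.f_proper.1
  obtain ⟨r₀, hr₀⟩ := hA.g_proper.1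
  have hg : ∀ x ∈ edom Pb.fSum, econj Pb.gSum y
      ≤ ((-Fs + inner ℝ y (Pb.K x) + (Pb.fR x + Pb.h x) : ℝ) : EReal) := by
    intro x hx
    refine iSup_le fun r => ?_
    by_cases hr : r ∈ edom Pb.gSum
    · rw [hA.gSum_eq hr, ← EReal.coe_sub]
      have := hy x hx r hr
      rw [inner_sub_right] at this
      exact_mod_cast (by linarith)
    · have : Pb.gSum r = ⊤ := not_lt_top_iff.1 hr
      rw [this, EReal.sub_top]
      exact bot_le
  have hlow : ((inner ℝ y r₀ - Pb.gR r₀ : ℝ) : EReal) ≤ econj Pb.gSum y := by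
    have := le_iSup (fun r => ((inner ℝ y r : ℝ) : EReal) - Pb.gSum r) r₀
    simp only [hA.gSum_eq hr₀, ← EReal.coe_sub] at this
    exact this
  -- The conjugate of g has to be known finite before it can be moved across the inequality to bound
  -- the conjugate of φ.
  obtain ⟨b, hb⟩ : ∃ b : ℝ, (b : EReal) = econj Pb.gSum y :=
    ⟨_, EReal.coe_toReal ((hg x₀ hx₀).trans_lt (EReal.coe_lt_top _)).ne
      ((EReal.bot_lt_coe _).trans_le hlow).ne'⟩
  have hf : econj Pb.phi (-(ContinuousLinearMap.adjoint Pb.K y)) ≤ ((-Fs - b : ℝ) : EReal) := by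
    refine iSup_le fun x => ?_
    by_cases hx : x ∈ edom Pb.fSum
    · rw [hA.inner_adjoint_sub_phi hx]
      have := hg x hx
      rw [← hb] at this
      have h' : b ≤ -Fs + inner ℝ y (Pb.K x) + (Pb.fR x + Pb.h x) := by exact_mod_cast this
      exact_mod_cast (by linarith)
    · rw [phi_eq_top hx, EReal.sub_top]
      exact bot_le
  rw [G, ← hb]
  refine (add_le_add hf le_rfl).trans ?_
  rw [← EReal.coe_add, sub_add_cancel]

/-- Some multiplier y has G(y) ≤ -F⋆, so a minimizer `ys` of G does as well. The Fenchel-Young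
inequality for both conjugates at `ys` then returns the multiplier inequality. -/
lemma multiplier_of_mem_dualSol {xs : Block p} (hxs : xs ∈ Pb.primalSol) {ys : Block d}
    (hys : ys ∈ Pb.dualSol) {x : Block p} (hx : x ∈ edom Pb.fSum) {r : Block d}
    (hr : r ∈ edom Pb.gSum) :
    Pb.FR xs ≤ Pb.fR x + Pb.h x + Pb.gR r + inner ℝ ys (Pb.K x - r) := by
  obtain ⟨y, hy⟩ := hA.exists_dual_multiplier hxs
  have h1 := (hys y).trans (hA.G_le_of_multiplier hy)
  have h2 := le_iSup (fun x => ((inner ℝ (-(ContinuousLinearMap.adjoint Pb.K ys)) x : ℝ) : EReal)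
    - Pb.phi x) x
  have h3 := le_iSup (fun r => ((inner ℝ ys r : ℝ) : EReal) - Pb.gSum r) r
  simp only [hA.inner_adjoint_sub_phi hx] at h2
  simp only [hA.gSum_eq hr, ← EReal.coe_sub] at h3
  have h4 := (add_le_add h2 h3).trans h1
  rw [← EReal.coe_add] at h4
  have h5 : -inner ℝ ys (Pb.K x) - (Pb.fR x + Pb.h x) + (inner ℝ ys r - Pb.gR r) ≤ -Pb.FR xs := by
    exact_mod_cast h4
  rw [inner_sub_right]
  linarith

/-- The one-sided Lipschitz inequality against a single point of dom g forces finiteness. -/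
lemma map_mem_edom {M : ℝ} (hLip : LipschitzAt M Pb.gSum (Pb.K '' edom Pb.fSum)) {x : Block p}
    (hx : x ∈ edom Pb.fSum) : Pb.K x ∈ edom Pb.gSum := by
  obtain ⟨r₀, hr₀⟩ := hA.g_proper.1
  refine (hLip _ ⟨x, hx, rfl⟩ r₀).trans_lt ?_
  rw [hA.gSum_eq hr₀, ← EReal.coe_add]
  exact EReal.coe_lt_top _

lemma gR_map_le {M : ℝ} (hLip : LipschitzAt M Pb.gSum (Pb.K '' edom Pb.fSum)) {x : Block p}
    (hx : x ∈ edom Pb.fSum) {r : Block d} (hr : r ∈ edom Pb.gSum) :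
    Pb.gR (Pb.K x) ≤ Pb.gR r + M * ‖Pb.K x - r‖ := by
  have := hLip _ ⟨x, hx, rfl⟩ r
  rw [hA.gSum_eq hr, hA.gSum_eq (hA.map_mem_edom hLip hx)] at this
  exact_mod_cast this

end Standing

end Problem

/-! ### Changing one block: separable sums, descent and the coupling norm. -/

section BlockFacts

variable {N : ℕ} {s : Fin N → ℕ}

lemma setBlock_sub (x : Block s) (j : Fin N) (v : EuclideanSpace ℝ (Fin (s j))) :
    setBlock x j v - x = blockIncl j (v - x j) := by
  ext i l
  by_cases h : i = j
  · subst h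
    simp [setBlock, blockIncl]
  · simp [setBlock, blockIncl, Function.update_of_ne h, Pi.single_eq_of_ne h]

lemma smul_blockIncl (t : ℝ) (j : Fin N) (v : EuclideanSpace ℝ (Fin (s j))) :
    t • (blockIncl j v : Block s) = blockIncl j (t • v) := by
  rw [blockIncl, blockIncl, Pi.single_smul, WithLp.toLp_smul]

lemma inner_blockIncl (x : Block s) (j : Fin N) (v : EuclideanSpace ℝ (Fin (s j))) :
    inner ℝ x (blockIncl j v) = inner ℝ (x j) v := by
  rw [PiLp.inner_apply, Finset.sum_eq_single j]
  · simp [blockIncl]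
  · intro i _ hi
    simp [blockIncl, Pi.single_eq_of_ne hi]
  · simp

lemma norm_blockIncl_sq (j : Fin N) (v : EuclideanSpace ℝ (Fin (s j))) :
    ‖(blockIncl j v : Block s)‖ ^ 2 = ‖v‖ ^ 2 := by
  rw [← real_inner_self_eq_norm_sq, inner_blockIncl, ← real_inner_self_eq_norm_sq]
  simp [blockIncl]

lemma setBlock_same (x : Block s) (j : Fin N) (v : EuclideanSpace ℝ (Fin (s j))) :
    setBlock x j v j = v := by
  simp [setBlock]

lemma setBlock_of_ne (x : Block s) {i j : Fin N} (h : i ≠ j) (v : EuclideanSpace ℝ (Fin (s j))) :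
    setBlock x j v i = x i := by
  simp [setBlock, Function.update_of_ne h]

/-- Replacing one block changes only one term of a separable sum. -/
lemma sum_setBlock (φ : ∀ j, EuclideanSpace ℝ (Fin (s j)) → ℝ) (x : Block s) (j : Fin N)
    (v : EuclideanSpace ℝ (Fin (s j))) :
    ∑ i, φ i (setBlock x j v i) = ∑ i, φ i (x i) + (φ j v - φ j (x j)) := by
  rw [← Finset.add_sum_erase _ _ (Finset.mem_univ j),
    ← Finset.add_sum_erase Finset.univ (fun i => φ i (x i)) (Finset.mem_univ j), setBlock_same,
    Finset.sum_congr rfl fun i hi => by rw [setBlock_of_ne x (Finset.ne_of_mem_erase hi)]]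
  ring

lemma wnormSq_setBlock_sub (w : Fin N → ℝ) (x z : Block s) (j : Fin N)
    (v : EuclideanSpace ℝ (Fin (s j))) :
    wnormSq w (setBlock x j v - z)
      = wnormSq w (x - z) + w j * (‖v - z j‖ ^ 2 - ‖x j - z j‖ ^ 2) := by
  have := sum_setBlock (fun i u => w i * ‖u - z i‖ ^ 2) x j v
  simp only [wnormSq, PiLp.sub_apply]
  rw [this]
  ring

lemma wnormSq_nonneg {w : Fin N → ℝ} (hw : ∀ j, 0 ≤ w j) (x : Block s) : 0 ≤ wnormSq w x :=
  Finset.sum_nonneg fun j _ => mul_nonneg (hw j) (sq_nonneg _)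

lemma hasDerivAt_comp_line {E : Type*} [NormedAddCommGroup E] [InnerProductSpace ℝ E]
    [CompleteSpace E] {h : E → ℝ} (hd : Differentiable ℝ h) (x v : E) (t : ℝ) :
    HasDerivAt (fun t : ℝ => h (x + t • v)) (inner ℝ (gradient h (x + t • v)) v) t := by
  have h1 : HasDerivAt (fun t : ℝ => x + t • v) v t := by
    simpa using ((hasDerivAt_id t).smul_const v).const_add x
  have h2 := (hd (x + t • v)).hasGradientAt.hasFDerivAt
  have h3 := h2.comp_hasDerivAt t h1
  rw [InnerProductSpace.toDual_apply_apply] at h3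
  exact h3

/-- The first-order inequality for a differentiable convex function. -/
lemma ConvexOn.add_inner_gradient_le {E : Type*} [NormedAddCommGroup E] [InnerProductSpace ℝ E]
    [CompleteSpace E] {h : E → ℝ} (hc : ConvexOn ℝ Set.univ h) (hd : Differentiable ℝ h)
    (x y : E) : h x + inner ℝ (gradient h x) (y - x) ≤ h y := by
  have hder := hasDerivAt_comp_line hd x (y - x) 0
  have hconv : ConvexOn ℝ Set.univ fun t : ℝ => h (x + t • (y - x)) := by
    refine ⟨convex_univ, fun a _ b _ u v hu hv huv => ?_⟩
    have := hc.2 (Set.mem_univ (x + a • (y - x))) (Set.mem_univ (x + b • (y - x))) hu hv huv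
    have e : x + (u • a + v • b) • (y - x) = u • (x + a • (y - x)) + v • (x + b • (y - x)) := by
      have : x = (u + v) • x := by rw [huv, one_smul]
      nth_rewrite 1 [this]
      simp only [smul_eq_mul]
      module
    simp only []
    rw [e]
    exact this
  have := hconv.le_slope_of_hasDerivAt (Set.mem_univ 0) (Set.mem_univ 1) one_pos hder
  simp only [zero_smul, add_zero, slope, one_smul, vsub_eq_sub, sub_zero, inv_one,
    add_sub_cancel] at this
  linarith

/-- The descent lemma along one block. -/
lemma block_descent {h : Block s → ℝ} (hd : Differentiable ℝ h) {j : Fin N} {L : ℝ}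
    (hL : ∀ (x : Block s) (v : EuclideanSpace ℝ (Fin (s j))),
      ‖gradient h (x + blockIncl j v) j - gradient h x j‖ ≤ L * ‖v‖)
    (x : Block s) (v : EuclideanSpace ℝ (Fin (s j))) :
    h (x + blockIncl j v) ≤ h x + inner ℝ (gradient h x j) v + L / 2 * ‖v‖ ^ 2 := by
  set a := inner ℝ (gradient h x j) v
  let ψ : ℝ → ℝ := fun t => h (x + t • blockIncl j v) - t * a - t ^ 2 * (L / 2 * ‖v‖ ^ 2)
  have hψ : ∀ t, HasDerivAt ψ (inner ℝ (gradient h (x + t • blockIncl j v)) (blockIncl j v)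
      - a - 2 * t * (L / 2 * ‖v‖ ^ 2)) t := fun t => by
    have h1 := hasDerivAt_comp_line hd x (blockIncl j v) t
    have h2 : HasDerivAt (fun t : ℝ => t * a) a t := by
      simpa using (hasDerivAt_id t).mul_const a
    have h3 : HasDerivAt (fun t : ℝ => t ^ 2 * (L / 2 * ‖v‖ ^ 2))
        (2 * t * (L / 2 * ‖v‖ ^ 2)) t := by
      simpa using (hasDerivAt_pow 2 t).mul_const (L / 2 * ‖v‖ ^ 2)
    exact (h1.sub h2).sub h3
  -- Subtracting the linear and quadratic terms of the claim leaves a function on [0, 1] whose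
  -- derivative is nonpositive by the block Lipschitz bound; comparing its endpoints is the claim.
  have hanti : AntitoneOn ψ (Set.Icc 0 1) := by
    refine antitoneOn_of_deriv_nonpos (convex_Icc 0 1)
      (fun t _ => (hψ t).continuousAt.continuousWithinAt)
      (fun t _ => (hψ t).differentiableAt.differentiableWithinAt) fun t ht => ?_
    rw [interior_Icc] at ht
    rw [(hψ t).deriv, inner_blockIncl, ← inner_sub_left, smul_blockIncl]
    have h1 := real_inner_le_norm (gradient h (x + blockIncl j (t • v)) j - gradient h x j) v
    have h2 := mul_le_mul_of_nonneg_right (hL x (t • v)) (norm_nonneg v)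
    rw [norm_smul, Real.norm_of_nonneg ht.1.le] at h2
    have h3 : L * (t * ‖v‖) * ‖v‖ = 2 * t * (L / 2 * ‖v‖ ^ 2) := by ring
    linarith
  have := hanti (Set.left_mem_Icc.2 zero_le_one) (Set.right_mem_Icc.2 zero_le_one) zero_le_one
  simp only [ψ, one_smul, zero_smul, add_zero] at this
  linarith

/-- Multiplying the block by √(σ j) undoes the diagonal scaling in `Lbar`, so its operator norm
applies. -/
lemma norm_map_blockIncl_sq_le {m n : ℕ} {p : Fin n → ℕ} {d : Fin m → ℕ} (Pb : Problem p d)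
    {σ : Fin n → ℝ} (hσ : ∀ j, 0 < σ j) (j : Fin n) (v : EuclideanSpace ℝ (Fin (p j))) :
    ‖Pb.K (blockIncl j v)‖ ^ 2 ≤ Pb.Lbar σ * (σ j * ‖v‖ ^ 2) := by
  have hpos : 0 < √(σ j) := Real.sqrt_pos.2 (hσ j)
  have e : Pb.K (blockIncl j v)
      = (Pb.K.comp (blockDiag p fun j => 1 / √(σ j))) (blockIncl j (√(σ j) • v)) := by
    rw [ContinuousLinearMap.comp_apply]
    congr 1
    ext i l
    by_cases h : i = j
    · subst h
      simp [blockDiag, blockIncl, hpos.ne']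
    · simp [blockDiag, blockIncl, Pi.single_eq_of_ne h]
  rw [e]
  have h1 := ContinuousLinearMap.le_opNorm (Pb.K.comp (blockDiag p fun j => 1 / √(σ j)))
    (blockIncl j (√(σ j) • v))
  refine (pow_le_pow_left₀ (norm_nonneg _) h1 2).trans (le_of_eq ?_)
  rw [mul_pow, norm_blockIncl_sq, norm_smul, mul_pow, Real.norm_of_nonneg hpos.le,
    Real.sq_sqrt (hσ j).le, Problem.Lbar]

end BlockFacts

/-! ### Inequalities behind a single step. -/

section Algebra

variable {E : Type*} [NormedAddCommGroup E] [InnerProductSpace ℝ E]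

/-- The effect of the multiplier update on the augmented Lagrangian. -/
lemma augmented_update_le {τ ρ : ℝ} (hρ : 0 < ρ) (Z Zt D yh ys : E) :
    inner ℝ ys ((1 - τ) • Z + τ • Zt + D) + ρ / 2 * ‖(1 - τ) • Z + τ • Zt + D‖ ^ 2
        + 1 / ρ * ‖yh + (ρ / 2) • (τ • Zt + D) - ys‖ ^ 2
      ≤ inner ℝ yh ((1 - τ) • Z + τ • Zt) + ρ / 2 * ‖(1 - τ) • Z + τ • Zt‖ ^ 2
        + inner ℝ (yh + ρ • ((1 - τ) • Z + τ • Zt)) D + ρ * ‖D‖ ^ 2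
        - (1 - τ) * inner ℝ (yh - ys) Z + 1 / ρ * ‖yh - ys‖ ^ 2 + ρ / 2 * τ ^ 2 * ‖Zt‖ ^ 2 := by
  set Zh := (1 - τ) • Z + τ • Zt with hZh
  have e1 : ‖Zh + D‖ ^ 2 = ‖Zh‖ ^ 2 + 2 * inner ℝ Zh D + ‖D‖ ^ 2 := norm_add_sq_real _ _
  have e2 : 1 / ρ * ‖yh + (ρ / 2) • (τ • Zt + D) - ys‖ ^ 2
      = 1 / ρ * ‖yh - ys‖ ^ 2 + inner ℝ (yh - ys) (τ • Zt + D) + ρ / 4 * ‖τ • Zt + D‖ ^ 2 := by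
    rw [show yh + (ρ / 2) • (τ • Zt + D) - ys = (yh - ys) + (ρ / 2) • (τ • Zt + D) by abel,
      norm_add_sq_real, inner_smul_right, norm_smul, mul_pow, Real.norm_eq_abs, sq_abs]
    field_simp
    ring
  -- With dual step ρ/2 the multiplier distance contributes (ρ/4)‖τ Zt + D‖². The parallelogram
  -- bound splits it into (ρ/2)τ²‖Zt‖², which cancels later in `average_step_le`, and (ρ/2)‖D‖²,
  -- which joins the (ρ/2)‖D‖² of the penalty.
  have e3 : ‖τ • Zt + D‖ ^ 2 ≤ 2 * (τ ^ 2 * ‖Zt‖ ^ 2 + ‖D‖ ^ 2) := by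
    have h1 : ‖τ • Zt + D‖ ^ 2 = ‖τ • Zt‖ ^ 2 + 2 * inner ℝ (τ • Zt) D + ‖D‖ ^ 2 :=
      norm_add_sq_real _ _
    have h2 : ‖τ • Zt - D‖ ^ 2 = ‖τ • Zt‖ ^ 2 - 2 * inner ℝ (τ • Zt) D + ‖D‖ ^ 2 :=
      norm_sub_sq_real _ _
    have h3 : ‖τ • Zt‖ ^ 2 = τ ^ 2 * ‖Zt‖ ^ 2 := by
      rw [norm_smul, mul_pow, Real.norm_eq_abs, sq_abs]
    nlinarith [sq_nonneg ‖τ • Zt - D‖]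
  have e4 : inner ℝ (yh - ys) (τ • Zt + D)
      = inner ℝ (yh - ys) (Zh + D) - (1 - τ) * inner ℝ (yh - ys) Z := by
    rw [← inner_smul_right, ← inner_sub_right]
    congr 1
    rw [hZh]
    module
  have e5 := mul_le_mul_of_nonneg_left e3 (show 0 ≤ ρ / 4 by positivity)
  rw [e1, e2, e4]
  simp only [inner_add_left, inner_add_right, inner_sub_left, inner_smul_left,
    RCLike.conj_to_real] at *
  linarith

lemma norm_smul_sub_sq_le (κ : ℝ) (a b : E) :
    ‖κ • (a - b)‖ ^ 2 ≤ 2 * κ ^ 2 * (‖a‖ ^ 2 + ‖b‖ ^ 2) := by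
  have h1 : ‖a - b‖ ^ 2 = ‖a‖ ^ 2 - 2 * inner ℝ a b + ‖b‖ ^ 2 := norm_sub_sq_real _ _
  have h2 : ‖a + b‖ ^ 2 = ‖a‖ ^ 2 + 2 * inner ℝ a b + ‖b‖ ^ 2 := norm_add_sq_real _ _
  rw [norm_smul, mul_pow, Real.norm_eq_abs, sq_abs]
  nlinarith [sq_nonneg ‖a + b‖, sq_nonneg κ]

/-- The averaged progress in one block, from the prox inequality at the solution and at the
current point. -/
lemma block_progress {φ : E → ℝ} {S : Set E} {u xt xs Δ : E} {q τ τ₀ σ β μ μj : ℝ}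
    (hτ : 0 < τ) (hτ₀ : 0 < τ₀) (hq : τ₀ ≤ q) (hσ : 0 < σ) (hβ : 0 < β) (hμ : μ * σ ≤ μj)
    (hμj : 0 ≤ μj) (hxt : xt ∈ S) (hxs : xs ∈ S)
    (hpr : ∀ v ∈ S, φ u + inner ℝ Δ (u - v) + μj / 2 * ‖v - u‖ ^ 2
      + 1 / (2 * (τ₀ * β / (τ * σ))) * (‖u - xt‖ ^ 2 + ‖v - u‖ ^ 2 - ‖v - xt‖ ^ 2) ≤ φ v) :
    q * (τ / τ₀ * (φ u - φ xt + inner ℝ Δ (u - xt)) + (τ / τ₀) ^ 2 * (1 / (2 * β)) *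
        (σ * ‖u - xt‖ ^ 2) + (τ ^ 2 / (2 * τ₀ * β) + τ * μ / 2) * (σ / q *
        (‖u - xs‖ ^ 2 - ‖xt - xs‖ ^ 2)))
      ≤ τ * (φ xs - φ xt + inner ℝ Δ (xs - xt)) - τ * μ / 2 * (σ * ‖xt - xs‖ ^ 2) := by
  have hA := hpr xs hxs
  have hB := hpr xt hxt
  have hqpos : 0 < q := hτ₀.trans_le hq
  have e1 : inner ℝ Δ (u - xs) = inner ℝ Δ (u - xt) - inner ℝ Δ (xs - xt) := by
    rw [← inner_sub_right]; congr 1; abel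
  rw [e1, norm_sub_rev xs u, norm_sub_rev xs xt] at hA
  rw [norm_sub_rev xt u, sub_self, norm_zero] at hB
  set Fu := φ u
  set Fx := φ xt
  set Fs := φ xs
  set i₁ := inner ℝ Δ (u - xt)
  set i₂ := inner ℝ Δ (xs - xt)
  set D := ‖u - xt‖ ^ 2 with hD
  set U := ‖u - xs‖ ^ 2
  set T := ‖xt - xs‖ ^ 2
  have hD0 : 0 ≤ D := sq_nonneg _
  have hU0 : 0 ≤ U := sq_nonneg _
  set e := 1 / (2 * (τ₀ * β / (τ * σ))) with he
  have he0 : 0 < e := by positivity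
  -- The selection probability q may exceed τ₀, so a ≥ 1. The prox inequality at the solution enters
  -- with weight τ. The remaining weight τ(a - 1) uses the inequality at the current point, whose
  -- decrease 2eD outweighs the extra quadratic term.
  set a := q / τ₀ with ha
  have ha1 : 1 ≤ a := (one_le_div hτ₀).2 hq
  have hA' := mul_le_mul_of_nonneg_left hA hτ.le
  have hB0 : Fu - Fx + i₁ ≤ -(2 * e) * D := by
    have : 0 ≤ μj / 2 * D := by positivity
    linarith
  have hB' := mul_le_mul_of_nonneg_left hB0
    (show 0 ≤ τ * (a - 1) from mul_nonneg hτ.le (by linarith))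
  have hμU : τ * μ / 2 * σ * U ≤ τ * (μj / 2 * U) := by
    nlinarith [mul_le_mul_of_nonneg_right hμ (mul_nonneg hτ.le hU0)]
  have l1 : q * (τ / τ₀ * (Fu - Fx + i₁) + (τ / τ₀) ^ 2 * (1 / (2 * β)) * (σ * D)
        + (τ ^ 2 / (2 * τ₀ * β) + τ * μ / 2) * (σ / q * (U - T)))
      = τ * a * (Fu - Fx + i₁) + a * τ * e * D + (τ * e + τ * μ / 2 * σ) * (U - T) := by
    rw [ha, he]
    field_simp
  rw [l1]
  have hae : 0 ≤ (a - 1) * (τ * e * D) := mul_nonneg (by linarith) (by positivity)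
  nlinarith

/-- For independent uniform indices only the marginal averages matter once the bound splits into a
constant, a term in j and a term in i. -/
lemma average_add {ι κ : Type*} [Fintype ι] [Fintype κ] [Nonempty ι] [Nonempty κ]
    {V : ι → κ → ℝ} {C : ℝ} {A : κ → ℝ} {B : ι → ℝ} (h : ∀ i j, V i j ≤ C + A j + B i) :
    (1 / (Fintype.card ι : ℝ)) * (1 / (Fintype.card κ : ℝ)) * ∑ i, ∑ j, V i j
      ≤ C + ∑ j, 1 / (Fintype.card κ : ℝ) * A j + ∑ i, 1 / (Fintype.card ι : ℝ) * B i := by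
  have hι : (0 : ℝ) < Fintype.card ι := by exact_mod_cast Fintype.card_pos
  have hκ : (0 : ℝ) < Fintype.card κ := by exact_mod_cast Fintype.card_pos
  have h1 : ∑ i, ∑ j, V i j ≤ ∑ i, ∑ j, (C + A j + B i) :=
    Finset.sum_le_sum fun i _ => Finset.sum_le_sum fun j _ => h i j
  have h2 : ∑ i : ι, ∑ j : κ, (C + A j + B i) = Fintype.card ι * Fintype.card κ * C
      + Fintype.card ι * ∑ j, A j + Fintype.card κ * ∑ i, B i := by
    simp only [Finset.sum_add_distrib, Finset.sum_const, Finset.card_univ, nsmul_eq_mul,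
      ← Finset.mul_sum]
    ring
  rw [h2] at h1
  refine (mul_le_mul_of_nonneg_left h1 (by positivity)).trans (le_of_eq ?_)
  rw [← Finset.mul_sum, ← Finset.mul_sum]
  field_simp

end Algebra

/-! ### The iteration expressed through residuals and single-block increments. -/

namespace Problem

variable {m n : ℕ} {p : Fin n → ℕ} {d : Fin m → ℕ}

/-- The extrapolated point `x̂`. -/
noncomputable def hatX (τ : ℝ) (s : State p d) : Block p := (1 - τ) • s.x + τ • s.xt

/-- The extrapolated point `r̂`. -/
noncomputable def hatR (τ : ℝ) (s : State p d) : Block d := (1 - τ) • s.r + τ • s.rt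

/-- The gradient in `x` of the augmented Lagrangian at the extrapolated point. -/
noncomputable def gradX (Pb : Problem p d) (τ ρ : ℝ) (s : State p d) : Block p :=
  gradient Pb.h (hatX τ s)
    + ContinuousLinearMap.adjoint Pb.K (s.yhat + ρ • (Pb.K (hatX τ s) - hatR τ s))

/-- The gradient in `r` of the augmented Lagrangian at the extrapolated point. -/
noncomputable def gradR (Pb : Problem p d) (τ ρ : ℝ) (s : State p d) : Block d :=
  -(s.yhat + ρ • (Pb.K (hatX τ s) - hatR τ s))

/-- The proximal point of block `j` of `x`. -/
noncomputable def proxX (Pb : Problem p d) (σ : Fin n → ℝ) (τ₀ τ ρ β : ℝ) (s : State p d) (j : Fin n) :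
    EuclideanSpace ℝ (Fin (p j)) :=
  prox (fun u => ((τ₀ * β / (τ * σ j) : ℝ) : EReal) * Pb.f j u)
    (s.xt j - (τ₀ * β / (τ * σ j)) • Pb.gradX τ ρ s j)

/-- The proximal point of block `i` of `r`. -/
noncomputable def proxR (Pb : Problem p d) (τ₀ τ ρ γ : ℝ) (s : State p d) (i : Fin m) :
    EuclideanSpace ℝ (Fin (d i)) :=
  prox (fun u => ((τ₀ * γ / τ : ℝ) : EReal) * Pb.g i u)
    (s.rt i - (τ₀ * γ / τ) • Pb.gradR τ ρ s i)

/-- The residual `K x - r`. -/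
noncomputable def resid (Pb : Problem p d) (s : State p d) : Block d := Pb.K s.x - s.r

/-- The residual `K x̃ - r̃`. -/
noncomputable def residT (Pb : Problem p d) (s : State p d) : Block d := Pb.K s.xt - s.rt

variable (Pb : Problem p d) (σ : Fin n → ℝ) (τ₀ τ ρ γ β η : ℝ) (i : Fin m) (j : Fin n)
  (s : State p d)

lemma step_xt : (Pb.step σ τ₀ τ ρ γ β η i j s).xt
    = setBlock s.xt j (Pb.proxX σ τ₀ τ ρ β s j) := rfl

lemma step_rt : (Pb.step σ τ₀ τ ρ γ β η i j s).rt
    = setBlock s.rt i (Pb.proxR τ₀ τ ρ γ s i) := by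
  have h : -(s.yhat i) + ρ • (hatR τ s i - Pb.K (hatX τ s) i) = Pb.gradR τ ρ s i := by
    rw [gradR, PiLp.neg_apply, PiLp.add_apply, PiLp.smul_apply, PiLp.sub_apply]
    module
  rw [proxR, ← h, mul_comm τ₀ γ]
  simp only [step, hatR, hatX, mul_comm τ₀ γ]

lemma step_x : (Pb.step σ τ₀ τ ρ γ β η i j s).x
    = hatX τ s + blockIncl j ((τ / τ₀) • (Pb.proxX σ τ₀ τ ρ β s j - s.xt j)) := by
  rw [← smul_blockIncl, ← setBlock_sub]
  rfl

lemma step_r : (Pb.step σ τ₀ τ ρ γ β η i j s).r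
    = hatR τ s + blockIncl i ((τ / τ₀) • (Pb.proxR τ₀ τ ρ γ s i - s.rt i)) := by
  rw [← smul_blockIncl, ← setBlock_sub, ← step_rt (σ := σ) (β := β) (η := η) (j := j)]
  rfl

lemma resid_hat : Pb.K (hatX τ s) - hatR τ s = (1 - τ) • Pb.resid s + τ • Pb.residT s := by
  simp only [hatX, hatR, resid, residT, map_add, map_smul]
  module

lemma resid_step : Pb.resid (Pb.step σ τ₀ τ ρ γ β η i j s)
    = (1 - τ) • Pb.resid s + τ • Pb.residT s
      + (τ / τ₀) • (Pb.K (blockIncl j (Pb.proxX σ τ₀ τ ρ β s j - s.xt j))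
        - blockIncl i (Pb.proxR τ₀ τ ρ γ s i - s.rt i)) := by
  rw [← resid_hat, resid, step_x, step_r, map_add, ← smul_blockIncl, ← smul_blockIncl, map_smul]
  module

lemma step_yhat : (Pb.step σ τ₀ τ ρ γ β η i j s).yhat
    = s.yhat + η • (τ • Pb.residT s
      + (τ / τ₀) • (Pb.K (blockIncl j (Pb.proxX σ τ₀ τ ρ β s j - s.xt j))
        - blockIncl i (Pb.proxR τ₀ τ ρ γ s i - s.rt i))) := by
  have h : (Pb.step σ τ₀ τ ρ γ β η i j s).yhat
      = s.yhat + η • (Pb.resid (Pb.step σ τ₀ τ ρ γ β η i j s) - (1 - τ) • Pb.resid s) := rfl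
  rw [h, resid_step]
  congr 2
  abel

end Problem

/-! ### Expected progress of one iteration. -/

namespace Problem

variable {m n : ℕ} {p : Fin n → ℕ} {d : Fin m → ℕ} {Pb : Problem p d}
  {Lh μf σ : Fin n → ℝ} {μg : Fin m → ℝ}

lemma le_LhSigma_mul (hσ : ∀ j, 0 < σ j) (j : Fin n) : Lh j ≤ LhSigma σ Lh * σ j := by
  have := le_ciSup (Set.finite_range fun j => Lh j / σ j).bddAbove j
  rwa [div_le_iff₀ (hσ j)] at this

lemma muSigma_mul_le (hσ : ∀ j, 0 < σ j) (j : Fin n) : muSigma σ μf * σ j ≤ μf j := by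
  have := ciInf_le (Set.finite_range fun j => μf j / σ j).bddBelow j
  rwa [le_div_iff₀ (hσ j)] at this

lemma muMin_le (i : Fin m) : muMin μg ≤ μg i :=
  ciInf_le (Set.finite_range μg).bddBelow i

namespace Standing

variable (hA : Pb.Standing Lh)
include hA

lemma proxX_spec (hμf : ∀ j, 0 < μf j) (hf : ∀ j, EStrongConvex (μf j) (Pb.f j))
    (hσ : ∀ j, 0 < σ j) {τ₀ τ β : ℝ} (hτ₀ : 0 < τ₀) (hτ : 0 < τ) (hβ : 0 < β) (ρ : ℝ)
    (s : State p d) (j : Fin n) :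
    Pb.proxX σ τ₀ τ ρ β s j ∈ edom (Pb.f j) ∧ ∀ v ∈ edom (Pb.f j),
      (Pb.f j (Pb.proxX σ τ₀ τ ρ β s j)).toReal
        + inner ℝ (Pb.gradX τ ρ s j) (Pb.proxX σ τ₀ τ ρ β s j - v)
        + μf j / 2 * ‖v - Pb.proxX σ τ₀ τ ρ β s j‖ ^ 2
        + 1 / (2 * (τ₀ * β / (τ * σ j))) * (‖Pb.proxX σ τ₀ τ ρ β s j - s.xt j‖ ^ 2
          + ‖v - Pb.proxX σ τ₀ τ ρ β s j‖ ^ 2 - ‖v - s.xt j‖ ^ 2) ≤ (Pb.f j v).toReal :=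
  prox_step (component_proper hA.f_proper j) (component_closed hA.f_proper hA.f_closed j)
    (hμf j) (hf j) (by have := hσ j; positivity) (s.xt j) (Pb.gradX τ ρ s j) rfl

/-- The factor `τ * 1` puts the r-step in the form of the x-step with weight σ = 1, so that
`block_progress` covers both. -/
lemma proxR_spec (hμg : ∀ i, 0 < μg i) (hg : ∀ i, EStrongConvex (μg i) (Pb.g i))
    {τ₀ τ γ : ℝ} (hτ₀ : 0 < τ₀) (hτ : 0 < τ) (hγ : 0 < γ) (ρ : ℝ)
    (s : State p d) (i : Fin m) :
    Pb.proxR τ₀ τ ρ γ s i ∈ edom (Pb.g i) ∧ ∀ v ∈ edom (Pb.g i),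
      (Pb.g i (Pb.proxR τ₀ τ ρ γ s i)).toReal
        + inner ℝ (Pb.gradR τ ρ s i) (Pb.proxR τ₀ τ ρ γ s i - v)
        + μg i / 2 * ‖v - Pb.proxR τ₀ τ ρ γ s i‖ ^ 2
        + 1 / (2 * (τ₀ * γ / (τ * 1))) * (‖Pb.proxR τ₀ τ ρ γ s i - s.rt i‖ ^ 2
          + ‖v - Pb.proxR τ₀ τ ρ γ s i‖ ^ 2 - ‖v - s.rt i‖ ^ 2) ≤ (Pb.g i v).toReal :=
  prox_step (component_proper hA.g_proper i) (component_closed hA.g_proper hA.g_closed i)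
    (hμg i) (hg i) (by positivity) (s.rt i) (Pb.gradR τ ρ s i) (by rw [proxR, mul_one])

/-- The value after one step for given indices, bounded by a sum of a constant, a term of block
`j` and a term of block `i`. -/
lemma step_le (hσ : ∀ j, 0 < σ j) {τ₀ τ ρ β γ : ℝ} (hτ₀ : 0 < τ₀) (hτ : 0 < τ) (hρ : 0 < ρ)
    (hβ : 1 / β = LhSigma σ Lh + 4 * Pb.Lbar σ * ρ) (hγ : 1 / γ = 4 * ρ)
    (s : State p d) (ys : Block d) (i : Fin m) (j : Fin n) :
    Pb.h (Pb.step σ τ₀ τ ρ γ β (ρ / 2) i j s).x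
        + inner ℝ ys (Pb.resid (Pb.step σ τ₀ τ ρ γ β (ρ / 2) i j s))
        + ρ / 2 * ‖Pb.resid (Pb.step σ τ₀ τ ρ γ β (ρ / 2) i j s)‖ ^ 2
        + 1 / ρ * ‖(Pb.step σ τ₀ τ ρ γ β (ρ / 2) i j s).yhat - ys‖ ^ 2
      ≤ (Pb.h (hatX τ s) + inner ℝ s.yhat (Pb.K (hatX τ s) - hatR τ s)
          + ρ / 2 * ‖Pb.K (hatX τ s) - hatR τ s‖ ^ 2
          - (1 - τ) * inner ℝ (s.yhat - ys) (Pb.resid s) + 1 / ρ * ‖s.yhat - ys‖ ^ 2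
          + ρ / 2 * τ ^ 2 * ‖Pb.residT s‖ ^ 2)
        + (τ / τ₀ * inner ℝ (Pb.gradX τ ρ s j) (Pb.proxX σ τ₀ τ ρ β s j - s.xt j)
          + (τ / τ₀) ^ 2 * (1 / (2 * β)) * (σ j * ‖Pb.proxX σ τ₀ τ ρ β s j - s.xt j‖ ^ 2))
        + (τ / τ₀ * inner ℝ (Pb.gradR τ ρ s i) (Pb.proxR τ₀ τ ρ γ s i - s.rt i)
          + (τ / τ₀) ^ 2 * (1 / (2 * γ)) * (1 * ‖Pb.proxR τ₀ τ ρ γ s i - s.rt i‖ ^ 2)) := by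
  have hdesc := block_descent hA.h_diff (hA.h_smooth j) (hatX τ s)
    ((τ / τ₀) • (Pb.proxX σ τ₀ τ ρ β s j - s.xt j))
  rw [resid_step, step_yhat, step_x]
  set dx := Pb.proxX σ τ₀ τ ρ β s j - s.xt j with hdx
  set dr := Pb.proxR τ₀ τ ρ γ s i - s.rt i with hdr
  set κ := τ / τ₀ with hκ
  have haug := augmented_update_le (τ := τ) hρ (Pb.resid s) (Pb.residT s)
    (κ • (Pb.K (blockIncl j dx) - blockIncl i dr)) s.yhat ys
  have hD := norm_smul_sub_sq_le κ (Pb.K (blockIncl j dx)) (blockIncl i dr)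
  have hK := norm_map_blockIncl_sq_le Pb hσ j dx
  rw [norm_blockIncl_sq] at hD
  -- The cross term of the multiplier update together with ∇h assembles into the two partial
  -- gradients of the augmented Lagrangian, which are the directions used by the prox steps.
  have hin : inner ℝ (s.yhat + ρ • (Pb.K (hatX τ s) - hatR τ s))
        (κ • (Pb.K (blockIncl j dx) - blockIncl i dr))
      = κ * (inner ℝ (Pb.gradX τ ρ s j) dx - inner ℝ (gradient Pb.h (hatX τ s) j) dx)
        + κ * inner ℝ (Pb.gradR τ ρ s i) dr := by
    set Y := s.yhat + ρ • (Pb.K (hatX τ s) - hatR τ s) with hY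
    have e1 : Pb.gradX τ ρ s j = gradient Pb.h (hatX τ s) j
        + ContinuousLinearMap.adjoint Pb.K Y j := rfl
    have e2 : Pb.gradR τ ρ s i = -(Y i) := rfl
    rw [inner_smul_right, inner_sub_right, ← ContinuousLinearMap.adjoint_inner_left,
      inner_blockIncl, inner_blockIncl, e1, e2, inner_neg_left, inner_add_left]
    ring
  rw [← resid_hat] at haug ⊢
  rw [hin] at haug
  rw [inner_smul_right, norm_smul, mul_pow, Real.norm_eq_abs, sq_abs] at hdesc
  have hLj : Lh j / 2 * (κ ^ 2 * ‖dx‖ ^ 2) ≤ LhSigma σ Lh * σ j / 2 * (κ ^ 2 * ‖dx‖ ^ 2) := by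
    have := le_LhSigma_mul (Lh := Lh) hσ j
    gcongr
  have hD2 := mul_le_mul_of_nonneg_left hD hρ.le
  have hK2 := mul_le_mul_of_nonneg_left hK (show 0 ≤ ρ * (2 * κ ^ 2) by positivity)
  -- The step sizes absorb exactly the quadratic errors: ρ‖D‖² is at most 2ρκ²(‖K U_j dx‖² + ‖dr‖²),
  -- hence 2ρ L̄_σ beside L^h_σ/2 for the x-block and 2ρ for the r-block.
  have eβ : 1 / (2 * β) = (LhSigma σ Lh + 4 * Pb.Lbar σ * ρ) / 2 := by
    rw [← hβ, one_div, one_div, mul_inv]; ring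
  have eγ : 1 / (2 * γ) = 2 * ρ := by
    have : 1 / (2 * γ) = (1 / γ) / 2 := by rw [one_div, one_div, mul_inv]; ring
    rw [this, hγ]; ring
  rw [eβ, eγ]
  linarith

/-- The expected decrease of the Lyapunov function in one step, with averages over the indices. -/
lemma average_step_le [NeZero m] [NeZero n]
    (hμf : ∀ j, 0 < μf j) (hf : ∀ j, EStrongConvex (μf j) (Pb.f j))
    (hμg : ∀ i, 0 < μg i) (hg : ∀ i, EStrongConvex (μg i) (Pb.g i))
    (hσ : ∀ j, 0 < σ j) {τ₀ τ ρ β γ : ℝ} (hτ₀ : 0 < τ₀) (hτ₀m : τ₀ ≤ 1 / (m : ℝ))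
    (hτ₀n : τ₀ ≤ 1 / (n : ℝ)) (hτ : 0 < τ) (hτ1 : τ ≤ 1) (hρ : 0 < ρ)
    (hβ0 : 0 < β) (hβ : 1 / β = LhSigma σ Lh + 4 * Pb.Lbar σ * ρ)
    (hγ0 : 0 < γ) (hγ : 1 / γ = 4 * ρ)
    (s : State p d) (hxt : s.xt ∈ edom Pb.fSum) (hrt : s.rt ∈ edom Pb.gSum) (fb gb : ℝ)
    {xs : Block p} (hxs : xs ∈ edom Pb.fSum) (hrs : Pb.K xs ∈ edom Pb.gSum) (ys : Block d) :
    (1 / (m : ℝ)) * (1 / (n : ℝ)) * ∑ i, ∑ j,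
      (((1 - τ) * fb + τ * Pb.fR s.xt
            + τ / τ₀ * (Pb.fR (Pb.step σ τ₀ τ ρ γ β (ρ / 2) i j s).xt - Pb.fR s.xt))
          + ((1 - τ) * gb + τ * Pb.gR s.rt
            + τ / τ₀ * (Pb.gR (Pb.step σ τ₀ τ ρ γ β (ρ / 2) i j s).rt - Pb.gR s.rt))
          + Pb.h (Pb.step σ τ₀ τ ρ γ β (ρ / 2) i j s).x
          + inner ℝ ys (Pb.resid (Pb.step σ τ₀ τ ρ γ β (ρ / 2) i j s)) - Pb.FR xs
        + ρ / 2 * ‖Pb.resid (Pb.step σ τ₀ τ ρ γ β (ρ / 2) i j s)‖ ^ 2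
        + 1 / ρ * ‖(Pb.step σ τ₀ τ ρ γ β (ρ / 2) i j s).yhat - ys‖ ^ 2
        + (τ ^ 2 / (2 * τ₀ * β) + τ * muSigma σ μf / 2) * wnormSq (fun j => σ j / (1 / (n : ℝ)))
            ((Pb.step σ τ₀ τ ρ γ β (ρ / 2) i j s).xt - xs)
        + (τ ^ 2 / (2 * τ₀ * γ) + τ * muMin μg / 2) * wnormSq (fun _ => 1 / (1 / (m : ℝ)))
            ((Pb.step σ τ₀ τ ρ γ β (ρ / 2) i j s).rt - Pb.K xs))
      ≤ (1 - τ) * (fb + gb + Pb.h s.x + inner ℝ ys (Pb.resid s) - Pb.FR xs)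
        + (1 - τ) ^ 2 * (ρ / 2 * ‖Pb.resid s‖ ^ 2) + 1 / ρ * ‖s.yhat - ys‖ ^ 2
        + (τ ^ 2 / (2 * τ₀ * β) + τ * muSigma σ μf / 2 - τ * muSigma σ μf / 2 * (1 / (n : ℝ)))
          * wnormSq (fun j => σ j / (1 / (n : ℝ))) (s.xt - xs)
        + (τ ^ 2 / (2 * τ₀ * γ) + τ * muMin μg / 2 - τ * muMin μg / 2 * (1 / (m : ℝ)))
          * wnormSq (fun _ => 1 / (1 / (m : ℝ))) (s.rt - Pb.K xs) := by
  have hn : (0 : ℝ) < n := by exact_mod_cast Nat.pos_of_neZero n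
  have hm : (0 : ℝ) < m := by exact_mod_cast Nat.pos_of_neZero m
  set cX := τ ^ 2 / (2 * τ₀ * β) + τ * muSigma σ μf / 2 with hcX
  set cR := τ ^ 2 / (2 * τ₀ * γ) + τ * muMin μg / 2 with hcR
  set W := wnormSq (fun j => σ j / (1 / (n : ℝ))) (s.xt - xs) with hW
  set Wr := wnormSq (fun _ => 1 / (1 / (m : ℝ))) (s.rt - Pb.K xs) with hWr
  let A : Fin n → ℝ := fun j =>
    τ / τ₀ * ((Pb.f j (Pb.proxX σ τ₀ τ ρ β s j)).toReal - (Pb.f j (s.xt j)).toReal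
        + inner ℝ (Pb.gradX τ ρ s j) (Pb.proxX σ τ₀ τ ρ β s j - s.xt j))
      + (τ / τ₀) ^ 2 * (1 / (2 * β)) * (σ j * ‖Pb.proxX σ τ₀ τ ρ β s j - s.xt j‖ ^ 2)
      + cX * (σ j / (1 / (n : ℝ))
        * (‖Pb.proxX σ τ₀ τ ρ β s j - xs j‖ ^ 2 - ‖s.xt j - xs j‖ ^ 2))
  let B : Fin m → ℝ := fun i =>
    τ / τ₀ * ((Pb.g i (Pb.proxR τ₀ τ ρ γ s i)).toReal - (Pb.g i (s.rt i)).toReal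
        + inner ℝ (Pb.gradR τ ρ s i) (Pb.proxR τ₀ τ ρ γ s i - s.rt i))
      + (τ / τ₀) ^ 2 * (1 / (2 * γ)) * (1 * ‖Pb.proxR τ₀ τ ρ γ s i - s.rt i‖ ^ 2)
      + cR * (1 / (1 / (m : ℝ))
        * (‖Pb.proxR τ₀ τ ρ γ s i - Pb.K xs i‖ ^ 2 - ‖s.rt i - Pb.K xs i‖ ^ 2))
  set C₀ := (Pb.h (hatX τ s) + inner ℝ s.yhat (Pb.K (hatX τ s) - hatR τ s)
          + ρ / 2 * ‖Pb.K (hatX τ s) - hatR τ s‖ ^ 2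
          - (1 - τ) * inner ℝ (s.yhat - ys) (Pb.resid s) + 1 / ρ * ‖s.yhat - ys‖ ^ 2
          + ρ / 2 * τ ^ 2 * ‖Pb.residT s‖ ^ 2) with hC₀
  have hAj : ∀ j, 1 / (n : ℝ) * A j ≤
      τ * ((Pb.f j (xs j)).toReal - (Pb.f j (s.xt j)).toReal
        + inner ℝ (Pb.gradX τ ρ s j) (xs j - s.xt j))
      - τ * muSigma σ μf / 2 * (σ j * ‖s.xt j - xs j‖ ^ 2) := fun j =>
    block_progress (φ := fun v => (Pb.f j v).toReal) hτ hτ₀ hτ₀n (hσ j) hβ0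
      (muSigma_mul_le hσ j) (hμf j).le
      ((mem_edom_sum_iff hA.f_proper.2).1 hxt j) ((mem_edom_sum_iff hA.f_proper.2).1 hxs j)
      (hA.proxX_spec hμf hf hσ hτ₀ hτ hβ0 ρ s j).2
  have hBi : ∀ i, 1 / (m : ℝ) * B i ≤
      τ * ((Pb.g i (Pb.K xs i)).toReal - (Pb.g i (s.rt i)).toReal
        + inner ℝ (Pb.gradR τ ρ s i) (Pb.K xs i - s.rt i))
      - τ * muMin μg / 2 * (1 * ‖s.rt i - Pb.K xs i‖ ^ 2) := fun i =>
    block_progress (φ := fun v => (Pb.g i v).toReal) hτ hτ₀ hτ₀m one_pos hγ0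
      (by rw [mul_one]; exact muMin_le i) (hμg i).le
      ((mem_edom_sum_iff hA.g_proper.2).1 hrt i) ((mem_edom_sum_iff hA.g_proper.2).1 hrs i)
      (hA.proxR_spec hμg hg hτ₀ hτ hγ0 ρ s i).2
  have havg := average_add (ι := Fin m) (κ := Fin n)
    -- Everything that does not depend on the drawn pair goes into C, including the weighted
    -- distances before the step; `A` and `B` carry only their changes in one block.
    (C := (1 - τ) * (fb + gb) + τ * (Pb.fR s.xt + Pb.gR s.rt) + C₀ - Pb.FR xs + cX * W + cR * Wr)
    (A := A) (B := B)
    (V := fun i j => (((1 - τ) * fb + τ * Pb.fR s.xt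
            + τ / τ₀ * (Pb.fR (Pb.step σ τ₀ τ ρ γ β (ρ / 2) i j s).xt - Pb.fR s.xt))
          + ((1 - τ) * gb + τ * Pb.gR s.rt
            + τ / τ₀ * (Pb.gR (Pb.step σ τ₀ τ ρ γ β (ρ / 2) i j s).rt - Pb.gR s.rt))
          + Pb.h (Pb.step σ τ₀ τ ρ γ β (ρ / 2) i j s).x
          + inner ℝ ys (Pb.resid (Pb.step σ τ₀ τ ρ γ β (ρ / 2) i j s)) - Pb.FR xs
        + ρ / 2 * ‖Pb.resid (Pb.step σ τ₀ τ ρ γ β (ρ / 2) i j s)‖ ^ 2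
        + 1 / ρ * ‖(Pb.step σ τ₀ τ ρ γ β (ρ / 2) i j s).yhat - ys‖ ^ 2
        + cX * wnormSq (fun j => σ j / (1 / (n : ℝ)))
            ((Pb.step σ τ₀ τ ρ γ β (ρ / 2) i j s).xt - xs)
        + cR * wnormSq (fun _ => 1 / (1 / (m : ℝ)))
            ((Pb.step σ τ₀ τ ρ γ β (ρ / 2) i j s).rt - Pb.K xs)))
    (fun i j => by
      have h1 := hA.step_le hσ hτ₀ hτ hρ hβ hγ s ys i j
      have h2 : Pb.fR (Pb.step σ τ₀ τ ρ γ β (ρ / 2) i j s).xt - Pb.fR s.xt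
          = (Pb.f j (Pb.proxX σ τ₀ τ ρ β s j)).toReal - (Pb.f j (s.xt j)).toReal := by
        rw [step_xt, fR, fR, sum_setBlock (fun j v => (Pb.f j v).toReal), add_sub_cancel_left]
      have h3 : Pb.gR (Pb.step σ τ₀ τ ρ γ β (ρ / 2) i j s).rt - Pb.gR s.rt
          = (Pb.g i (Pb.proxR τ₀ τ ρ γ s i)).toReal - (Pb.g i (s.rt i)).toReal := by
        rw [step_rt, gR, gR, sum_setBlock (fun i v => (Pb.g i v).toReal), add_sub_cancel_left]
      simp only [h2, h3]
      rw [step_xt, step_rt, wnormSq_setBlock_sub, wnormSq_setBlock_sub, ← hW, ← hWr]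
      simp only [A, B]
      linarith)
  simp only [Fintype.card_fin] at havg
  refine havg.trans ?_
  have hsumA := Finset.sum_le_sum fun j (_ : j ∈ Finset.univ) => hAj j
  have hsumB := Finset.sum_le_sum fun i (_ : i ∈ Finset.univ) => hBi i
  have eA : ∑ j, (τ * ((Pb.f j (xs j)).toReal - (Pb.f j (s.xt j)).toReal
        + inner ℝ (Pb.gradX τ ρ s j) (xs j - s.xt j))
      - τ * muSigma σ μf / 2 * (σ j * ‖s.xt j - xs j‖ ^ 2))
      = τ * (Pb.fR xs - Pb.fR s.xt + inner ℝ (Pb.gradX τ ρ s) (xs - s.xt))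
        - τ * muSigma σ μf / 2 * (1 / (n : ℝ)) * W := by
    have e1 : W = n * ∑ j, σ j * ‖s.xt j - xs j‖ ^ 2 := by
      rw [hW, wnormSq, Finset.mul_sum]
      refine Finset.sum_congr rfl fun j _ => ?_
      rw [PiLp.sub_apply]
      field_simp
    rw [Finset.sum_sub_distrib, ← Finset.mul_sum, ← Finset.mul_sum, Finset.sum_add_distrib,
      Finset.sum_sub_distrib, e1, PiLp.inner_apply]
    simp only [PiLp.sub_apply, fR]
    field_simp
  have eB : ∑ i, (τ * ((Pb.g i (Pb.K xs i)).toReal - (Pb.g i (s.rt i)).toReal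
        + inner ℝ (Pb.gradR τ ρ s i) (Pb.K xs i - s.rt i))
      - τ * muMin μg / 2 * (1 * ‖s.rt i - Pb.K xs i‖ ^ 2))
      = τ * (Pb.gR (Pb.K xs) - Pb.gR s.rt + inner ℝ (Pb.gradR τ ρ s) (Pb.K xs - s.rt))
        - τ * muMin μg / 2 * (1 / (m : ℝ)) * Wr := by
    have e1 : Wr = m * ∑ i, 1 * ‖s.rt i - Pb.K xs i‖ ^ 2 := by
      rw [hWr, wnormSq, Finset.mul_sum]
      refine Finset.sum_congr rfl fun j _ => ?_
      rw [PiLp.sub_apply]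
      field_simp
    rw [Finset.sum_sub_distrib, ← Finset.mul_sum, ← Finset.mul_sum, Finset.sum_add_distrib,
      Finset.sum_sub_distrib, e1, PiLp.inner_apply]
    simp only [PiLp.sub_apply, gR]
    field_simp
  rw [eA] at hsumA
  rw [eB] at hsumB
  -- The gradient inequality at x̂ is tested at (1-τ)x + τ x⋆, which differs from x̂ by exactly τ(x⋆
  -- - x̃).
  have hconv : Pb.h (hatX τ s) + τ * inner ℝ (gradient Pb.h (hatX τ s)) (xs - s.xt)
      ≤ (1 - τ) * Pb.h s.x + τ * Pb.h xs := by
    have h1 := ConvexOn.add_inner_gradient_le hA.h_convex hA.h_diff (hatX τ s)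
      ((1 - τ) • s.x + τ • xs)
    have h2 := hA.h_convex.2 (Set.mem_univ s.x) (Set.mem_univ xs)
      (show 0 ≤ 1 - τ by linarith) hτ.le (by ring)
    have e : (1 - τ) • s.x + τ • xs - hatX τ s = τ • (xs - s.xt) := by
      rw [hatX]; module
    rw [e, inner_smul_right] at h1
    exact h1.trans h2
  set Y := s.yhat + ρ • (Pb.K (hatX τ s) - hatR τ s) with hY
  have hinner : inner ℝ (Pb.gradX τ ρ s) (xs - s.xt)
      + inner ℝ (Pb.gradR τ ρ s) (Pb.K xs - s.rt)
      = inner ℝ (gradient Pb.h (hatX τ s)) (xs - s.xt) - inner ℝ Y (Pb.residT s) := by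
    rw [gradX, gradR, inner_add_left, ContinuousLinearMap.adjoint_inner_left, inner_neg_left,
      ← hY, residT, map_sub]
    simp only [inner_sub_right]
    ring
  -- The quadratic terms complete the square (ρ/2)‖Ẑ - τ Z̃‖² with Ẑ = (1-τ)Z + τ Z̃, so only
  -- (1-τ)²(ρ/2)‖Z‖² survives, and the linear terms reduce to (1-τ)⟨y⋆, Z⟩.
  have hquad : inner ℝ s.yhat (Pb.K (hatX τ s) - hatR τ s)
        + ρ / 2 * ‖Pb.K (hatX τ s) - hatR τ s‖ ^ 2 - τ * inner ℝ Y (Pb.residT s)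
        - (1 - τ) * inner ℝ (s.yhat - ys) (Pb.resid s) + ρ / 2 * τ ^ 2 * ‖Pb.residT s‖ ^ 2
      = (1 - τ) * inner ℝ ys (Pb.resid s) + (1 - τ) ^ 2 * (ρ / 2 * ‖Pb.resid s‖ ^ 2) := by
    rw [hY, resid_hat]
    simp only [← real_inner_self_eq_norm_sq, inner_add_left, inner_add_right, inner_sub_left,
      inner_smul_left, inner_smul_right, RCLike.conj_to_real,
      real_inner_comm (Pb.resid s) (Pb.residT s)]
    ring
  have hF : Pb.FR xs = Pb.fR xs + Pb.h xs + Pb.gR (Pb.K xs) := rfl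
  have hprod : τ * inner ℝ (Pb.gradX τ ρ s) (xs - s.xt)
      + τ * inner ℝ (Pb.gradR τ ρ s) (Pb.K xs - s.rt)
      = τ * inner ℝ (gradient Pb.h (hatX τ s)) (xs - s.xt) - τ * inner ℝ Y (Pb.residT s) := by
    rw [← mul_add, hinner, mul_sub]
  rw [hF] at *
  linarith

end Standing

end Problem

/-! ### The iterates as convex combinations of the auxiliary points. -/

section Averages

/-- The recursion satisfied by the iterates, with increments of the auxiliary sequence `a`. -/
noncomputable def avgSeq {E : Type*} [AddCommGroup E] [Module ℝ E] (τ₀ : ℝ) (τ : ℕ → ℝ)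
    (a : ℕ → E) : ℕ → E
  | 0 => a 0
  | k + 1 => (1 - τ k) • avgSeq τ₀ τ a k + τ k • a k + (τ k / τ₀) • (a (k + 1) - a k)

/-- The averaged sequence consists of convex combinations of the auxiliary sequence. -/
lemma avgSeq_mem {E : Type*} [AddCommGroup E] [Module ℝ E] {S : Set E} (hS : Convex ℝ S)
    {τ₀ c : ℝ} (hτ₀ : 0 < τ₀) (hτ₀1 : τ₀ ≤ 1) (hc : 1 ≤ c) {τ : ℕ → ℝ}
    (hτ : ∀ k : ℕ, τ k = c * τ₀ / (k + c)) {a : ℕ → E} (ha : ∀ k, a k ∈ S) (k : ℕ) :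
    avgSeq τ₀ τ a k ∈ S := by
  have hc0 : 0 < c := by linarith
  have hpos : ∀ k : ℕ, 0 < (k : ℝ) + c := fun k => by positivity
  have hτpos : ∀ k, 0 < τ k := fun k => by rw [hτ]; have := hpos k; positivity
  have hκ : ∀ k, τ k / τ₀ = c / (k + c) := fun k => by rw [hτ]; field_simp
  have hκ1 : ∀ k, τ k / τ₀ ≤ 1 := fun k => by
    rw [hκ, div_le_one (hpos k)]
    have : (0 : ℝ) ≤ k := Nat.cast_nonneg k
    linarith
  have hτ1 : ∀ k, τ k ≤ 1 := fun k => by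
    have := hκ1 k
    rw [div_le_one hτ₀] at this
    linarith
  -- The recursion itself has a negative coefficient in general, so the induction tracks the weight
  -- w of the newest point. The fourth condition says that the weight left on `a k` after the next
  -- step is nonnegative. The new point then enters with weight τ_k/τ₀ = c/(k+c), which equals 1 at
  -- k = 0.
  obtain ⟨w, hw0, hw1, hwk, e, he, heq⟩ : ∃ w : ℝ, 0 ≤ w ∧ w ≤ 1 ∧
      (1 - τ k) * w + τ k - τ k / τ₀ ≥ 0 ∧ ∃ e ∈ S, avgSeq τ₀ τ a k = w • a k + (1 - w) • e := by
    induction k with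
    | zero =>
      refine ⟨1, zero_le_one, le_rfl, ?_, a 0, ha 0, by simp [avgSeq]⟩
      have := hκ1 0
      linarith
    | succ k ih =>
      obtain ⟨w, hw0, hw1, hwk, e, he, heq⟩ := ih
      refine ⟨τ k / τ₀, (div_pos (hτpos k) hτ₀).le, hκ1 k, ?_, ?_⟩
      · rw [hκ, hκ, hτ]
        push_cast
        have h1 := hpos k
        have h2 : 0 < (k : ℝ) + 1 + c := by positivity
        have h3 : (1 - c * τ₀ / ((k : ℝ) + 1 + c)) * (c / (k + c)) + c * τ₀ / (k + 1 + c)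
            - c / (k + 1 + c) = c * (1 + k * τ₀) / ((k + c) * (k + 1 + c)) := by
          field_simp
          ring
        rw [h3]
        have : (0 : ℝ) ≤ k * τ₀ := by positivity
        positivity
      · obtain ⟨z, hz, hzeq⟩ := hS.exists_mem_add_smul_eq he (ha k)
          (mul_nonneg (sub_nonneg.2 (hτ1 k)) (sub_nonneg.2 hw1)) hwk
        refine ⟨z, hz, ?_⟩
        have hs : 1 - τ k / τ₀ = (1 - τ k) * (1 - w) + ((1 - τ k) * w + τ k - τ k / τ₀) := by ring
        rw [hs, hzeq, avgSeq, heq]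
        module
  rw [heq]
  exact hS (ha k) he hw0 (by linarith) (by ring)

lemma avgSeq_prod {E F : Type*} [AddCommGroup E] [Module ℝ E] [AddCommGroup F] [Module ℝ F]
    (τ₀ : ℝ) (τ : ℕ → ℝ) (a : ℕ → E) (b : ℕ → F) (k : ℕ) :
    avgSeq τ₀ τ (fun k => (a k, b k)) k = (avgSeq τ₀ τ a k, avgSeq τ₀ τ b k) := by
  induction k with
  | zero => rfl
  | succ k ih => simp [avgSeq, ih]

/-- Jensen's inequality for the averaged sequence. -/
lemma ConvexOn.le_avgSeq {E : Type*} [AddCommGroup E] [Module ℝ E] {D : Set E} {φ : E → ℝ}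
    (hφ : ConvexOn ℝ D φ) {τ₀ c : ℝ} (hτ₀ : 0 < τ₀) (hτ₀1 : τ₀ ≤ 1) (hc : 1 ≤ c) {τ : ℕ → ℝ}
    (hτ : ∀ k : ℕ, τ k = c * τ₀ / (k + c)) {a : ℕ → E} (ha : ∀ k, a k ∈ D) (k : ℕ) :
    avgSeq τ₀ τ a k ∈ D ∧ φ (avgSeq τ₀ τ a k) ≤ avgSeq τ₀ τ (fun k => φ (a k)) k := by
  -- Applying the convex combination to the points (a, φ a) of the epigraph yields membership in the
  -- domain and Jensen's inequality at once.
  have := avgSeq_mem hφ.convex_epigraph hτ₀ hτ₀1 hc hτ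
    (a := fun k => (a k, φ (a k))) (fun k => ⟨ha k, le_rfl⟩) k
  rw [avgSeq_prod] at this
  exact this

end Averages

/-! ### Expectations of functions of finitely many random indices. -/

section Sampling

variable {Ω : Type*} [MeasurableSpace Ω] {P : Measure Ω} [IsProbabilityMeasure P]
  {m n : ℕ} [NeZero m] [NeZero n] {qhat : Fin m → ℝ} {q : Fin n → ℝ}
  {I : ℕ → Ω → Fin m} {J : ℕ → Ω → Fin n}

/-- The extension of a finite index sequence by a constant. -/
def extendIdx (m n : ℕ) [NeZero m] [NeZero n] {k : ℕ} (h : Finset.range k → Fin m × Fin n) :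
    ℕ → Fin m × Fin n :=
  fun l => if hl : l ∈ Finset.range k then h ⟨l, hl⟩ else (0, 0)

omit [IsProbabilityMeasure P] [NeZero m] [NeZero n] in
lemma IsSampling.measurable_history (hIJ : IsSampling P qhat q I J) (k : ℕ) :
    Measurable fun ω (l : Finset.range k) => (I l ω, J l ω) :=
  measurable_pi_lambda _ fun l => (hIJ.meas_i l).prodMk (hIJ.meas_j l)

/-- The constant tail of `extendIdx` is never read. Factoring through the history makes Φ a function
on a finite type, where measurability and integrability are automatic. -/
lemma eq_extendIdx_history {k : ℕ} {Φ : (ℕ → Fin m × Fin n) → ℝ}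
    (hΦ : DependsOn Φ (Set.Iio k)) (idx : ℕ → Fin m × Fin n) :
    Φ idx = Φ (extendIdx m n fun l : Finset.range k => idx l) :=
  hΦ fun l hl => by
    have : l ∈ Finset.range k := Finset.mem_range.2 hl
    simp [extendIdx, Set.mem_Iio.1 hl]

lemma IsSampling.integrable (hIJ : IsSampling P qhat q I J) {k : ℕ}
    {Φ : (ℕ → Fin m × Fin n) → ℝ} (hΦ : DependsOn Φ (Set.Iio k)) :
    Integrable (fun ω => Φ fun l => (I l ω, J l ω)) P := by
  have h : Integrable (fun h : Finset.range k → Fin m × Fin n => Φ (extendIdx m n h))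
      (P.map fun ω (l : Finset.range k) => (I l ω, J l ω)) := Integrable.of_finite
  refine (h.comp_measurable (hIJ.measurable_history k)).congr (ae_of_all _ fun ω => ?_)
  exact (eq_extendIdx_history hΦ fun l => (I l ω, J l ω)).symm

omit [NeZero m] [NeZero n] in
lemma dependsOn_update {k : ℕ} {Φ : (ℕ → Fin m × Fin n) → ℝ}
    (hΦ : DependsOn Φ (Set.Iio (k + 1))) (a : Fin m × Fin n) :
    DependsOn (fun idx => Φ (Function.update idx k a)) (Set.Iio k) := by
  intro x y hxy
  refine hΦ fun l hl => ?_
  rcases (Nat.lt_succ_iff.1 hl).eq_or_lt with rfl | hlt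
  · simp
  · simp [Function.update_of_ne hlt.ne, hxy l hlt]

omit [IsProbabilityMeasure P] in
-- The draw at time k is independent of the tuple of earlier draws, which is all that Ψ sees, and
-- its law is the product of the two marginals.
lemma IsSampling.integral_indicator_mul (hIJ : IsSampling P qhat q I J) {k : ℕ}
    {Ψ : (ℕ → Fin m × Fin n) → ℝ} (hΨ : DependsOn Ψ (Set.Iio k)) (a : Fin m × Fin n) :
    ∫ ω, (if (I k ω, J k ω) = a then (1 : ℝ) else 0) * Ψ (fun l => (I l ω, J l ω)) ∂P
      = qhat a.1 * q a.2 * ∫ ω, Ψ (fun l => (I l ω, J l ω)) ∂P := by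
  have hmeas : ∀ l, Measurable fun ω => (I l ω, J l ω) :=
    fun l => (hIJ.meas_i l).prodMk (hIJ.meas_j l)
  have hind := hIJ.indep_time.indepFun_finset {k} (Finset.range k) (by simp) hmeas
  have hind2 := hind.comp
    (φ := fun h : ({k} : Finset ℕ) → Fin m × Fin n =>
      if h ⟨k, Finset.mem_singleton_self k⟩ = a then (1 : ℝ) else 0)
    (ψ := fun h : Finset.range k → Fin m × Fin n => Ψ (extendIdx m n h))
    (measurable_of_finite _) (measurable_of_finite _)
  have hmul := hind2.integral_mul_eq_mul_integral
    ((measurable_of_finite _).comp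
      (measurable_pi_lambda _ fun l : ({k} : Finset ℕ) => hmeas l)).aestronglyMeasurable
    ((measurable_of_finite _).comp (hIJ.measurable_history k)).aestronglyMeasurable
  have e1 : ∀ ω, Ψ (fun l => (I l ω, J l ω))
      = Ψ (extendIdx m n fun l : Finset.range k => (I l ω, J l ω)) :=
    fun ω => eq_extendIdx_history hΨ _
  have e2 : ∫ ω, (if (I k ω, J k ω) = a then (1 : ℝ) else 0) ∂P = qhat a.1 * q a.2 := by
    have hset : MeasurableSet {ω | (I k ω, J k ω) = a} := hmeas k (measurableSet_singleton a)
    have : (fun ω => if (I k ω, J k ω) = a then (1 : ℝ) else 0)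
        = Set.indicator {ω | (I k ω, J k ω) = a} 1 := by
      funext ω
      simp [Set.indicator_apply]
    rw [this, integral_indicator_one hset, ← hIJ.law_i k a.1, ← hIJ.law_j k a.2]
    have h := (hIJ.indep_pair k).measure_inter_preimage_eq_mul {a.1} {a.2}
      (measurableSet_singleton _) (measurableSet_singleton _)
    simp only [Measure.real, ← ENNReal.toReal_mul]
    congr 1
    rw [show {ω | (I k ω, J k ω) = a} = I k ⁻¹' {a.1} ∩ J k ⁻¹' {a.2} by
      ext ω; simp [Prod.ext_iff], h]
    rfl
  simp_rw [e1]
  rw [← e2]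
  exact hmul

/-- The law of total expectation for one step of uniform sampling, as an inequality. -/
lemma IsSampling.integral_le_of_average_le (hIJ : IsSampling P qhat q I J)
    (hqhat : ∀ i, qhat i = 1 / m) (hq : ∀ j, q j = 1 / n) {k : ℕ}
    {Φ Ψ : (ℕ → Fin m × Fin n) → ℝ} (hΦ : DependsOn Φ (Set.Iio (k + 1)))
    (hΨ : DependsOn Ψ (Set.Iio k))
    (h : ∀ idx, (1 / (m : ℝ)) * (1 / (n : ℝ)) * ∑ i, ∑ j, Φ (Function.update idx k (i, j))
      ≤ Ψ idx) :
    ∫ ω, Φ (fun l => (I l ω, J l ω)) ∂P ≤ ∫ ω, Ψ (fun l => (I l ω, J l ω)) ∂P := by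
  classical
  have hint : ∀ a, Integrable (fun ω => Φ (Function.update (fun l => (I l ω, J l ω)) k a)) P :=
    fun a => hIJ.integrable (dependsOn_update hΦ a)
  -- Splitting by the value a of the k-th draw and writing a into the sequence leaves, for each a, a
  -- function of the earlier draws alone.
  have e1 : ∀ ω, Φ (fun l => (I l ω, J l ω)) = ∑ a : Fin m × Fin n,
      (if (I k ω, J k ω) = a then (1 : ℝ) else 0)
        * Φ (Function.update (fun l => (I l ω, J l ω)) k a) := by
    intro ω
    have hu : Function.update (fun l => (I l ω, J l ω)) k (I k ω, J k ω)
        = fun l => (I l ω, J l ω) := Function.update_eq_self k (fun l => (I l ω, J l ω))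
    rw [Finset.sum_eq_single (I k ω, J k ω)]
    · rw [if_pos rfl, one_mul, hu]
    · intro b _ hb
      rw [if_neg hb.symm, zero_mul]
    · simp
  have hint2 : ∀ a, Integrable (fun ω => (if (I k ω, J k ω) = a then (1 : ℝ) else 0)
      * Φ (Function.update (fun l => (I l ω, J l ω)) k a)) P := fun a => by
    refine hIJ.integrable (k := k + 1) (Φ := fun idx => (if idx k = a then (1 : ℝ) else 0)
      * Φ (Function.update idx k a)) ?_
    intro x y hxy
    have h1 := dependsOn_update hΦ a (fun l hl => hxy l (Nat.lt_succ_of_lt hl))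
    simp only [hxy k (Nat.lt_succ_self k), h1]
  calc ∫ ω, Φ (fun l => (I l ω, J l ω)) ∂P
      = ∑ a : Fin m × Fin n, (1 / (m : ℝ)) * (1 / (n : ℝ))
          * ∫ ω, Φ (Function.update (fun l => (I l ω, J l ω)) k a) ∂P := by
        simp_rw [e1]
        rw [integral_finsetSum _ fun a _ => hint2 a]
        refine Finset.sum_congr rfl fun a _ => ?_
        rw [hIJ.integral_indicator_mul (dependsOn_update hΦ a), hqhat, hq]
    _ = ∫ ω, (1 / (m : ℝ)) * (1 / (n : ℝ)) * ∑ i, ∑ j,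
          Φ (Function.update (fun l => (I l ω, J l ω)) k (i, j)) ∂P := by
        rw [integral_const_mul, ← Finset.mul_sum]
        congr 1
        rw [Fintype.sum_prod_type, integral_finsetSum _ fun i _ =>
          integrable_finsetSum _ fun j _ => hint (i, j)]
        exact Finset.sum_congr rfl fun i _ => (integral_finsetSum _ fun j _ => hint (i, j)).symm
    _ ≤ ∫ ω, Ψ (fun l => (I l ω, J l ω)) ∂P :=
        integral_mono (Integrable.const_mul (integrable_finsetSum _ fun i _ =>
          integrable_finsetSum _ fun j _ => hint (i, j)) _) (hIJ.integrable hΨ) fun ω => h _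

end Sampling

/-! ### From a summable weighted sequence to a liminf rate. -/

section Rates

/-- Cauchy condensation turns the series into a multiple of the harmonic series. -/
lemma not_summable_one_div_mul_log : ¬ Summable fun k : ℕ => 1 / ((k : ℝ) * Real.log k) := by
  rw [← summable_condensed_iff_of_eventually_nonneg]
  · have e : (fun k : ℕ => (2 : ℝ) ^ k * (1 / (((2 ^ k : ℕ) : ℝ) * Real.log ((2 ^ k : ℕ) : ℝ))))
        = fun k : ℕ => (1 / Real.log 2) * (1 / (k : ℝ)) := by
      funext k
      rw [Nat.cast_pow, Real.log_pow, Nat.cast_ofNat, one_div, one_div, one_div, mul_inv, mul_inv,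
        ← mul_assoc, mul_inv_cancel₀ (by positivity), one_mul, mul_comm]
    rw [e, summable_mul_left_iff (by have := Real.log_pos one_lt_two; positivity)]
    exact Real.not_summable_one_div_natCast
  · exact Eventually.of_forall fun k => by
      have := Real.log_natCast_nonneg k
      simp only [Pi.zero_apply]
      positivity
  · filter_upwards [eventually_ge_atTop 2] with k hk
    have hk' : (2 : ℝ) ≤ k := by exact_mod_cast hk
    have hlog : 0 < Real.log k := Real.log_pos (by linarith)
    apply one_div_le_one_div_of_le (by positivity)
    push_cast
    have : Real.log k ≤ Real.log (k + 1) := Real.log_le_log (by linarith) (by linarith)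
    gcongr
    linarith

lemma frequently_lt_of_summable {v q : ℕ → ℝ} {C : ℝ} (hC : 0 ≤ C) (hq : ∀ k, 0 ≤ q k)
    (hs : Summable fun k : ℕ => (k : ℝ) * q k)
    (hv : ∀ k : ℕ, 1 ≤ k → v k ≤ q k + C / k * √(q k)) {ε : ℝ} (hε : 0 < ε) :
    ∃ᶠ k : ℕ in atTop, (k : ℝ) ^ 2 * √(Real.log k) * v k < ε := by
  by_contra hcon
  rw [not_frequently] at hcon
  -- With k√(log k)√(q k) ≤ s, the two parts of the bound on v are at most s² and C s. As s ≤ 1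
  -- their sum is at most (1 + C)s ≤ ε/2.
  set s := min 1 (ε / (2 * (1 + C))) with hsdef
  have hs0 : 0 < s := lt_min one_pos (by positivity)
  have hs1 : s ≤ 1 := min_le_left _ _
  have hs2 : (1 + C) * s ≤ ε / 2 := by
    have : s ≤ ε / (2 * (1 + C)) := min_le_right _ _
    rw [le_div_iff₀ (by positivity)] at this
    linarith
  have hev : ∀ᶠ k : ℕ in atTop, ‖1 / ((k : ℝ) * Real.log k)‖ ≤ (1 / s ^ 2) * ((k : ℝ) * q k) := by
    -- From k = 3 > e on, log k ≥ 1, so √(log k) ≤ log k and the term linear in `q k` is also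
    -- controlled by s².
    filter_upwards [hcon, eventually_ge_atTop 3] with k hk hk3
    have hk3' : (3 : ℝ) ≤ k := by exact_mod_cast hk3
    have hkpos : (0 : ℝ) < k := by linarith
    have hl1 : 1 ≤ Real.log k := by
      rw [Real.le_log_iff_exp_le hkpos]
      linarith [Real.exp_one_lt_d9]
    have hlpos : 0 < Real.log k := by linarith
    set r := √(Real.log k) with hr
    have hr2 : r ^ 2 = Real.log k := Real.sq_sqrt hlpos.le
    have hr1 : 1 ≤ r := by rw [hr]; exact Real.one_le_sqrt.2 hl1
    have hmain : s ^ 2 ≤ (k : ℝ) ^ 2 * Real.log k * q k := by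
      by_contra hlt
      rw [not_le] at hlt
      apply hk
      have hsq : k * r * √(q k) ≤ s := by
        refine (pow_le_pow_iff_left₀ (by positivity) hs0.le two_ne_zero).1 ?_
        rw [mul_pow, mul_pow, Real.sq_sqrt (hq k), hr2]
        exact hlt.le
      have h1 := mul_le_mul_of_nonneg_left (hv k (by omega))
        (show 0 ≤ (k : ℝ) ^ 2 * r by positivity)
      have h2 : (k : ℝ) ^ 2 * r * (q k + C / k * √(q k))
          = (k : ℝ) ^ 2 * r * q k + C * (k * r * √(q k)) := by
        field_simp
      have h3 : (k : ℝ) ^ 2 * r * q k ≤ s ^ 2 := by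
        refine le_trans ?_ hlt.le
        rw [← hr2]
        have : r ≤ r ^ 2 := by nlinarith
        have := hq k
        gcongr
      have h4 := mul_le_mul_of_nonneg_left hsq hC
      nlinarith
    rw [Real.norm_of_nonneg (by positivity), div_le_iff₀ (by positivity)]
    have : 1 / s ^ 2 * (k * q k) * (k * Real.log k)
        = ((k : ℝ) ^ 2 * Real.log k * q k) / s ^ 2 := by
      field_simp
    rw [this, one_le_div (by positivity)]
    exact hmain
  exact not_summable_one_div_mul_log
    (Summable.of_norm_bounded_eventually_nat (hs.mul_left _) hev)

lemma liminf_coe_eq_zero {u : ℕ → ℝ} (h0 : ∀ k, 0 ≤ u k)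
    (h : ∀ ε > 0, ∃ᶠ k in atTop, u k < ε) :
    liminf (fun k => ((u k : ℝ) : EReal)) atTop = 0 := by
  apply le_antisymm
  · refine le_of_forall_gt fun b hb => ?_
    obtain ⟨ε, hε0, hεb⟩ := EReal.lt_iff_exists_real_btwn.1 hb
    have hε : 0 < ε := by exact_mod_cast hε0
    have : liminf (fun k => ((u k : ℝ) : EReal)) atTop ≤ (ε : EReal) :=
      liminf_le_of_frequently_le ((h ε hε).mono fun k hk => by exact_mod_cast hk.le)
    exact this.trans_lt hεb
  · exact le_liminf_of_le (h := Eventually.of_forall fun k => by exact_mod_cast h0 k)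

/-- A telescoping bound makes the increments summable. -/
lemma summable_of_add_le {a b : ℕ → ℝ} (ha : ∀ k, 0 ≤ a k) (hb : ∀ k, 0 ≤ b k)
    (h : ∀ k, a (k + 1) + b k ≤ a k) : Summable b := by
  refine summable_of_sum_range_le (c := a 0) hb fun N => ?_
  have : a N + ∑ k ∈ Finset.range N, b k ≤ a 0 := by
    induction N with
    | zero => simp
    | succ N ih =>
      rw [Finset.sum_range_succ]
      linarith [h N]
  linarith [ha N]

end Rates

/-! ### The Lyapunov function and its change of scale. -/

namespace Problem

variable {m n : ℕ} {p : Fin n → ℕ} {d : Fin m → ℕ} {Pb : Problem p d}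
  {Lh μf σ : Fin n → ℝ} {μg : Fin m → ℝ}

/-- The Lagrangian gap plus the penalized residual, at scale `u`; `fb` and `gb` are upper bounds
of the values of `f` and `g`. -/
noncomputable def lyapGap (Pb : Problem p d) (c ρ₀ : ℝ) (xs : Block p) (ys : Block d)
    (u fb gb : ℝ) (s : State p d) : ℝ :=
  fb + gb + Pb.h s.x + inner ℝ ys (Pb.resid s) - Pb.FR xs
    + ρ₀ * u ^ 2 / (2 * c ^ 2) * ‖Pb.resid s‖ ^ 2

/-- The Lyapunov function at scale `u`. -/
noncomputable def lyap (Pb : Problem p d) (Lh μf σ : Fin n → ℝ) (μg : Fin m → ℝ) (c τ₀ ρ₀ : ℝ)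
    (xs : Block p) (ys : Block d) (u fb gb : ℝ) (s : State p d) : ℝ :=
  u ^ 2 / c ^ 2 * Pb.lyapGap c ρ₀ xs ys u fb gb s + 1 / ρ₀ * ‖s.yhat - ys‖ ^ 2
    + τ₀ / 2 * (LhSigma σ Lh + 4 * ρ₀ * Pb.Lbar σ * (u ^ 2 / c ^ 2) + muSigma σ μf * (u / c))
      * wnormSq (fun j => σ j / (1 / (n : ℝ))) (s.xt - xs)
    + τ₀ / 2 * (4 * ρ₀ * (u ^ 2 / c ^ 2) + muMin μg * (u / c))
      * wnormSq (fun _ => 1 / (1 / (m : ℝ))) (s.rt - Pb.K xs)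

/-- After multiplication by c² the margin is 4κ(1-2t) + μ(c a t - c). Here κ ≤ μ/8 limits the loss
to μ(t - 1/2), while c a ≥ cτ₀ > 2 makes the gain at least μ(2t - c), so t ≥ c suffices. -/
lemma coef_le {c τ₀ t κ μ a : ℝ} (hc : 2 ≤ c) (hcτ : 2 < c * τ₀) (ht : c ≤ t) (ha : τ₀ ≤ a)
    (hκ0 : 0 ≤ κ) (hκ : κ ≤ μ / 8) :
    4 * κ * (t ^ 2 / c ^ 2) + μ * (t / c) * (1 - a)
      ≤ 4 * κ * ((t - 1) ^ 2 / c ^ 2) + μ * ((t - 1) / c) := by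
  have hc0 : 0 < c := by linarith
  have ht0 : 0 < t := by linarith
  have hμ : 0 ≤ μ := by linarith
  have e : 4 * κ * ((t - 1) ^ 2 / c ^ 2) + μ * ((t - 1) / c)
      - (4 * κ * (t ^ 2 / c ^ 2) + μ * (t / c) * (1 - a))
      = (4 * κ * (1 - 2 * t) + μ * (c * a * t - c)) / c ^ 2 := by
    field_simp
    ring
  have h1 : 4 * κ * (1 - 2 * t) ≥ μ / 2 * (1 - 2 * t) := by nlinarith
  have h2 : 2 * t ≤ c * a * t := by
    have : 2 ≤ c * a := by nlinarith
    nlinarith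
  have h3 : μ * (c * a * t - c) ≥ μ * (2 * t - c) := by
    apply mul_le_mul_of_nonneg_left _ hμ
    linarith
  have h4 : 0 ≤ μ * (1 / 2 + t - c) := mul_nonneg hμ (by linarith)
  have h5 : 0 ≤ (4 * κ * (1 - 2 * t) + μ * (c * a * t - c)) / c ^ 2 :=
    div_nonneg (by linarith) (sq_nonneg _)
  linarith

/-- The coefficients of the Lyapunov function decrease from scale `t - 1` to scale `t`. -/
lemma scale_step_le {c τ₀ ρ₀ t S Z Y W Wr Lσ Lb μ μ' a a' : ℝ} (hc : 2 ≤ c)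
    (hcτ : 2 < c * τ₀) (hτ₀ : 0 < τ₀) (hτ₀1 : τ₀ ≤ 1)
    (hρ₀ : 0 < ρ₀) (hρf : ρ₀ * Lb ≤ μ / 8) (hρg : ρ₀ ≤ μ' / 8) (ht : c + 1 ≤ t)
    (ha : τ₀ ≤ a) (ha' : τ₀ ≤ a') (hLb : 0 ≤ Lb)
    (hS : 0 ≤ S) (hZ : 0 ≤ Z) (hW : 0 ≤ W) (hWr : 0 ≤ Wr) :
    (t ^ 2 / c ^ 2 - τ₀ * t / c) * S + (t ^ 2 / c ^ 2 - τ₀ * t / c) ^ 2 * (ρ₀ / 2 * Z) + Y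
        + τ₀ / 2 * (Lσ + 4 * ρ₀ * Lb * (t ^ 2 / c ^ 2) + μ * (t / c) * (1 - a)) * W
        + τ₀ / 2 * (4 * ρ₀ * (t ^ 2 / c ^ 2) + μ' * (t / c) * (1 - a')) * Wr
        + (c * τ₀ - 2) / c ^ 2 * t * (S + ρ₀ * (t - 1) ^ 2 / (2 * c ^ 2) * Z)
      ≤ (t - 1) ^ 2 / c ^ 2 * (S + ρ₀ * (t - 1) ^ 2 / (2 * c ^ 2) * Z) + Y
        + τ₀ / 2 * (Lσ + 4 * ρ₀ * Lb * ((t - 1) ^ 2 / c ^ 2) + μ * ((t - 1) / c)) * W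
        + τ₀ / 2 * (4 * ρ₀ * ((t - 1) ^ 2 / c ^ 2) + μ' * ((t - 1) / c)) * Wr := by
  have hc0 : 0 < c := by linarith
  have ht0 : 0 < t := by linarith
  have hW' := mul_le_mul_of_nonneg_right (mul_le_mul_of_nonneg_left
    (coef_le (t := t) (κ := ρ₀ * Lb) hc hcτ (by linarith) ha (by positivity) hρf)
    (show 0 ≤ τ₀ / 2 by positivity)) hW
  have hWr' := mul_le_mul_of_nonneg_right (mul_le_mul_of_nonneg_left
    (coef_le (t := t) (κ := ρ₀) hc hcτ (by linarith) ha' hρ₀.le hρg) (show 0 ≤ τ₀ / 2 by positivity)) hWr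
  set A := (t - 1) ^ 2 / c ^ 2 with hA
  set B := t ^ 2 / c ^ 2 - τ₀ * t / c with hB
  set D := (c * τ₀ - 2) / c ^ 2 * t with hD
  have hD0 : 0 ≤ D := by
    have : 0 ≤ c * τ₀ - 2 := by linarith
    positivity
  have hA0 : 0 ≤ A := by positivity
  have hB0 : 0 ≤ B := by
    have : B = t * (t - c * τ₀) / c ^ 2 := by rw [hB]; field_simp
    rw [this]
    have : 0 ≤ t - c * τ₀ := by nlinarith
    positivity
  -- Expanding (t-1)² shows that A exceeds B + D by exactly 1/c². This is where cτ₀ > 2 becomes a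
  -- surplus D that is linear in t.
  have hAB : B + D ≤ A := by
    have : A - (B + D) = 1 / c ^ 2 := by rw [hA, hB, hD]; field_simp; ring
    have : 0 ≤ 1 / c ^ 2 := by positivity
    linarith
  have hS' := mul_le_mul_of_nonneg_right hAB hS
  -- From 0 ≤ B ≤ A - D follows B² ≤ A B ≤ A(A - D).
  have hsq : B ^ 2 + D * A ≤ A ^ 2 := by nlinarith
  have hZ' := mul_le_mul_of_nonneg_right hsq (show 0 ≤ ρ₀ / 2 * Z by positivity)
  have e : ρ₀ * (t - 1) ^ 2 / (2 * c ^ 2) = A * (ρ₀ / 2) := by rw [hA]; field_simp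
  rw [e]
  linarith

lemma Lbar_nonneg (Pb : Problem p d) (σ : Fin n → ℝ) : 0 ≤ Pb.Lbar σ := sq_nonneg _

namespace Standing

variable (hA : Pb.Standing Lh)
include hA

lemma LhSigma_nonneg (hσ : ∀ j, 0 < σ j) : 0 ≤ LhSigma σ Lh :=
  Real.iSup_nonneg fun j => div_nonneg (hA.Lh_nonneg j) (hσ j).le

/-- The expected Lyapunov function after a step, at scale `t`. -/
lemma average_lyap_le [NeZero m] [NeZero n]
    (hμf : ∀ j, 0 < μf j) (hf : ∀ j, EStrongConvex (μf j) (Pb.f j))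
    (hμg : ∀ i, 0 < μg i) (hg : ∀ i, EStrongConvex (μg i) (Pb.g i))
    (hσ : ∀ j, 0 < σ j) (hLL : 0 < LhSigma σ Lh + Pb.Lbar σ)
    {c τ₀ ρ₀ t : ℝ} (hc : 0 < c) (hτ₀ : 0 < τ₀) (hτ₀m : τ₀ ≤ 1 / (m : ℝ))
    (hτ₀n : τ₀ ≤ 1 / (n : ℝ)) (hτ₀1 : τ₀ ≤ 1) (hρ₀ : 0 < ρ₀) (ht : c ≤ t) {τ ρ β γ : ℝ}
    (hτ : τ = c * τ₀ / t) (hρ : ρ = ρ₀ * τ₀ ^ 2 / τ ^ 2)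
    (hβ : β = 1 / (LhSigma σ Lh + 4 * Pb.Lbar σ * ρ)) (hγ : γ = 1 / (4 * ρ))
    (s : State p d) (hxt : s.xt ∈ edom Pb.fSum) (hrt : s.rt ∈ edom Pb.gSum) (fb gb : ℝ)
    {xs : Block p} (hxs : xs ∈ edom Pb.fSum) (hrs : Pb.K xs ∈ edom Pb.gSum) (ys : Block d) :
    (1 / (m : ℝ)) * (1 / (n : ℝ)) * ∑ i, ∑ j,
      Pb.lyap Lh μf σ μg c τ₀ ρ₀ xs ys t
        ((1 - τ) * fb + τ * Pb.fR s.xt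
          + τ / τ₀ * (Pb.fR (Pb.step σ τ₀ τ ρ γ β (ρ / 2) i j s).xt - Pb.fR s.xt))
        ((1 - τ) * gb + τ * Pb.gR s.rt
          + τ / τ₀ * (Pb.gR (Pb.step σ τ₀ τ ρ γ β (ρ / 2) i j s).rt - Pb.gR s.rt))
        (Pb.step σ τ₀ τ ρ γ β (ρ / 2) i j s)
      ≤ (t ^ 2 / c ^ 2 - τ₀ * t / c)
          * (fb + gb + Pb.h s.x + inner ℝ ys (Pb.resid s) - Pb.FR xs)
        + (t ^ 2 / c ^ 2 - τ₀ * t / c) ^ 2 * (ρ₀ / 2 * ‖Pb.resid s‖ ^ 2)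
        + 1 / ρ₀ * ‖s.yhat - ys‖ ^ 2
        + τ₀ / 2 * (LhSigma σ Lh + 4 * ρ₀ * Pb.Lbar σ * (t ^ 2 / c ^ 2)
            + muSigma σ μf * (t / c) * (1 - 1 / (n : ℝ)))
          * wnormSq (fun j => σ j / (1 / (n : ℝ))) (s.xt - xs)
        + τ₀ / 2 * (4 * ρ₀ * (t ^ 2 / c ^ 2) + muMin μg * (t / c) * (1 - 1 / (m : ℝ)))
          * wnormSq (fun _ => 1 / (1 / (m : ℝ))) (s.rt - Pb.K xs) := by
  have ht0 : 0 < t := hc.trans_le ht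
  have hτ0 : 0 < τ := by rw [hτ]; positivity
  have hτ1 : τ ≤ 1 := by
    rw [hτ, div_le_one ht0]
    nlinarith
  have hρ' : ρ = ρ₀ * (t ^ 2 / c ^ 2) := by rw [hρ, hτ]; field_simp
  have hρ0 : 0 < ρ := by rw [hρ']; positivity
  have hL0 := hA.LhSigma_nonneg hσ
  have hLb0 := Pb.Lbar_nonneg σ
  have hden : 0 < LhSigma σ Lh + 4 * Pb.Lbar σ * ρ := by
    rcases hLb0.eq_or_lt with h | h
    · rw [← h] at hLL ⊢
      linarith
    · positivity
  have hβ0 : 0 < β := by rw [hβ]; positivity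
  have hγ0 : 0 < γ := by rw [hγ]; positivity
  have hβ1 : 1 / β = LhSigma σ Lh + 4 * Pb.Lbar σ * ρ := by rw [hβ, one_div_one_div]
  have hγ1 : 1 / γ = 4 * ρ := by rw [hγ, one_div_one_div]
  have hmain := hA.average_step_le hμf hf hμg hg hσ hτ₀ hτ₀m hτ₀n hτ0 hτ1 hρ0 hβ0 hβ1 hγ0 hγ1
    s hxt hrt fb gb hxs hrs ys
  -- The identities `c1` to `c6` rewrite all coefficients using t²/c² = ρ/ρ₀ and τ = cτ₀/t.
  have c1 : t ^ 2 / c ^ 2 * (1 / ρ) = 1 / ρ₀ := by rw [hρ']; field_simp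
  have c2 : ∀ μ, t ^ 2 / c ^ 2 * (τ ^ 2 / (2 * τ₀ * β) + τ * μ / 2)
      = τ₀ / 2 * (LhSigma σ Lh + 4 * ρ₀ * Pb.Lbar σ * (t ^ 2 / c ^ 2) + μ * (t / c)) := by
    intro μ
    have : τ ^ 2 / (2 * τ₀ * β) = τ ^ 2 / (2 * τ₀) * (1 / β) := by
      rw [mul_one_div, div_div]
    rw [this, hβ1, hρ', hτ]
    field_simp
  have c3 : ∀ μ, t ^ 2 / c ^ 2 * (τ ^ 2 / (2 * τ₀ * γ) + τ * μ / 2)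
      = τ₀ / 2 * (4 * ρ₀ * (t ^ 2 / c ^ 2) + μ * (t / c)) := by
    intro μ
    have : τ ^ 2 / (2 * τ₀ * γ) = τ ^ 2 / (2 * τ₀) * (1 / γ) := by
      rw [mul_one_div, div_div]
    rw [this, hγ1, hρ', hτ]
    field_simp
  have c4 : ∀ μ w, t ^ 2 / c ^ 2 * (τ * μ / 2 * (1 / w)) = τ₀ / 2 * (μ * (t / c) * (1 / w)) := by
    intro μ w
    rw [hτ]
    field_simp
  have c5 : t ^ 2 / c ^ 2 * (1 - τ) = t ^ 2 / c ^ 2 - τ₀ * t / c := by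
    rw [hτ]
    field_simp
  have c6 : t ^ 2 / c ^ 2 * ((1 - τ) ^ 2 * (ρ / 2))
      = (t ^ 2 / c ^ 2 - τ₀ * t / c) ^ 2 * (ρ₀ / 2) := by
    rw [← c5, hρ']
    ring
  have hscale := mul_le_mul_of_nonneg_left hmain (show 0 ≤ t ^ 2 / c ^ 2 by positivity)
  refine le_trans (le_of_eq ?_) (hscale.trans (le_of_eq ?_))
  · conv_rhs => rw [mul_left_comm, Finset.mul_sum]
    congr 1
    refine Finset.sum_congr rfl fun i _ => ?_
    rw [Finset.mul_sum]
    refine Finset.sum_congr rfl fun j _ => ?_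
    rw [lyap, lyapGap, ← c1, ← c2, ← c3, hρ']
    ring
  · have key : ∀ S Z Y W Wr A B A' B' : ℝ, t ^ 2 / c ^ 2 * ((1 - τ) * S
        + (1 - τ) ^ 2 * (ρ / 2 * Z) + 1 / ρ * Y + (A - B) * W + (A' - B') * Wr)
        = t ^ 2 / c ^ 2 * (1 - τ) * S + t ^ 2 / c ^ 2 * ((1 - τ) ^ 2 * (ρ / 2)) * Z
          + t ^ 2 / c ^ 2 * (1 / ρ) * Y + (t ^ 2 / c ^ 2 * A - t ^ 2 / c ^ 2 * B) * W
          + (t ^ 2 / c ^ 2 * A' - t ^ 2 / c ^ 2 * B') * Wr := by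
      intros
      ring
    rw [key, c5, c6, c1, c2, c3, c4, c4]
    ring

end Standing

end Problem

/-! ### Dependence of the run on the drawn indices, and feasibility of the iterates. -/

lemma avgSeq_congr {E : Type*} [AddCommGroup E] [Module ℝ E] {τ₀ : ℝ} {τ : ℕ → ℝ} {a b : ℕ → E}
    {k : ℕ} (h : ∀ l ≤ k, a l = b l) : avgSeq τ₀ τ a k = avgSeq τ₀ τ b k := by
  induction k with
  | zero => exact h 0 le_rfl
  | succ k ih =>
    rw [avgSeq, avgSeq, ih fun l hl => h l (by omega), h k (by omega), h (k + 1) le_rfl]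

namespace Problem

variable {m n : ℕ} {p : Fin n → ℕ} {d : Fin m → ℕ} {Pb : Problem p d}
  {Lh μf σ : Fin n → ℝ} {μg : Fin m → ℝ} {τ₀ : ℝ} {π : Params} {x₀ : Block p} {y₀ : Block d}

lemma run_congr {k : ℕ} {idx idx' : ℕ → Fin m × Fin n} (h : ∀ l < k, idx l = idx' l) :
    Pb.run σ τ₀ π x₀ y₀ idx k = Pb.run σ τ₀ π x₀ y₀ idx' k := by
  induction k with
  | zero => rfl
  | succ k ih => rw [run, run, ih fun l hl => h l (by omega), h k (by omega)]

/-- The upper bound of `f(x^k)` along the iterations. -/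
noncomputable def fBar (Pb : Problem p d) (σ : Fin n → ℝ) (τ₀ : ℝ) (π : Params) (x₀ : Block p)
    (y₀ : Block d) (idx : ℕ → Fin m × Fin n) (k : ℕ) : ℝ :=
  avgSeq τ₀ π.τ (fun l => Pb.fR (Pb.run σ τ₀ π x₀ y₀ idx l).xt) k

/-- The upper bound of `g(r^k)` along the iterations. -/
noncomputable def gBar (Pb : Problem p d) (σ : Fin n → ℝ) (τ₀ : ℝ) (π : Params) (x₀ : Block p)
    (y₀ : Block d) (idx : ℕ → Fin m × Fin n) (k : ℕ) : ℝ :=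
  avgSeq τ₀ π.τ (fun l => Pb.gR (Pb.run σ τ₀ π x₀ y₀ idx l).rt) k

/-- A function of the state and the bounds `fBar`, `gBar` at time `k` depends only on the first
`k` indices. -/
lemma dependsOn_run (Φ : ℝ → ℝ → State p d → ℝ) (k : ℕ) :
    DependsOn (fun idx => Φ (Pb.fBar σ τ₀ π x₀ y₀ idx k) (Pb.gBar σ τ₀ π x₀ y₀ idx k)
      (Pb.run σ τ₀ π x₀ y₀ idx k)) (Set.Iio k) := by
  intro idx idx' h
  have hrun : ∀ l ≤ k, Pb.run σ τ₀ π x₀ y₀ idx l = Pb.run σ τ₀ π x₀ y₀ idx' l :=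
    fun l hl => run_congr fun i hi => h i (Set.mem_Iio.2 (by omega))
  have h1 : Pb.fBar σ τ₀ π x₀ y₀ idx k = Pb.fBar σ τ₀ π x₀ y₀ idx' k :=
    avgSeq_congr fun l hl => by rw [hrun l hl]
  have h2 : Pb.gBar σ τ₀ π x₀ y₀ idx k = Pb.gBar σ τ₀ π x₀ y₀ idx' k :=
    avgSeq_congr fun l hl => by rw [hrun l hl]
  simp only [h1, h2, hrun k le_rfl]

/-- The first k states do not read the draw at time k. Averaging over that draw is therefore a
finite average of steps from one common state. -/
lemma run_update (k : ℕ) (idx : ℕ → Fin m × Fin n) (i : Fin m) (j : Fin n) :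
    Pb.run σ τ₀ π x₀ y₀ (Function.update idx k (i, j)) (k + 1)
      = Pb.step σ τ₀ (π.τ k) (π.ρ k) (π.γ k) (π.β k) (π.η k) i j
        (Pb.run σ τ₀ π x₀ y₀ idx k) := by
  have h : Pb.run σ τ₀ π x₀ y₀ (Function.update idx k (i, j)) k = Pb.run σ τ₀ π x₀ y₀ idx k :=
    run_congr fun l hl => Function.update_of_ne hl.ne _ _
  rw [run, h, Function.update_self]

lemma fBar_update (k : ℕ) (idx : ℕ → Fin m × Fin n) (i : Fin m) (j : Fin n) :
    Pb.fBar σ τ₀ π x₀ y₀ (Function.update idx k (i, j)) (k + 1)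
      = (1 - π.τ k) * Pb.fBar σ τ₀ π x₀ y₀ idx k + π.τ k * Pb.fR (Pb.run σ τ₀ π x₀ y₀ idx k).xt
        + π.τ k / τ₀ * (Pb.fR (Pb.step σ τ₀ (π.τ k) (π.ρ k) (π.γ k) (π.β k) (π.η k) i j
          (Pb.run σ τ₀ π x₀ y₀ idx k)).xt - Pb.fR (Pb.run σ τ₀ π x₀ y₀ idx k).xt) := by
  have h : ∀ l ≤ k, Pb.run σ τ₀ π x₀ y₀ (Function.update idx k (i, j)) l
      = Pb.run σ τ₀ π x₀ y₀ idx l :=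
    fun l hl => run_congr fun i hi => Function.update_of_ne (by omega) _ _
  rw [fBar, avgSeq, run_update, h k le_rfl, fBar, avgSeq_congr fun l hl => by rw [h l hl]]
  simp only [smul_eq_mul]

lemma gBar_update (k : ℕ) (idx : ℕ → Fin m × Fin n) (i : Fin m) (j : Fin n) :
    Pb.gBar σ τ₀ π x₀ y₀ (Function.update idx k (i, j)) (k + 1)
      = (1 - π.τ k) * Pb.gBar σ τ₀ π x₀ y₀ idx k + π.τ k * Pb.gR (Pb.run σ τ₀ π x₀ y₀ idx k).rt
        + π.τ k / τ₀ * (Pb.gR (Pb.step σ τ₀ (π.τ k) (π.ρ k) (π.γ k) (π.β k) (π.η k) i j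
          (Pb.run σ τ₀ π x₀ y₀ idx k)).rt - Pb.gR (Pb.run σ τ₀ π x₀ y₀ idx k).rt) := by
  have h : ∀ l ≤ k, Pb.run σ τ₀ π x₀ y₀ (Function.update idx k (i, j)) l
      = Pb.run σ τ₀ π x₀ y₀ idx l :=
    fun l hl => run_congr fun i hi => Function.update_of_ne (by omega) _ _
  rw [gBar, avgSeq, run_update, h k le_rfl, gBar, avgSeq_congr fun l hl => by rw [h l hl]]
  simp only [smul_eq_mul]

lemma run_x_eq (idx : ℕ → Fin m × Fin n) (k : ℕ) :
    (Pb.run σ τ₀ π x₀ y₀ idx k).x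
      = avgSeq τ₀ π.τ (fun l => (Pb.run σ τ₀ π x₀ y₀ idx l).xt) k := by
  induction k with
  | zero => rfl
  | succ k ih => rw [avgSeq, ← ih]; rfl

lemma run_r_eq (idx : ℕ → Fin m × Fin n) (k : ℕ) :
    (Pb.run σ τ₀ π x₀ y₀ idx k).r
      = avgSeq τ₀ π.τ (fun l => (Pb.run σ τ₀ π x₀ y₀ idx l).rt) k := by
  induction k with
  | zero => rfl
  | succ k ih => rw [avgSeq, ← ih]; rfl

lemma setBlock_mem_edom {N : ℕ} {s : Fin N → ℕ} {φ : ∀ j, EuclideanSpace ℝ (Fin (s j)) → EReal}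
    (hb : ∀ x : Block s, ∑ j, φ j (x j) ≠ ⊥) {x : Block s} (hx : ∑ j, φ j (x j) < ⊤)
    {j : Fin N} {v : EuclideanSpace ℝ (Fin (s j))} (hv : v ∈ edom (φ j)) :
    ∑ i, φ i (setBlock x j v i) < ⊤ := by
  rw [mem_edom_sum_iff hb] at hx ⊢
  intro i
  by_cases h : i = j
  · subst h
    rwa [setBlock_same]
  · rw [setBlock_of_ne x h]
    exact hx i

namespace Standing

variable (hA : Pb.Standing Lh)
include hA

lemma run_mem_edom (hμf : ∀ j, 0 < μf j) (hf : ∀ j, EStrongConvex (μf j) (Pb.f j))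
    (hμg : ∀ i, 0 < μg i) (hg : ∀ i, EStrongConvex (μg i) (Pb.g i))
    (hσ : ∀ j, 0 < σ j) (hτ₀ : 0 < τ₀) (hτ : ∀ k, 0 < π.τ k) (hβ : ∀ k, 0 < π.β k)
    (hγ : ∀ k, 0 < π.γ k) (hx₀ : x₀ ∈ edom Pb.fSum) (hr₀ : Pb.K x₀ ∈ edom Pb.gSum)
    (idx : ℕ → Fin m × Fin n) (k : ℕ) :
    (Pb.run σ τ₀ π x₀ y₀ idx k).xt ∈ edom Pb.fSum ∧
      (Pb.run σ τ₀ π x₀ y₀ idx k).rt ∈ edom Pb.gSum := by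
  induction k with
  | zero => exact ⟨hx₀, hr₀⟩
  | succ k ih =>
    rw [run, step_xt, step_rt]
    exact ⟨setBlock_mem_edom hA.f_proper.2 ih.1
        (hA.proxX_spec hμf hf hσ hτ₀ (hτ k) (hβ k) (π.ρ k) _ _).1,
      setBlock_mem_edom hA.g_proper.2 ih.2
        (hA.proxR_spec hμg hg hτ₀ (hτ k) (hγ k) (π.ρ k) _ _).1⟩

end Standing

/-- The Lagrangian gap is nonnegative and controls the objective gap. -/
lemma lyapGap_facts (hA : Pb.Standing Lh) {c ρ₀ u M fb gb : ℝ} {xs : Block p} {ys : Block d}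
    (hρ₀ : 0 < ρ₀) (hLip : LipschitzAt M Pb.gSum (Pb.K '' edom Pb.fSum))
    (hys : ∀ x ∈ edom Pb.fSum, ∀ r ∈ edom Pb.gSum,
      Pb.FR xs ≤ Pb.fR x + Pb.h x + Pb.gR r + inner ℝ ys (Pb.K x - r))
    {s : State p d} (hx : s.x ∈ edom Pb.fSum) (hr : s.r ∈ edom Pb.gSum)
    (hfb : Pb.fR s.x ≤ fb) (hgb : Pb.gR s.r ≤ gb) :
    0 ≤ fb + gb + Pb.h s.x + inner ℝ ys (Pb.resid s) - Pb.FR xs ∧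
      ρ₀ * u ^ 2 / (2 * c ^ 2) * ‖Pb.resid s‖ ^ 2 ≤ Pb.lyapGap c ρ₀ xs ys u fb gb s ∧
      Pb.FR s.x - Pb.FR xs ≤ Pb.lyapGap c ρ₀ xs ys u fb gb s + (M + ‖ys‖) * ‖Pb.resid s‖ := by
  have h0 : 0 ≤ fb + gb + Pb.h s.x + inner ℝ ys (Pb.resid s) - Pb.FR xs := by
    have := hys s.x hx s.r hr
    rw [resid]
    linarith
  refine ⟨h0, by rw [lyapGap]; linarith, ?_⟩
  -- Passing from g(r) to g(K x) costs M‖Z‖, and dropping ⟨y⋆, Z⟩ from the gap costs at most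
  -- ‖y⋆‖‖Z‖.
  have h1 := hA.gR_map_le hLip hx hr
  have h2 := (abs_le.1 (abs_real_inner_le_norm ys (Pb.resid s))).1
  have h3 : 0 ≤ ρ₀ * u ^ 2 / (2 * c ^ 2) * ‖Pb.resid s‖ ^ 2 := by positivity
  have h4 : Pb.FR s.x = Pb.fR s.x + Pb.h s.x + Pb.gR (Pb.K s.x) := rfl
  change Pb.gR (Pb.K s.x) ≤ Pb.gR s.r + M * ‖Pb.resid s‖ at h1
  rw [lyapGap]
  linarith

end Problem

lemma tauZero_eq {m n : ℕ} [NeZero m] [NeZero n] {qhat : Fin m → ℝ} {q : Fin n → ℝ}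
    (hqhat : ∀ i, qhat i = 1 / m) (hq : ∀ j, q j = 1 / n) :
    tauZero qhat q = min (1 / (m : ℝ)) (1 / (n : ℝ)) := by
  simp only [tauZero, hqhat, hq, ciInf_const]

/-- The variance is nonnegative. -/
lemma sq_integral_le {Ω : Type*} [MeasurableSpace Ω] {P : Measure Ω} [IsProbabilityMeasure P]
    {X : Ω → ℝ} (h1 : Integrable X P) (h2 : Integrable (fun ω => X ω ^ 2) P) :
    (∫ ω, X ω ∂P) ^ 2 ≤ ∫ ω, X ω ^ 2 ∂P := by
  set a := ∫ ω, X ω ∂P with ha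
  have h3 : 0 ≤ ∫ ω, (X ω - a) ^ 2 ∂P := integral_nonneg fun ω => sq_nonneg _
  have e : ∀ ω, (X ω - a) ^ 2 = X ω ^ 2 - (2 * a * X ω - a ^ 2) := fun ω => by ring
  simp_rw [e] at h3
  have hi : Integrable (fun ω => 2 * a * X ω - a ^ 2) P :=
    (h1.const_mul _).sub (integrable_const _)
  rw [integral_sub h2 hi,
    integral_sub (h1.const_mul _) (integrable_const _), integral_const_mul, integral_const,
    probReal_univ, one_smul, ← ha] at h3
  linarith

/-! ### Bounds in expectation along the run. -/

namespace Problem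

variable {m n : ℕ} {p : Fin n → ℕ} {d : Fin m → ℕ} {Pb : Problem p d}
  {Lh μf σ : Fin n → ℝ} {μg : Fin m → ℝ}

/-- The weights of the Lyapunov function are nonnegative. -/
lemma lyapGap_le_lyap (hA : Pb.Standing Lh) (hσ : ∀ j, 0 < σ j) {c τ₀ ρ₀ u fb gb : ℝ}
    (hc : 0 < c) (hτ₀ : 0 < τ₀) (hρ₀ : 0 < ρ₀) (hu : 0 ≤ u) (hμ : 0 ≤ muSigma σ μf)
    (hμ' : 0 ≤ muMin μg) (xs : Block p) (ys : Block d) (s : State p d) :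
    u ^ 2 / c ^ 2 * Pb.lyapGap c ρ₀ xs ys u fb gb s
      ≤ Pb.lyap Lh μf σ μg c τ₀ ρ₀ xs ys u fb gb s := by
  have hL0 := hA.LhSigma_nonneg hσ
  have hLb0 := Pb.Lbar_nonneg σ
  have h1 : 0 ≤ wnormSq (fun j => σ j / (1 / (n : ℝ))) (s.xt - xs) :=
    wnormSq_nonneg (fun j => div_nonneg (hσ j).le (by positivity)) _
  have h2 : 0 ≤ wnormSq (fun _ => 1 / (1 / (m : ℝ))) (s.rt - Pb.K xs) :=
    wnormSq_nonneg (fun j => by positivity) _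
  have h3 : 0 ≤ τ₀ / 2 * (LhSigma σ Lh + 4 * ρ₀ * Pb.Lbar σ * (u ^ 2 / c ^ 2)
      + muSigma σ μf * (u / c)) * wnormSq (fun j => σ j / (1 / (n : ℝ))) (s.xt - xs) := by
    positivity
  have h4 : 0 ≤ τ₀ / 2 * (4 * ρ₀ * (u ^ 2 / c ^ 2) + muMin μg * (u / c))
      * wnormSq (fun _ => 1 / (1 / (m : ℝ))) (s.rt - Pb.K xs) := by
    positivity
  have h5 : 0 ≤ 1 / ρ₀ * ‖s.yhat - ys‖ ^ 2 := by positivity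
  rw [lyap]
  linarith

/-- The expected Lagrangian gap `e`: nonnegativity, summability and rate, and its control of the
expected objective gap. -/
lemma expectation_bounds [NeZero m] [NeZero n] (hA : Pb.Standing Lh)
    (hμf : ∀ j, 0 < μf j) (hf : ∀ j, EStrongConvex (μf j) (Pb.f j))
    (hμg : ∀ i, 0 < μg i) (hg : ∀ i, EStrongConvex (μg i) (Pb.g i))
    (hσ : ∀ j, 0 < σ j) (hLL : 0 < LhSigma σ Lh + Pb.Lbar σ)
    {qhat : Fin m → ℝ} (hqhat : ∀ i, qhat i = 1 / m) {q : Fin n → ℝ} (hq : ∀ j, q j = 1 / n)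
    {c : ℝ} (hc : 2 ≤ c) (hcτ : 2 < c * tauZero qhat q)
    {ρ₀ : ℝ} (hρ₀ : 0 < ρ₀) (hρg : ρ₀ ≤ muMin μg / 8)
    (hρf : ρ₀ * Pb.Lbar σ ≤ muSigma σ μf / 8) {M : ℝ} (hM : 0 ≤ M)
    (hLip : LipschitzAt M Pb.gSum (Pb.K '' edom Pb.fSum))
    {x₀ : Block p} (hx₀ : x₀ ∈ edom Pb.fSum) (y₀ : Block d)
    {Ω : Type*} [MeasurableSpace Ω] {P : Measure Ω} [IsProbabilityMeasure P]
    {I : ℕ → Ω → Fin m} {J : ℕ → Ω → Fin n} (hIJ : IsSampling P qhat q I J)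
    {x : ℕ → Ω → Block p}
    (hx : ∀ k ω, x k ω = (Pb.run σ (tauZero qhat q)
      (strongParams c (tauZero qhat q) ρ₀ (LhSigma σ Lh) (Pb.Lbar σ))
      x₀ y₀ (fun l => (I l ω, J l ω)) k).x)
    {xs : Block p} (hxs : xs ∈ edom Pb.fSum) {ys : Block d}
    (hys : ∀ x ∈ edom Pb.fSum, ∀ r ∈ edom Pb.gSum,
      Pb.FR xs ≤ Pb.fR x + Pb.h x + Pb.gR r + inner ℝ ys (Pb.K x - r)) :
    (∀ k ω, x k ω ∈ edom Pb.fSum) ∧ (∀ k, Integrable (fun ω => Pb.FR (x k ω)) P) ∧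
    ∃ e : ℕ → ℝ, (∀ k, 0 ≤ e k) ∧ Summable (fun k : ℕ => (k : ℝ) * e k) ∧
      (∀ k : ℕ, 1 ≤ k → ((k : ℝ) + c - 1) ^ 2 / c ^ 2 * e k ≤
        Pb.FR x₀ - Pb.FR xs + 1 / ρ₀ * ‖y₀ - ys‖ ^ 2
          + (LhSigma σ Lh + 4 * ρ₀ * Pb.Lbar σ + muSigma σ μf) * tauZero qhat q / 2
            * wnormSq (fun j => σ j / q j) (x₀ - xs)
          + tauZero qhat q * (4 * ρ₀ + muMin μg) / 2
            * wnormSq (fun i => 1 / qhat i) (Pb.K (x₀ - xs))) ∧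
      ∀ k : ℕ, 1 ≤ k → ∫ ω, (Pb.FR (x k ω) - Pb.FR xs) ∂P
        ≤ e k + (M + ‖ys‖) * (√(2 / ρ₀) * (c / ((k : ℝ) + c - 1)) * √(e k)) := by
  have hn : (0 : ℝ) < n := by exact_mod_cast Nat.pos_of_neZero n
  have hm : (0 : ℝ) < m := by exact_mod_cast Nat.pos_of_neZero m
  have hq' : q = fun _ => 1 / (n : ℝ) := funext hq
  have hqhat' : qhat = fun _ => 1 / (m : ℝ) := funext hqhat
  have hτeq := tauZero_eq hqhat hq
  set τ₀ := tauZero qhat q with hτ₀def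
  have hτ₀ : 0 < τ₀ := by rw [hτeq]; exact lt_min (by positivity) (by positivity)
  have hτ₀m : τ₀ ≤ 1 / (m : ℝ) := by rw [hτeq]; exact min_le_left _ _
  have hτ₀n : τ₀ ≤ 1 / (n : ℝ) := by rw [hτeq]; exact min_le_right _ _
  have hτ₀1 : τ₀ ≤ 1 := by
    refine hτ₀n.trans ((div_le_one hn).2 ?_)
    exact_mod_cast Nat.one_le_iff_ne_zero.2 (NeZero.ne n)
  set π := strongParams c τ₀ ρ₀ (LhSigma σ Lh) (Pb.Lbar σ) with hπ
  have hc0 : 0 < c := by linarith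
  have hkc : ∀ k : ℕ, c ≤ (k : ℝ) + c := fun k => by
    have : (0 : ℝ) ≤ k := Nat.cast_nonneg k
    linarith
  have hkc0 : ∀ k : ℕ, 0 < (k : ℝ) + c := fun k => hc0.trans_le (hkc k)
  have hL0 := hA.LhSigma_nonneg hσ
  have hLb0 := Pb.Lbar_nonneg σ
  have hμ : 0 ≤ muSigma σ μf := by
    have : 0 ≤ ρ₀ * Pb.Lbar σ := by positivity
    linarith
  have hμ' : 0 ≤ muMin μg := by linarith
  have hτk : ∀ k, π.τ k = c * τ₀ / (k + c) := fun k => rfl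
  have hτpos : ∀ k, 0 < π.τ k := fun k => by rw [hτk]; have := hkc0 k; positivity
  have hρk : ∀ k, π.ρ k = ρ₀ * τ₀ ^ 2 / π.τ k ^ 2 := fun k => rfl
  have hρpos : ∀ k, 0 < π.ρ k := fun k => by rw [hρk]; have := hτpos k; positivity
  have hγk : ∀ k, π.γ k = 1 / (4 * π.ρ k) := fun k => rfl
  have hγpos : ∀ k, 0 < π.γ k := fun k => by rw [hγk]; have := hρpos k; positivity
  have hβk : ∀ k, π.β k = 1 / (LhSigma σ Lh + 4 * Pb.Lbar σ * π.ρ k) := fun k => rfl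
  have hβpos : ∀ k, 0 < π.β k := fun k => by
    have := hρpos k
    rw [hβk]
    apply one_div_pos.2
    rcases hLb0.eq_or_lt with h | h
    · rw [← h] at hLL ⊢
      linarith
    · positivity
  have hr₀ : Pb.K x₀ ∈ edom Pb.gSum := hA.map_mem_edom hLip hx₀
  have hrs : Pb.K xs ∈ edom Pb.gSum := hA.map_mem_edom hLip hxs
  have hdom := hA.run_mem_edom (x₀ := x₀) (y₀ := y₀) hμf hf hμg hg hσ hτ₀ hτpos hβpos hγpos hx₀ hr₀
  have hjx : ∀ idx k, (Pb.run σ τ₀ π x₀ y₀ idx k).x ∈ edom Pb.fSum ∧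
      Pb.fR (Pb.run σ τ₀ π x₀ y₀ idx k).x ≤ Pb.fBar σ τ₀ π x₀ y₀ idx k := fun idx k => by
    rw [run_x_eq]
    exact ConvexOn.le_avgSeq hA.fR_convexOn hτ₀ hτ₀1 (by linarith) hτk (fun l => (hdom idx l).1) k
  have hjr : ∀ idx k, (Pb.run σ τ₀ π x₀ y₀ idx k).r ∈ edom Pb.gSum ∧
      Pb.gR (Pb.run σ τ₀ π x₀ y₀ idx k).r ≤ Pb.gBar σ τ₀ π x₀ y₀ idx k := fun idx k => by
    rw [run_r_eq]
    exact ConvexOn.le_avgSeq hA.gR_convexOn hτ₀ hτ₀1 (by linarith) hτk (fun l => (hdom idx l).2) k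
  have hgap := fun (u : ℝ) idx k => lyapGap_facts (c := c) (u := u) hA hρ₀ hLip hys
    (hjx idx k).1 (hjr idx k).1 (hjx idx k).2 (hjr idx k).2
  let smp : Ω → ℕ → Fin m × Fin n := fun ω l => (I l ω, J l ω)
  -- Time k carries the scale k + c - 1, since the step leading to it is step k - 1, whose scale is
  -- t = (k - 1) + c.
  let gap : ℕ → (ℕ → Fin m × Fin n) → ℝ := fun k idx =>
    Pb.lyapGap c ρ₀ xs ys ((k : ℝ) + c - 1) (Pb.fBar σ τ₀ π x₀ y₀ idx k)
      (Pb.gBar σ τ₀ π x₀ y₀ idx k) (Pb.run σ τ₀ π x₀ y₀ idx k)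
  let L : ℕ → (ℕ → Fin m × Fin n) → ℝ := fun k idx =>
    Pb.lyap Lh μf σ μg c τ₀ ρ₀ xs ys ((k : ℝ) + c - 1) (Pb.fBar σ τ₀ π x₀ y₀ idx k)
      (Pb.gBar σ τ₀ π x₀ y₀ idx k) (Pb.run σ τ₀ π x₀ y₀ idx k)
  have hgapdep : ∀ k, DependsOn (gap k) (Set.Iio k) := fun k =>
    dependsOn_run (fun a b s => Pb.lyapGap c ρ₀ xs ys ((k : ℝ) + c - 1) a b s) k
  have hLdep : ∀ k, DependsOn (L k) (Set.Iio k) := fun k =>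
    dependsOn_run (fun a b s => Pb.lyap Lh μf σ μg c τ₀ ρ₀ xs ys ((k : ℝ) + c - 1) a b s) k
  have hgapint : ∀ k, Integrable (fun ω => gap k (smp ω)) P := fun k => hIJ.integrable (hgapdep k)
  have hLint : ∀ k, Integrable (fun ω => L k (smp ω)) P := fun k => hIJ.integrable (hLdep k)
  have hu0 : ∀ k : ℕ, 0 < (k : ℝ) + c - 1 := fun k => by have := hkc k; linarith
  have hgap0 : ∀ k idx, 0 ≤ gap k idx := fun k idx => by
    have h := (hgap ((k : ℝ) + c - 1) idx k).2.1
    refine le_trans ?_ h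
    positivity
  have hLgap : ∀ (k : ℕ) idx, ((k : ℝ) + c - 1) ^ 2 / c ^ 2 * gap k idx ≤ L k idx := fun k idx =>
    lyapGap_le_lyap hA hσ hc0 hτ₀ hρ₀ (hu0 k).le hμ hμ' xs ys _
  have havg := fun (k : ℕ) idx => hA.average_lyap_le hμf hf hμg hg hσ hLL hc0 hτ₀ hτ₀m hτ₀n hτ₀1 hρ₀
    (hkc k) (hτk k) (hρk k) (hβk k) (hγk k) (Pb.run σ τ₀ π x₀ y₀ idx k) (hdom idx k).1
    (hdom idx k).2 (Pb.fBar σ τ₀ π x₀ y₀ idx k) (Pb.gBar σ τ₀ π x₀ y₀ idx k) hxs hrs ys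
  have hupd : ∀ (k : ℕ) idx i j, L (k + 1) (Function.update idx k (i, j)) =
      Pb.lyap Lh μf σ μg c τ₀ ρ₀ xs ys ((k : ℝ) + c)
        ((1 - π.τ k) * Pb.fBar σ τ₀ π x₀ y₀ idx k + π.τ k * Pb.fR (Pb.run σ τ₀ π x₀ y₀ idx k).xt
          + π.τ k / τ₀ * (Pb.fR (Pb.step σ τ₀ (π.τ k) (π.ρ k) (π.γ k) (π.β k) (π.ρ k / 2) i j
            (Pb.run σ τ₀ π x₀ y₀ idx k)).xt - Pb.fR (Pb.run σ τ₀ π x₀ y₀ idx k).xt))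
        ((1 - π.τ k) * Pb.gBar σ τ₀ π x₀ y₀ idx k + π.τ k * Pb.gR (Pb.run σ τ₀ π x₀ y₀ idx k).rt
          + π.τ k / τ₀ * (Pb.gR (Pb.step σ τ₀ (π.τ k) (π.ρ k) (π.γ k) (π.β k) (π.ρ k / 2) i j
            (Pb.run σ τ₀ π x₀ y₀ idx k)).rt - Pb.gR (Pb.run σ τ₀ π x₀ y₀ idx k).rt))
        (Pb.step σ τ₀ (π.τ k) (π.ρ k) (π.γ k) (π.β k) (π.ρ k / 2) i j
            (Pb.run σ τ₀ π x₀ y₀ idx k)) := by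
    intro k idx i j
    have e : ((k + 1 : ℕ) : ℝ) + c - 1 = (k : ℝ) + c := by push_cast; ring
    simp only [L]
    rw [e, run_update, fBar_update, gBar_update]
    rfl
  have hWn : ∀ s : State p d, 0 ≤ wnormSq (fun j => σ j / (1 / (n : ℝ))) (s.xt - xs) := fun s =>
    wnormSq_nonneg (fun j => div_nonneg (hσ j).le (by positivity)) _
  have hWm : ∀ s : State p d, 0 ≤ wnormSq (fun _ => 1 / (1 / (m : ℝ))) (s.rt - Pb.K xs) := fun s =>
    wnormSq_nonneg (fun j => by positivity) _
  have hdec : ∀ k : ℕ, 1 ≤ k → ∫ ω, L (k + 1) (smp ω) ∂P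
      + (c * τ₀ - 2) / c ^ 2 * ((k : ℝ) + c) * ∫ ω, gap k (smp ω) ∂P
      ≤ ∫ ω, L k (smp ω) ∂P := by
    intro k hk
    have hk1 : (1 : ℝ) ≤ k := by exact_mod_cast hk
    have h := hIJ.integral_le_of_average_le hqhat hq (hLdep (k + 1))
      (Ψ := fun idx => L k idx - (c * τ₀ - 2) / c ^ 2 * ((k : ℝ) + c) * gap k idx)
      (fun a b hab => by simp only [hLdep k hab, hgapdep k hab]) (fun idx => by
        simp only [hupd]
        refine (havg k idx).trans ?_
        -- The first component of `hgap` does not involve the scale, so the value 0 given to it is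
        -- immaterial.
        have hsc := scale_step_le (t := (k : ℝ) + c) (a := 1 / (n : ℝ)) (a' := 1 / (m : ℝ))
          (Y := 1 / ρ₀ * ‖(Pb.run σ τ₀ π x₀ y₀ idx k).yhat - ys‖ ^ 2) (Lσ := LhSigma σ Lh)
          hc hcτ hτ₀ hτ₀1 hρ₀ hρf hρg
          (by linarith) hτ₀n hτ₀m hLb0 (hgap 0 idx k).1
          (sq_nonneg ‖Pb.resid (Pb.run σ τ₀ π x₀ y₀ idx k)‖)
          (hWn (Pb.run σ τ₀ π x₀ y₀ idx k)) (hWm (Pb.run σ τ₀ π x₀ y₀ idx k))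
        simp only [L, gap, lyap, lyapGap]
        linarith)
    have h2 : ∫ ω, (L k (smp ω) - (c * τ₀ - 2) / c ^ 2 * ((k : ℝ) + c) * gap k (smp ω)) ∂P
        = ∫ ω, L k (smp ω) ∂P
          - (c * τ₀ - 2) / c ^ 2 * ((k : ℝ) + c) * ∫ ω, gap k (smp ω) ∂P := by
      rw [integral_sub (hLint k) ((hgapint k).const_mul _), integral_const_mul]
    have h3 := h.trans_eq h2
    linarith
  set E0 := Pb.FR x₀ - Pb.FR xs + 1 / ρ₀ * ‖y₀ - ys‖ ^ 2
          + (LhSigma σ Lh + 4 * ρ₀ * Pb.Lbar σ + muSigma σ μf) * τ₀ / 2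
            * wnormSq (fun j => σ j / q j) (x₀ - xs)
          + τ₀ * (4 * ρ₀ + muMin μg) / 2
            * wnormSq (fun i => 1 / qhat i) (Pb.K (x₀ - xs)) with hE0
  -- The first step is bounded directly: at k = 0 the scale is t = c, so the coefficients collapse
  -- to those of `E0`. The residual starts at zero, and the leftover terms with τ₀ and the strong
  -- convexity constants have a favourable sign.
  have hL1 : ∫ ω, L 1 (smp ω) ∂P ≤ E0 := by
    have h := hIJ.integral_le_of_average_le hqhat hq (hLdep 1) (Ψ := fun _ => E0)
      (fun a b hab => rfl) (fun idx => by
        have hupd0 := hupd 0 idx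
        simp only [zero_add] at hupd0
        simp only [hupd0]
        refine (havg 0 idx).trans ?_
        have hres : Pb.resid (Pb.run σ τ₀ π x₀ y₀ idx 0) = 0 := sub_self _
        have hS : Pb.fBar σ τ₀ π x₀ y₀ idx 0 + Pb.gBar σ τ₀ π x₀ y₀ idx 0
            + Pb.h (Pb.run σ τ₀ π x₀ y₀ idx 0).x = Pb.FR x₀ := by
          simp only [fBar, gBar, avgSeq, run, FR]
          ring
        have hS0 := (hgap 0 idx 0).1
        rw [hS, hres, inner_zero_right, add_zero] at hS0
        rw [hS, hres, inner_zero_right, norm_zero]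
        have hW0 := hWn (Pb.run σ τ₀ π x₀ y₀ idx 0)
        have hR0 := hWm (Pb.run σ τ₀ π x₀ y₀ idx 0)
        have e1 : wnormSq (fun j => σ j / q j) (x₀ - xs)
            = wnormSq (fun j => σ j / (1 / (n : ℝ))) ((Pb.run σ τ₀ π x₀ y₀ idx 0).xt - xs) := by
          rw [hq']; rfl
        have e2 : wnormSq (fun i => 1 / qhat i) (Pb.K (x₀ - xs))
            = wnormSq (fun _ => 1 / (1 / (m : ℝ)))
              ((Pb.run σ τ₀ π x₀ y₀ idx 0).rt - Pb.K xs) := by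
          rw [hqhat', map_sub]; rfl
        have e3 : (Pb.run σ τ₀ π x₀ y₀ idx 0).yhat = y₀ := rfl
        rw [hE0, e1, e2, e3]
        have d1 : (c ^ 2 / c ^ 2 : ℝ) = 1 := div_self (by positivity)
        have d2 : (c / c : ℝ) = 1 := div_self hc0.ne'
        have d3 : τ₀ * c / c = τ₀ := by field_simp
        rw [Nat.cast_zero, zero_add, d1, d2, d3]
        have f1 : 0 ≤ τ₀ * (Pb.FR x₀ - Pb.FR xs) := mul_nonneg hτ₀.le (by linarith)
        have f2 : 0 ≤ τ₀ / 2 * (muSigma σ μf * (1 / (n : ℝ)))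
          * wnormSq (fun j => σ j / (1 / (n : ℝ))) ((Pb.run σ τ₀ π x₀ y₀ idx 0).xt - xs) := by
          positivity
        have f3 : 0 ≤ τ₀ / 2 * (muMin μg * (1 / (m : ℝ)))
          * wnormSq (fun _ => 1 / (1 / (m : ℝ))) ((Pb.run σ τ₀ π x₀ y₀ idx 0).rt - Pb.K xs) := by
          positivity
        linarith)
    simpa using h
  have hLgapI : ∀ k : ℕ, ((k : ℝ) + c - 1) ^ 2 / c ^ 2 * ∫ ω, gap k (smp ω) ∂P
      ≤ ∫ ω, L k (smp ω) ∂P := fun k => by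
    rw [← integral_const_mul]
    exact integral_mono ((hgapint k).const_mul _) (hLint k) fun ω => hLgap k _
  have he0 : ∀ k, 0 ≤ ∫ ω, gap k (smp ω) ∂P := fun k => integral_nonneg fun ω => hgap0 k _
  have hL0' : ∀ k, 0 ≤ ∫ ω, L k (smp ω) ∂P := fun k =>
    le_trans (mul_nonneg (by positivity) (he0 k)) (hLgapI k)
  have hδ : 0 < (c * τ₀ - 2) / c ^ 2 := by
    have : 0 < c * τ₀ - 2 := by linarith
    positivity
  have hLle : ∀ k : ℕ, 1 ≤ k → ∫ ω, L k (smp ω) ∂P ≤ E0 := by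
    intro k hk
    induction k, hk using Nat.le_induction with
    | base => exact hL1
    | succ k hk ih =>
      have h1 := hdec k hk
      have h2 := he0 k
      have h3 := hkc0 k
      have : 0 ≤ (c * τ₀ - 2) / c ^ 2 * ((k : ℝ) + c) * ∫ ω, gap k (smp ω) ∂P := by positivity
      linarith
  have hxeq : ∀ k ω, x k ω = (Pb.run σ τ₀ π x₀ y₀ (smp ω) k).x := hx
  have hFint : ∀ k, Integrable (fun ω => Pb.FR (x k ω)) P := fun k => by
    simp only [hxeq]
    exact hIJ.integrable (dependsOn_run (fun _ _ s => Pb.FR s.x) k)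
  refine ⟨fun k ω => by rw [hxeq]; exact (hjx _ k).1, hFint,
    fun k => ∫ ω, gap k (smp ω) ∂P, he0, ?_, fun k hk => (hLgapI k).trans (hLle k hk),
    fun k hk => ?_⟩
  · have hs := summable_of_add_le (a := fun k => ∫ ω, L (k + 1) (smp ω) ∂P)
      (b := fun k => (c * τ₀ - 2) / c ^ 2 * (((k + 1 : ℕ) : ℝ) + c) * ∫ ω, gap (k + 1) (smp ω) ∂P)
      (fun k => hL0' _) (fun k => mul_nonneg (mul_nonneg hδ.le (hkc0 _).le) (he0 _))
      (fun k => hdec (k + 1) (by omega))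
    rw [← summable_nat_add_iff 1]
    refine Summable.of_nonneg_of_le (fun k => mul_nonneg (Nat.cast_nonneg _) (he0 _)) (fun k => ?_)
      (hs.mul_left (1 / ((c * τ₀ - 2) / c ^ 2)))
    rw [← mul_assoc, ← mul_assoc, one_div_mul_cancel hδ.ne', one_mul]
    exact mul_le_mul_of_nonneg_right (by linarith) (he0 _)
  · set u := (k : ℝ) + c - 1 with hu
    have hupos : 0 < u := hu0 k
    have hZdep : DependsOn (fun idx => ‖Pb.resid (Pb.run σ τ₀ π x₀ y₀ idx k)‖) (Set.Iio k) :=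
      dependsOn_run (fun _ _ s => ‖Pb.resid s‖) k
    have hZint := hIJ.integrable hZdep
    -- The penalty part of the gap at scale u bounds the squared residual. Taking expectations and
    -- Jensen's inequality moves the square root outside the integral.
    have hroot : ∀ idx, ‖Pb.resid (Pb.run σ τ₀ π x₀ y₀ idx k)‖ ^ 2
        ≤ 2 / ρ₀ * (c / u) ^ 2 * gap k idx := fun idx => by
      have h := (hgap u idx k).2.1
      have e : ‖Pb.resid (Pb.run σ τ₀ π x₀ y₀ idx k)‖ ^ 2 = 2 / ρ₀ * (c / u) ^ 2
          * (ρ₀ * u ^ 2 / (2 * c ^ 2) * ‖Pb.resid (Pb.run σ τ₀ π x₀ y₀ idx k)‖ ^ 2) := by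
        field_simp
      rw [e]
      exact mul_le_mul_of_nonneg_left h (by positivity)
    have hZ : ∫ ω, ‖Pb.resid (Pb.run σ τ₀ π x₀ y₀ (smp ω) k)‖ ∂P
        ≤ √(2 / ρ₀) * (c / u) * √(∫ ω, gap k (smp ω) ∂P) := by
      have hZ2dep : DependsOn (fun idx => ‖Pb.resid (Pb.run σ τ₀ π x₀ y₀ idx k)‖ ^ 2)
          (Set.Iio k) := dependsOn_run (fun _ _ s => ‖Pb.resid s‖ ^ 2) k
      have h1 : (∫ ω, ‖Pb.resid (Pb.run σ τ₀ π x₀ y₀ (smp ω) k)‖ ∂P) ^ 2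
          ≤ ∫ ω, ‖Pb.resid (Pb.run σ τ₀ π x₀ y₀ (smp ω) k)‖ ^ 2 ∂P := by
        exact sq_integral_le hZint (hIJ.integrable hZ2dep)
      have h2 : ∫ ω, ‖Pb.resid (Pb.run σ τ₀ π x₀ y₀ (smp ω) k)‖ ^ 2 ∂P
          ≤ 2 / ρ₀ * (c / u) ^ 2 * ∫ ω, gap k (smp ω) ∂P := by
        rw [← integral_const_mul]
        exact integral_mono (hIJ.integrable hZ2dep) ((hgapint k).const_mul _) fun ω => hroot _
      have h3 := Real.sqrt_le_sqrt (h1.trans h2)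
      rw [Real.sqrt_sq (integral_nonneg fun ω => norm_nonneg _),
        Real.sqrt_mul (by positivity), Real.sqrt_mul (by positivity),
        Real.sqrt_sq (by positivity)] at h3
      exact h3
    have hbound : ∫ ω, (Pb.FR (x k ω) - Pb.FR xs) ∂P ≤ ∫ ω, (gap k (smp ω)
        + (M + ‖ys‖) * ‖Pb.resid (Pb.run σ τ₀ π x₀ y₀ (smp ω) k)‖) ∂P :=
      integral_mono ((hFint k).sub (integrable_const _))
        ((hgapint k).add (hZint.const_mul _)) fun ω => by
          simp only [hxeq]
          exact (hgap u (smp ω) k).2.2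
    refine hbound.trans ?_
    rw [integral_add (hgapint k) (hZint.const_mul _), integral_const_mul]
    have := mul_le_mul_of_nonneg_left hZ (show 0 ≤ M + ‖ys‖ by positivity)
    linarith

end Problem

end RandPD

/-! ### Assembly of the rate and the liminf statement. -/

theorem theoremF2 {m n : ℕ} [NeZero m] [NeZero n] {p : Fin n → ℕ} {d : Fin m → ℕ}
    (Pb : RandPD.Problem p d) (Lh μf σ : Fin n → ℝ) (μg : Fin m → ℝ)
    (hA : Pb.Standing Lh)
    -- strong convexity of `f` and `g`
    (hμf : ∀ j, 0 < μf j) (hf : ∀ j, RandPD.EStrongConvex (μf j) (Pb.f j))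
    (hμg : ∀ i, 0 < μg i) (hg : ∀ i, RandPD.EStrongConvex (μg i) (Pb.g i))
    (hσ : ∀ j, 0 < σ j)
    -- the step sizes `β_k` are well defined
    (hβ : 0 < RandPD.LhSigma σ Lh + Pb.Lbar σ)
    -- uniform sampling
    (qhat : Fin m → ℝ) (hqhat : ∀ i, qhat i = 1 / m)
    (q : Fin n → ℝ) (hq : ∀ j, q j = 1 / n)
    -- parameters
    (c : ℝ) (hc : 2 ≤ c) (hcτ : 2 < c * RandPD.tauZero qhat q)
    (ρ₀ : ℝ) (hρ₀ : 0 < ρ₀) (hρg : ρ₀ ≤ RandPD.muMin μg / 8)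
    (hρf : ρ₀ * Pb.Lbar σ ≤ RandPD.muSigma σ μf / 8)
    -- Lipschitz continuity of `g`
    (M : ℝ) (hM : 0 ≤ M) (hLip : RandPD.LipschitzAt M Pb.gSum (Pb.K '' RandPD.edom Pb.fSum))
    -- initial point and random indices
    (x₀ : RandPD.Block p) (hx₀ : x₀ ∈ RandPD.edom Pb.fSum) (y₀ : RandPD.Block d)
    {Ω : Type*} [MeasurableSpace Ω] (P : Measure Ω) [IsProbabilityMeasure P]
    (I : ℕ → Ω → Fin m) (J : ℕ → Ω → Fin n) (hIJ : RandPD.IsSampling P qhat q I J)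
    -- the iterates `x^k`
    (x : ℕ → Ω → RandPD.Block p)
    (hx : ∀ k ω, x k ω = (Pb.run σ (RandPD.tauZero qhat q)
      (RandPD.strongParams c (RandPD.tauZero qhat q) ρ₀ (RandPD.LhSigma σ Lh) (Pb.Lbar σ))
      x₀ y₀ (fun l => (I l ω, J l ω)) k).x) :
    (∀ k, (∀ᵐ ω ∂P, Pb.F (x k ω) < ⊤) ∧ Integrable (fun ω => (Pb.F (x k ω)).toReal) P) ∧
    (∀ xs ∈ Pb.primalSol, ∀ ys ∈ Pb.dualSol, ∀ k : ℕ,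
      ∫ ω, ((Pb.F (x k ω)).toReal - Pb.Fstar.toReal) ∂P ≤
        (c ^ 2 * Pb.E0sq σ Lh μf μg qhat q ρ₀ x₀ xs y₀ ys
          + c ^ 2 * (M + ‖ys‖) * √(Pb.E0sq σ Lh μf μg qhat q ρ₀ x₀ xs y₀ ys) * √(2 / ρ₀))
          / (k + c - 1) ^ 2) ∧
    liminf (fun k : ℕ => (((k : ℝ) ^ 2 * √(Real.log k) *
      ∫ ω, ((Pb.F (x k ω)).toReal - Pb.Fstar.toReal) ∂P : ℝ) : EReal)) atTop = 0 ∧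
    RandPD.SmallOLiminf (fun k => (∫ ω, (Pb.F (x k ω)).toReal ∂P) - Pb.Fstar.toReal)
      (fun k => 1 / ((k : ℝ) ^ 2 * √(Real.log k))) := by
  have hFR : ∀ z ∈ RandPD.edom Pb.fSum, Pb.F z = (Pb.FR z : EReal) := fun z hz =>
    hA.F_eq hz (hA.map_mem_edom hLip hz)
  have hbounds := fun (xs : RandPD.Block p) (hxs : xs ∈ RandPD.edom Pb.fSum)
    (ys : RandPD.Block d) => RandPD.Problem.expectation_bounds (ys := ys) hA hμf hf hμg hg hσ hβ
      hqhat hq hc hcτ hρ₀ hρg hρf hM hLip hx₀ y₀ hIJ hx hxs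
  obtain ⟨xs₀, hxs₀⟩ := hA.sol_nonempty
  -- For the liminf any multiplier will do, so no element of the dual solution set is needed here.
  obtain ⟨ys₀, hys₀⟩ := hA.exists_dual_multiplier hxs₀
  obtain ⟨hdom, hint, e, he0, hes, -, hev⟩ :=
    hbounds xs₀ (hA.mem_edom_of_mem_primalSol hxs₀).1 ys₀ hys₀
  have hval : ∀ k ω, (Pb.F (x k ω)).toReal = Pb.FR (x k ω) := fun k ω => by
    rw [hFR _ (hdom k ω), EReal.toReal_coe]
  have hstar : ∀ xs ∈ Pb.primalSol, Pb.Fstar.toReal = Pb.FR xs := fun xs hxs => by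
    rw [hA.Fstar_eq hxs, EReal.toReal_coe]
  have hle : ∀ xs ∈ Pb.primalSol, ∀ z ∈ RandPD.edom Pb.fSum, Pb.FR xs ≤ Pb.FR z :=
    fun xs hxs z hz => by
      have h := hxs z
      rw [hFR z hz, hFR xs (hA.mem_edom_of_mem_primalSol hxs).1] at h
      exact_mod_cast h
  have hint' : ∀ k, Integrable (fun ω => (Pb.F (x k ω)).toReal) P := fun k => by
    simp only [hval]
    exact hint k
  have hlim : liminf (fun k : ℕ => (((k : ℝ) ^ 2 * √(Real.log k) *
      ∫ ω, ((Pb.F (x k ω)).toReal - Pb.Fstar.toReal) ∂P : ℝ) : EReal)) atTop = 0 := by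
    simp only [hval, hstar xs₀ hxs₀]
    refine RandPD.liminf_coe_eq_zero (fun k => mul_nonneg (by positivity)
      (integral_nonneg fun ω => sub_nonneg.2 (hle xs₀ hxs₀ _ (hdom k ω)))) fun ε hε => ?_
    refine RandPD.frequently_lt_of_summable (C := (M + ‖ys₀‖) * (√(2 / ρ₀) * c))
      (by positivity) he0 hes (fun k hk => (hev k hk).trans ?_) hε
    have hk1 : (1 : ℝ) ≤ k := by exact_mod_cast hk
    have h1 : c / ((k : ℝ) + c - 1) ≤ c / k :=
      div_le_div_of_nonneg_left (by linarith) (by linarith) (by linarith)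
    have h2 : (M + ‖ys₀‖) * (√(2 / ρ₀) * c) / k * √(e k)
        = (M + ‖ys₀‖) * (√(2 / ρ₀) * (c / k) * √(e k)) := by ring
    rw [h2]
    gcongr
  refine ⟨fun k => ⟨ae_of_all _ fun ω => ?_, hint' k⟩, fun xs hxs ys hys k => ?_, hlim, ?_⟩
  · rw [hFR _ (hdom k ω)]
    exact EReal.coe_lt_top _
  · obtain ⟨-, -, e, he0, -, hrate, hev⟩ := hbounds xs (hA.mem_edom_of_mem_primalSol hxs).1 ys
      fun x hx r hr => hA.multiplier_of_mem_dualSol hxs hys hx hr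
    have hE : Pb.E0sq σ Lh μf μg qhat q ρ₀ x₀ xs y₀ ys = Pb.FR x₀ - Pb.FR xs
        + 1 / ρ₀ * ‖y₀ - ys‖ ^ 2
        + (RandPD.LhSigma σ Lh + 4 * ρ₀ * Pb.Lbar σ + RandPD.muSigma σ μf)
          * RandPD.tauZero qhat q / 2 * RandPD.wnormSq (fun j => σ j / q j) (x₀ - xs)
        + RandPD.tauZero qhat q * (4 * ρ₀ + RandPD.muMin μg) / 2
          * RandPD.wnormSq (fun i => 1 / qhat i) (Pb.K (x₀ - xs)) := by
      rw [RandPD.Problem.E0sq, hFR x₀ hx₀, EReal.toReal_coe, hstar xs hxs]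
    rw [← hE] at hrate
    simp only [hval, hstar xs hxs]
    set E := Pb.E0sq σ Lh μf μg qhat q ρ₀ x₀ xs y₀ ys with hEdef
    have hc0 : 0 < c := by linarith
    set N := M + ‖ys‖ with hN
    have hN0 : 0 ≤ N := by positivity
    -- The bounds in expectation start at k = 1. At k = 0 the objective gap is itself a summand of
    -- E, and (c - 1)² ≤ c² suffices.
    rcases Nat.eq_zero_or_pos k with rfl | hk
    · have hx0 : ∀ ω, x 0 ω = x₀ := fun ω => by rw [hx]; rfl
      simp only [hx0, integral_const, probReal_univ, one_smul, Nat.cast_zero, zero_add]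
      have hτ₀ : 0 < RandPD.tauZero qhat q := by
        by_contra h
        nlinarith
      have hLb := Pb.Lbar_nonneg σ
      have hL0 := hA.LhSigma_nonneg hσ
      have hμ : 0 ≤ RandPD.muSigma σ μf := by
        have : 0 ≤ ρ₀ * Pb.Lbar σ := by positivity
        linarith
      have hμ' : 0 ≤ RandPD.muMin μg := by linarith
      have hW : 0 ≤ RandPD.wnormSq (fun j => σ j / q j) (x₀ - xs) :=
        RandPD.wnormSq_nonneg (fun j => div_nonneg (hσ j).le (by rw [hq]; positivity)) _
      have hWr : 0 ≤ RandPD.wnormSq (fun i => 1 / qhat i) (Pb.K (x₀ - xs)) :=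
        RandPD.wnormSq_nonneg (fun i => by rw [hqhat]; positivity) _
      have h0 := hle xs hxs x₀ hx₀
      have hle1 : Pb.FR x₀ - Pb.FR xs ≤ E := by
        rw [hE]
        have h1 : 0 ≤ 1 / ρ₀ * ‖y₀ - ys‖ ^ 2 := by positivity
        have h2 : 0 ≤ (RandPD.LhSigma σ Lh + 4 * ρ₀ * Pb.Lbar σ + RandPD.muSigma σ μf)
          * RandPD.tauZero qhat q / 2 * RandPD.wnormSq (fun j => σ j / q j) (x₀ - xs) := by
          positivity
        have h3 : 0 ≤ RandPD.tauZero qhat q * (4 * ρ₀ + RandPD.muMin μg) / 2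
          * RandPD.wnormSq (fun i => 1 / qhat i) (Pb.K (x₀ - xs)) := by positivity
        linarith
      have hE0 : 0 ≤ E := by linarith
      refine hle1.trans ?_
      have hc1 : 0 < c - 1 := by linarith
      rw [le_div_iff₀ (by positivity)]
      have h4 : E * (c - 1) ^ 2 ≤ E * c ^ 2 := by
        apply mul_le_mul_of_nonneg_left _ hE0
        nlinarith
      have h5 : 0 ≤ c ^ 2 * N * √E * √(2 / ρ₀) := by positivity
      linarith
    · have hk1 : (1 : ℝ) ≤ k := by exact_mod_cast hk
      refine (hev k hk).trans ?_
      have hr := hrate k hk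
      set u := (k : ℝ) + c - 1 with hu
      have hu0 : 0 < u := by linarith
      have he : e k ≤ (c / u) ^ 2 * E := by
        have : e k = (c / u) ^ 2 * (u ^ 2 / c ^ 2 * e k) := by field_simp
        rw [this]
        exact mul_le_mul_of_nonneg_left hr (by positivity)
      have hs : √(e k) ≤ c / u * √E := by
        have := Real.sqrt_le_sqrt he
        rwa [Real.sqrt_mul (by positivity), Real.sqrt_sq (by positivity)] at this
      have h1 : N * (√(2 / ρ₀) * (c / u) * √(e k)) ≤ N * (√(2 / ρ₀) * (c / u) * (c / u * √E)) := by
        gcongr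
      have h2 : (c ^ 2 * E + c ^ 2 * N * √E * √(2 / ρ₀)) / u ^ 2
          = (c / u) ^ 2 * E + N * (√(2 / ρ₀) * (c / u) * (c / u * √E)) := by
        field_simp
      rw [h2]
      linarith
  -- Dividing by 1/w equals multiplying by w also when w = 0, which occurs for k ≤ 1, so the two
  -- sequences agree at every index.
  · unfold RandPD.SmallOLiminf
    refine Eq.trans ?_ hlim
    congr 1
    funext k
    rw [integral_sub (hint' k) (integrable_const _), integral_const, probReal_univ, one_smul,
      ← one_div_one_div ((k : ℝ) ^ 2 * √(Real.log k)), one_div_mul_eq_div]
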